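/- Let $\kappa$ be a regular cardinal, let $\lambda<\kappa$ be an infinite cardinal, let $\theta$ be a cardinal, let $E^\kappa_\lambda=\{\delta<\kappa\mid \mathrm{cf}(\delta)=\lambda\}$, and let $T$ be a stationary subset of $\kappa$. For every $\delta\in E^\kappa_\lambda$ let $J_\delta$ be a $\lambda$-complete proper ideal over $\delta$ containing all bounded subsets of $\delta$, and write $J_\delta^+=\mathcal P(\delta)\setminus J_\delta$. Let $\langle C_\delta\mid\delta\in E^\kappa_\lambda\rangle$ be a sequence such that each $C_\delta$ is a closed unbounded subset of $\delta$ of order type at most $\lambda$. Suppose that for every club $D\subseteq\kappa$ there is $\delta\in E^\kappa_\lambda$ with $$\{\beta<\delta\mid \min(C_\delta\setminus(\beta+1))\in D\cap T\}\in J_\delta^+.$$ Suppose moreover that at least one of the following holds: 1. $\theta=\lambda=\lambda^{<\lambda}$ and $\lambda$ is a successor cardinal; 2. $\theta=\lambda$, $\diamondsuit(\lambda)$ holds, and $\lambda$ is not Mahlo; 3. $\theta=\lambda$, $\diamondsuit^*(\lambda)$ holds, and each $J_\delta$ is normal; 4. $\theta<\lambda$, $\theta$ is an (infinite) regular cardinal,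 and $\lambda$ is not greatly Mahlo. Then there is a map $h:\lambda\to\theta$ such that for every club $D\subseteq\kappa$ there is $\delta\in E^\kappa_\lambda$ such that for every $\tau<\theta$, $$\{\beta<\delta\mid h(\mathrm{otp}(C_\delta\cap\beta))=\tau\ \text{ and }\ \min(C_\delta\setminus(\beta+1))\in D\cap T\}\in J_\delta^+.$$ Here $\diamondsuit(\lambda)$ says that there are sets $A_\delta\subseteq\delta$ $(\delta<\lambda)$ such that for every $X\subseteq\lambda$ the set $\{\delta<\lambda\mid A_\delta=X\cap\delta\}$ is stationary in $\lambda$; and $\diamondsuit^*(\lambda)$ says that there are families $\mathcal A_\delta\subseteq\mathcal P(\delta)$ with $|\mathcal A_\delta|\le|\delta|$ $(\delta<\lambda)$ such that for every $X\subseteq\lambda$ there is a club $D\subseteq\lambda$ with $X\cap\delta\in\mathcal A_\delta$ for all $\delta\in D$. An ideal $J$ over $\delta$ is normal if for every $B\in J^+$ and every $f:B\to\delta$ with $f(\beta)<\beta$ for all nonzero $\beta\in B$, there is $B'\subseteq B$ in $J^+$ on which $f$ is bounded below $\delta$ (for a $\lambda$-complete ideal over $\delta=\lambda$ regular this is equivalent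 to $f$ being constant on a set in $J^+$). Mahlo and greatly Mahlo cardinals are meant in the weak sense: a regular uncountable cardinal $\lambda$ is Mahlo if the set of regular cardinals below $\lambda$ is stationary in $\lambda$, and greatly Mahlo if there is a normal $\lambda$-complete proper ideal over $\lambda$, containing all bounded subsets of $\lambda$, whose dual filter contains the set of regular cardinals below $\lambda$ and contains, with each $A$, the set of all $\alpha<\lambda$ of uncountable cofinality such that $A\cap\alpha$ is stationary in $\alpha$. -/

import Mathlib

open scoped Cardinal

/-! Sets of ordinals are elements of `Set Ordinal.{u}`; an ordinal `o`, as the set of its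
predecessors, is `Set.Iio o`; a cardinal `c`, as an ordinal, is `c.ord`. -/

universe u

namespace ClubGuess

/-- `D` is a closed and unbounded subset of the ordinal `o`. -/
def IsClubIn (D : Set Ordinal.{u}) (o : Ordinal.{u}) : Prop :=
  D ⊆ Set.Iio o ∧ IsClub {x : Set.Iio o | (x : Ordinal.{u}) ∈ D}

/-- `S ∩ o` is stationary in the ordinal `o`: it meets every club in `o`. -/
def IsStatIn (S : Set Ordinal.{u}) (o : Ordinal.{u}) : Prop :=
  IsStationary {x : Set.Iio o | (x : Ordinal.{u}) ∈ S}

/-- `E κ μ` is the set of all ordinals below `κ` of cofinality `μ`. -/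
def E (κ μ : Cardinal.{u}) : Set Ordinal.{u} :=
  {δ | δ < κ.ord ∧ δ.cof = μ}

/-- The order type of a (bounded) set of ordinals, as an ordinal of the same universe:
see `lift_otp`. -/
noncomputable def otp (A : Set Ordinal.{u}) : Ordinal.{u} :=
  sInf {o | Ordinal.type (fun x y : A => x < y) ≤ Ordinal.lift.{u + 1} o}

theorem lift_otp (A : Set Ordinal.{u}) (o : Ordinal.{u}) (hA : A ⊆ Set.Iio o) :
    Ordinal.lift.{u + 1} (otp A) = Ordinal.type (fun x y : A => x < y) := by
  have h1 : Ordinal.type (fun x y : A => x < y) ≤ Ordinal.lift.{u + 1} o := by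
    have h2 : Ordinal.type (fun x y : A => x < y)
        ≤ Ordinal.type (fun x y : Set.Iio o => x < y) :=
      Ordinal.type_le_iff'.2 ⟨⟨⟨Set.inclusion hA, Set.inclusion_injective hA⟩, Iff.rfl⟩⟩
    exact h2.trans (le_of_eq (Ordinal.type_lt_Iio o))
  obtain ⟨p, hp⟩ := Ordinal.mem_range_lift_of_le h1
  have h3 : otp A = p := by
    unfold otp
    rw [← hp]
    simp only [Ordinal.lift_le]
    exact csInf_Ici
  rw [h3, hp]

/-! ### Ideals over an ordinal -/

/-- `J` is a proper ideal over `δ` that contains all bounded subsets of `δ`. -/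
structure IsIdealOver (J : Set (Set Ordinal.{u})) (δ : Ordinal.{u}) : Prop where
  subset : ∀ A ∈ J, A ⊆ Set.Iio δ
  mono : ∀ A ∈ J, ∀ B, B ⊆ A → B ∈ J
  union : ∀ A ∈ J, ∀ B ∈ J, A ∪ B ∈ J
  bounded : ∀ A : Set Ordinal.{u}, ∀ γ < δ, A ⊆ Set.Iio γ → A ∈ J
  proper : Set.Iio δ ∉ J

/-- `J` is `μ`-complete: closed under unions of fewer than `μ` of its members. -/
def IsComplete (J : Set (Set Ordinal.{u})) (μ : Cardinal.{u}) : Prop :=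
  ∀ (ι : Type u) (A : ι → Set Ordinal.{u}), #ι < μ → (∀ i, A i ∈ J) → (⋃ i, A i) ∈ J

/-- `B ∈ J⁺`, where `J` is an ideal over `δ`. -/
def IsPositive (J : Set (Set Ordinal.{u})) (δ : Ordinal.{u}) (B : Set Ordinal.{u}) : Prop :=
  B ⊆ Set.Iio δ ∧ B ∉ J

/-- `J` is normal: every regressive function on a `J`-positive set is bounded below `δ` on
some `J`-positive subset. If `J` is `cf(δ)`-complete and `δ` is a regular cardinal, then
`bounded` can be replaced here by `constant`; on other ordinals `δ` the formulation
with `bounded` is the one that the nonstationary ideal satisfies. -/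
def IsNormalIdeal (J : Set (Set Ordinal.{u})) (δ : Ordinal.{u}) : Prop :=
  ∀ (B : Set Ordinal.{u}) (f : Ordinal.{u} → Ordinal.{u}), IsPositive J δ B →
    (∀ β ∈ B, β ≠ 0 → f β < β) →
      ∃ B' ⊆ B, IsPositive J δ B' ∧ ∃ γ < δ, ∀ β ∈ B', f β ≤ γ

/-! ### Diamonds and Mahlo cardinals -/

/-- Jensen's principle diamond at `μ`. -/
def Diamond (μ : Cardinal.{u}) : Prop :=
  ∃ A : Ordinal.{u} → Set Ordinal.{u}, (∀ δ < μ.ord, A δ ⊆ Set.Iio δ) ∧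
    ∀ X ⊆ Set.Iio μ.ord, IsStatIn {δ | A δ = X ∩ Set.Iio δ} μ.ord

/-- The principle diamond star at `μ`. -/
def DiamondStar (μ : Cardinal.{u}) : Prop :=
  ∃ 𝒜 : Ordinal.{u} → Set (Set Ordinal.{u}),
    (∀ δ < μ.ord, (∀ A ∈ 𝒜 δ, A ⊆ Set.Iio δ) ∧
      #(𝒜 δ) ≤ Cardinal.lift.{u + 1} δ.card) ∧
    ∀ X ⊆ Set.Iio μ.ord, ∃ D, IsClubIn D μ.ord ∧ ∀ δ ∈ D, X ∩ Set.Iio δ ∈ 𝒜 δ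

/-- The class of all regular cardinals, as a class of ordinals. -/
def Reg : Set Ordinal.{u} :=
  {α | ∃ c : Cardinal.{u}, c.IsRegular ∧ c.ord = α}

/-- `μ` is a (weakly) Mahlo cardinal. -/
def IsMahlo (μ : Cardinal.{u}) : Prop :=
  μ.IsRegular ∧ ℵ₀ < μ ∧ IsStatIn Reg μ.ord

/-- `Tr μ A` is the set of all `α < μ` of uncountable cofinality such that `A ∩ α` is
stationary in `α`. -/
def Tr (μ : Cardinal.{u}) (A : Set Ordinal.{u}) : Set Ordinal.{u} :=
  {α | α < μ.ord ∧ ℵ₀ < α.cof ∧ IsStatIn A α}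

/-- `μ` is a (weakly) greatly Mahlo cardinal: it is regular uncountable, and there is a
normal `μ`-complete ideal over `μ` whose dual filter contains the set of regular cardinals
below `μ` and is closed under the operation `Tr`. -/
def IsGreatlyMahlo (μ : Cardinal.{u}) : Prop :=
  μ.IsRegular ∧ ℵ₀ < μ ∧ ∃ J : Set (Set Ordinal.{u}),
    IsIdealOver J μ.ord ∧ IsComplete J μ ∧ IsNormalIdeal J μ.ord ∧
    Set.Iio μ.ord \ Reg ∈ J ∧
    ∀ A ⊆ Set.Iio μ.ord, Set.Iio μ.ord \ A ∈ J → Set.Iio μ.ord \ Tr μ A ∈ J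

/-- `min (C \ (β + 1))`, where `C` is a set of ordinals with an element above `β`. -/
noncomputable def next (C : Set Ordinal.{u}) (β : Ordinal.{u}) : Ordinal.{u} :=
  sInf (C \ Set.Iio (β + 1))

end ClubGuess

/-! Everything reduces to colorings of λ. Since λ is the cofinality of some δ, it is regular. For δ
∈ E and a J_δ-positive set B, the map β ↦ otp(C_δ ∩ β) carries J_δ restricted to B to a λ-complete
proper ideal over λ that contains the bounded sets, and that is normal if J_δ is. So it is enough to
have at most λ colorings λ → θ such that for every such ideal one of them has all its colors
positive (`HasColorings`). If each coloring p failed on a club D_p, then the intersection of the D_p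
would still be a club, as λ < κ, and the δ guessing it would refute one of these failures
(`HasColorings.guess`).

To verify such a family, suppose that every coloring p has a null color τ_p, and cover a nonnull set
by few sets {h_p = τ_p}.

If λ = ν⁺ and λ^ν = λ, there are ν colorings, arranged so that at β they meet each of the first β
functions ν → λ. Under diamond star, the i-th coloring reads its value from the i-th guess at β;
then club many β lie in a diagonal union of null sets, against normality. Under diamond for
non-Mahlo λ, finite words with parameters below a suitable μ move every β ≥ μ to μ itself
(`exists_op`), where A_μ guesses the code of τ.

For θ⁺ < λ, a λ that is not greatly Mahlo carries a sequence of stationary sets with no common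
reflection at uncountable regular cardinals (`exists_nonreflecting`). With it, for every ideal some
word moves β onto unboundedly many ordinals with positive fibers (`exists_unbounded`). Club guessing
at cofinality θ gives λ maps λ → θ, one of which sends a given unbounded set onto θ (`exists_onto`).

For λ = θ⁺, walks along ladders of type at most θ have coherent weights, each weight being attained
fewer than θ times. The i-th coloring counts oscillations between the weights of i and β along the
trace of the walk from β to i. The 2-adic valuation of this number selects a vertex of the walk,
whose class in a partition into θ stationary sets is the color. Positive labels of walks can be
prolonged with prescribed agreement or disagreement (`exists_prolong`, `exists_prolong_ne`), so that
any finite number of consecutive oscillations occurs (`exists_labels_osc`). -/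

namespace ClubGuess

open Set

/-! ### Clubs, stationary sets and Fodor's lemma -/

/-- `δ` is a nonzero limit of elements of `D`. -/
def Acc (D : Set Ordinal.{u}) (δ : Ordinal.{u}) : Prop :=
  δ ≠ 0 ∧ ∀ x < δ, ∃ y ∈ D, x < y ∧ y < δ

theorem Acc.mono {D D' : Set Ordinal.{u}} (h : D ⊆ D') {δ : Ordinal.{u}} (hδ : Acc D δ) :
    Acc D' δ :=
  ⟨hδ.1, fun x hx => let ⟨y, hy, h1, h2⟩ := hδ.2 x hx; ⟨y, h hy, h1, h2⟩⟩

theorem isClubIn_iff {D : Set Ordinal.{u}} {o : Ordinal.{u}} :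
    IsClubIn D o ↔ D ⊆ Iio o ∧ (∀ δ < o, Acc D δ → δ ∈ D) ∧ ∀ x < o, ∃ y ∈ D, x ≤ y := by
  unfold IsClubIn
  refine and_congr_right fun hD => ⟨fun h => ⟨fun δ hδ hacc => ?_, fun x hx => ?_⟩, fun h => ?_⟩
  · have := h.dirSupClosed (d := {x : Iio o | (x : Ordinal) ∈ D ∧ (x : Ordinal) < δ})
      (fun x hx => hx.1) ?_ (.of_linearOrder _) (a := ⟨δ, hδ⟩) ?_
    · exact this
    · obtain ⟨y, hy, -, h2⟩ := hacc.2 0 (pos_iff_ne_zero.2 hacc.1)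
      exact ⟨⟨y, hD hy⟩, hy, h2⟩
    · refine ⟨fun x hx => hx.2.le, fun b hb => ?_⟩
      by_contra hlt
      obtain ⟨y, hy, h1, h2⟩ := hacc.2 b (not_le.1 hlt)
      exact absurd (hb (a := ⟨y, hD hy⟩) ⟨hy, h2⟩) (not_le.2 h1)
  · obtain ⟨y, hy, h1⟩ := h.isCofinal ⟨x, hx⟩
    exact ⟨y, hy, h1⟩
  · refine ⟨fun d hd hne _ a ha => ?_, fun x => ?_⟩
    · by_cases had : a ∈ d
      · exact hd had
      · refine h.1 a a.2 ⟨?_, fun x hx => ?_⟩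
        · rintro h0
          obtain ⟨y, hy⟩ := hne
          have h1 : y ≤ a := ha.1 hy
          have h2 : (y : Ordinal) = a := le_antisymm h1 (by rw [h0]; exact zero_le)
          exact had (Subtype.ext h2 ▸ hy)
        · have : ¬ (⟨x, hx.trans a.2⟩ : Iio o) ∈ upperBounds d := fun hb =>
            absurd (ha.2 hb) (not_le.2 hx)
          simp only [upperBounds, Set.mem_ofPred_eq, not_forall, not_le] at this
          obtain ⟨y, hy, hxy⟩ := this
          exact ⟨y, hd hy, hxy, lt_of_le_of_ne (ha.1 hy) fun he => had (Subtype.ext he ▸ hy)⟩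
    · obtain ⟨y, hy, hxy⟩ := h.2 x x.2
      exact ⟨⟨y, hD hy⟩, hy, hxy⟩

theorem isStatIn_iff {S : Set Ordinal.{u}} {o : Ordinal.{u}} :
    IsStatIn S o ↔ ∀ D, IsClubIn D o → (S ∩ D).Nonempty := by
  constructor
  · rintro h D ⟨-, hD⟩
    obtain ⟨x, h1, h2⟩ := h hD
    exact ⟨x, h1, h2⟩
  · intro h t ht
    have he : {x : Iio o | (x : Ordinal) ∈ Subtype.val '' t} = t := by
      ext x; simp; exact fun _ => x.2
    obtain ⟨_, h1, x, h2, rfl⟩ := h (Subtype.val '' t) ⟨by rintro _ ⟨x, -, rfl⟩; exact x.2, by rwa [he]⟩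
    exact ⟨x, h1, h2⟩

theorem IsStatIn.mono {S S' : Set Ordinal.{u}} {o : Ordinal.{u}} (h : S ∩ Iio o ⊆ S')
    (hS : IsStatIn S o) : IsStatIn S' o :=
  isStatIn_iff.2 fun D hD => let ⟨x, hx, hxD⟩ := isStatIn_iff.1 hS D hD
    ⟨x, h ⟨hx, hD.1 hxD⟩, hxD⟩

section Regular

variable {c : Cardinal.{u}}

theorem exists_bound (hc : c.IsRegular) {s : Set Ordinal.{u}} (hs : s ⊆ Iio c.ord)
    (hsc : #s < Cardinal.lift.{u + 1} c) : ∃ b < c.ord, ∀ x ∈ s, x < b := by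
  have h1 : sSup ((· + 1) '' s) < c.ord := by
    refine Ordinal.sSup_add_one_lt_of_lt_cof ?_ hs
    rwa [← Ordinal.lift_cof, hc.cof_ord]
  refine ⟨_, h1, fun x hx => ?_⟩
  have hb : BddAbove ((· + 1) '' s) := by
    refine ⟨c.ord, ?_⟩
    rintro _ ⟨y, hy, rfl⟩
    exact Order.add_one_le_of_lt (hs hy)
  exact lt_of_lt_of_le (lt_add_one x) (le_csSup hb ⟨x, hx, rfl⟩)

theorem mk_Iio_lt {x : Ordinal.{u}} (hx : x < c.ord) : #(Iio x) < Cardinal.lift.{u + 1} c := by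
  rw [Cardinal.mk_Iio_ordinal]
  exact Cardinal.lift_lt.2 (Cardinal.lt_ord.1 hx)

theorem mk_Iic_lt (hc : c.IsRegular) {x : Ordinal.{u}} (hx : x < c.ord) :
    #(Iic x) < Cardinal.lift.{u + 1} c := by
  rw [← Set.Iio_add_one_eq_Iic x]
  exact mk_Iio_lt ((Cardinal.isSuccLimit_ord hc.1).add_one_lt hx)

theorem mk_biUnion_lt (hc : c.IsRegular) {X Y : Type (u + 1)} {s : Set X} {t : X → Set Y}
    (hs : #s < Cardinal.lift.{u + 1} c) (ht : ∀ x ∈ s, #(t x) < Cardinal.lift.{u + 1} c) :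
    #(⋃ x ∈ s, t x : Set Y) < Cardinal.lift.{u + 1} c :=
  (Cardinal.card_biUnion_lt_iff_forall_of_isRegular hc.lift hs).2 ht

theorem exists_closed (hc : c.IsRegular) (hc' : ℵ₀ < c) {F : Ordinal.{u} → Set Ordinal.{u}}
    (hF : ∀ y < c.ord, F y ⊆ Iio c.ord)
    (hF' : ∀ y < c.ord, #(F y) < Cardinal.lift.{u + 1} c) {x : Ordinal.{u}} (hx : x < c.ord) :
    ∃ δ < c.ord, x < δ ∧ Order.IsSuccLimit δ ∧ ∀ y < δ, ∀ z ∈ F y, z < δ := by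
  have key : ∀ y : Ordinal.{u}, ∃ b, y < c.ord → b < c.ord ∧ y + 1 ≤ b ∧ ∀ y' ≤ y, ∀ z ∈ F y', z < b := by
    intro y
    by_cases hy : y < c.ord
    · obtain ⟨b, hb, hb'⟩ := exists_bound (s := ⋃ y' ∈ Iic y, F y') hc
        (by
          intro z hz
          simp only [mem_iUnion, mem_Iic] at hz
          obtain ⟨y', hy', hz⟩ := hz
          exact hF y' (hy'.trans_lt hy) hz)
        (mk_biUnion_lt hc (mk_Iic_lt hc hy) fun y' hy' => hF' y' (lt_of_le_of_lt hy' hy))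
      refine ⟨max b (y + 1), fun _ => ⟨max_lt hb
        ((Cardinal.isSuccLimit_ord hc.1).add_one_lt hy), le_max_right _ _, fun y' hy' z hz => ?_⟩⟩
      refine (hb' z ?_).trans_le (le_max_left _ _)
      simp only [mem_iUnion, mem_Iic]
      exact ⟨y', hy', hz⟩
    · exact ⟨0, fun h => absurd h hy⟩
  choose b hb using key
  -- The supremum of the iterates of `b` is closed under `F`, and it stays below `c.ord` because `c`
  -- has uncountable cofinality.
  have hit : ∀ n, b^[n] (x + 1) < c.ord := by
    intro n
    induction n with
    | zero => exact (Cardinal.isSuccLimit_ord hc.1).add_one_lt hx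
    | succ n ih => rw [Function.iterate_succ_apply']; exact (hb _ ih).1
  have hlt : ⨆ n, b^[n] (x + 1) < c.ord := by
    apply Ordinal.lift_iSup_lt_of_lt_cof _ hit
    rw [← Ordinal.lift_cof, hc.cof_ord]
    simpa using hc'
  have hle : ∀ n, b^[n] (x + 1) ≤ ⨆ n, b^[n] (x + 1) := Ordinal.le_iSup _
  have hcl : ∀ y < ⨆ n, b^[n] (x + 1), ∃ n, y < b^[n] (x + 1) := fun y hy => Ordinal.lt_iSup_iff.1 hy
  have hx1 : x < ⨆ n, b^[n] (x + 1) := lt_of_lt_of_le (lt_add_one x) (hle 0)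
  refine ⟨_, hlt, hx1, ?_, fun y hy z hz => ?_⟩
  · rw [Order.isSuccLimit_iff]
    refine ⟨(pos_of_gt hx1).ne' ∘ IsMin.eq_bot, ?_⟩
    rw [Order.isSuccPrelimit_iff_succ_lt]
    intro y hy
    obtain ⟨n, hn⟩ := hcl y hy
    have h2 := (hb _ (hit n)).2.1
    rw [← Function.iterate_succ_apply' b] at h2
    refine lt_of_lt_of_le ?_ (hle (n + 1))
    refine lt_of_lt_of_le ?_ h2
    rw [Order.succ_eq_add_one]
    exact lt_of_le_of_lt (Order.add_one_le_of_lt hn) (lt_add_one _)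
  · obtain ⟨n, hn⟩ := hcl y hy
    have h2 := (hb _ (hit n)).2.2 y hn.le z hz
    rw [← Function.iterate_succ_apply' b] at h2
    exact h2.trans_le (hle (n + 1))

theorem isClubIn_closed (hc : c.IsRegular) (hc' : ℵ₀ < c) {F : Ordinal.{u} → Set Ordinal.{u}}
    (hF : ∀ y < c.ord, F y ⊆ Iio c.ord)
    (hF' : ∀ y < c.ord, #(F y) < Cardinal.lift.{u + 1} c) :
    IsClubIn {δ | δ < c.ord ∧ Order.IsSuccLimit δ ∧ ∀ y < δ, ∀ z ∈ F y, z < δ} c.ord := by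
  rw [isClubIn_iff]
  refine ⟨fun x hx => hx.1, fun δ hδ hacc => ⟨hδ, ?_, fun y hy z hz => ?_⟩, fun x hx => ?_⟩
  · rw [Order.isSuccLimit_iff]
    refine ⟨hacc.1 ∘ IsMin.eq_bot, ?_⟩
    rw [Order.isSuccPrelimit_iff_succ_lt]
    intro y hy
    obtain ⟨w, hw, h1, h2⟩ := hacc.2 y hy
    exact (Order.succ_le_of_lt h1).trans_lt h2
  · obtain ⟨w, hw, h1, h2⟩ := hacc.2 y hy
    exact (hw.2.2 y h1 z hz).trans h2
  · obtain ⟨δ, h1, h2, h3, h4⟩ := exists_closed hc hc' hF hF' hx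
    exact ⟨δ, ⟨h1, h3, h4⟩, h2.le⟩

theorem mk_singleton_lt (hc : c.IsRegular) {X : Type (u + 1)} (x : X) :
    #({x} : Set X) < Cardinal.lift.{u + 1} c := by
  rw [Cardinal.mk_singleton]
  exact lt_of_lt_of_le Cardinal.one_lt_aleph0 (by simpa using hc.1)

/-- The diagonal intersection of clubs contains a club. -/
theorem isClubIn_diag (hc : c.IsRegular) (hc' : ℵ₀ < c) {D : Ordinal.{u} → Set Ordinal.{u}}
    (hD : ∀ i < c.ord, IsClubIn (D i) c.ord) :
    ∃ E, IsClubIn E c.ord ∧ ∀ δ ∈ E, Order.IsSuccLimit δ ∧ ∀ i < δ, δ ∈ D i := by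
  have key : ∀ i x : Ordinal.{u}, ∃ y, i < c.ord → x < c.ord → y ∈ D i ∧ x < y := by
    intro i x
    by_cases h : i < c.ord ∧ x < c.ord
    · obtain ⟨y, hy, h1⟩ := (isClubIn_iff.1 (hD i h.1)).2.2 (x + 1)
        ((Cardinal.isSuccLimit_ord hc.1).add_one_lt h.2)
      exact ⟨y, fun _ _ => ⟨hy, lt_of_lt_of_le (lt_add_one x) h1⟩⟩
    · exact ⟨0, fun h1 h2 => absurd ⟨h1, h2⟩ h⟩
  choose n hn using key
  -- If `δ` is closed under `n`, then it is a limit of each `D i` with `i < δ`, hence in `D i`.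
  refine ⟨_, isClubIn_closed hc hc' (F := fun y => (fun p : Ordinal × Ordinal => n p.1 p.2) ''
    (Iic y ×ˢ Iic y)) ?_ ?_, ?_⟩
  · rintro y hy _ ⟨⟨i, x⟩, ⟨h1, h2⟩, rfl⟩
    have := hn i x (lt_of_le_of_lt h1 hy) (lt_of_le_of_lt h2 hy)
    exact (hD i (lt_of_le_of_lt h1 hy)).1 this.1
  · intro y hy
    refine Cardinal.mk_image_le.trans_lt ?_
    rw [Cardinal.mk_setProd]
    exact Cardinal.mul_lt_of_lt (by simpa using hc.1) (mk_Iic_lt hc hy) (mk_Iic_lt hc hy)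
  · rintro δ ⟨h1, h2, h3⟩
    refine ⟨h2, fun i hi => (isClubIn_iff.1 (hD i (hi.trans h1))).2.1 δ h1
      ⟨(pos_of_gt hi).ne', fun x hx => ?_⟩⟩
    have h4 := hn i x (hi.trans h1) (hx.trans h1)
    exact ⟨_, h4.1, h4.2, h3 (max i x) (max_lt hi hx) _ ⟨(i, x), ⟨Set.mem_Iic.2 (le_max_left _ _), Set.mem_Iic.2 (le_max_right _ _)⟩, rfl⟩⟩

theorem IsClubIn.biInter (hc : c.IsRegular) (hc' : ℵ₀ < c) {X : Type (u + 1)} {s : Set X}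
    {D : X → Set Ordinal.{u}} (hs : #s < Cardinal.lift.{u + 1} c)
    (hD : ∀ i ∈ s, IsClubIn (D i) c.ord) :
    IsClubIn (Iio c.ord ∩ ⋂ i ∈ s, D i) c.ord := by
  rw [isClubIn_iff]
  refine ⟨fun x hx => hx.1, fun δ hδ hacc => ⟨hδ, ?_⟩, fun x hx => ?_⟩
  · simp only [mem_iInter]
    intro i hi
    refine (isClubIn_iff.1 (hD i hi)).2.1 δ hδ (hacc.mono fun y hy => ?_)
    have := hy.2
    simp only [mem_iInter] at this
    exact this i hi
  · have key : ∀ (i : X) (x : Ordinal.{u}), ∃ y, i ∈ s → x < c.ord → y ∈ D i ∧ x < y := by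
      intro i x
      by_cases h : i ∈ s ∧ x < c.ord
      · obtain ⟨y, hy, h1⟩ := (isClubIn_iff.1 (hD i h.1)).2.2 (x + 1)
          ((Cardinal.isSuccLimit_ord hc.1).add_one_lt h.2)
        exact ⟨y, fun _ _ => ⟨hy, lt_of_lt_of_le (lt_add_one x) h1⟩⟩
      · exact ⟨0, fun h1 h2 => absurd ⟨h1, h2⟩ h⟩
    choose n hn using key
    obtain ⟨δ, h1, h2, h3, h4⟩ := exists_closed hc hc' (F := fun y => (fun i => n i y) '' s)
      (by
        rintro y hy _ ⟨i, hi, rfl⟩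
        exact (hD i hi).1 (hn i y hi hy).1)
      (fun y _ => Cardinal.mk_image_le.trans_lt hs) hx
    refine ⟨δ, ⟨h1, ?_⟩, h2.le⟩
    simp only [mem_iInter]
    intro i hi
    refine (isClubIn_iff.1 (hD i hi)).2.1 δ h1 ⟨(pos_of_gt h2).ne', fun y hy => ?_⟩
    have h5 := hn i y hi (hy.trans h1)
    exact ⟨_, h5.1, h5.2, h4 y hy _ ⟨i, hi, rfl⟩⟩

theorem IsClubIn.inter (hc : c.IsRegular) (hc' : ℵ₀ < c) {D E : Set Ordinal.{u}}
    (hD : IsClubIn D c.ord) (hE : IsClubIn E c.ord) : IsClubIn (D ∩ E) c.ord := by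
  have := IsClubIn.biInter hc hc' (X := ULift.{u + 1} Bool) (s := univ)
    (D := fun b => if b.down then D else E)
    ((Cardinal.lt_aleph0_of_finite _).trans_le (by simpa using hc.1))
    (by rintro ⟨_ | _⟩ - <;> simpa)
  convert this using 1
  ext x
  simp only [mem_inter_iff, mem_iInter, mem_Iio, mem_univ, forall_true_left, ULift.forall,
    Bool.forall_bool]
  exact ⟨fun h => ⟨hD.1 h.1, by simpa using h.2, by simpa using h.1⟩,
    fun h => ⟨by simpa using h.2.2, by simpa using h.2.1⟩⟩

theorem isClubIn_Iio : IsClubIn (Iio c.ord) c.ord :=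
  isClubIn_iff.2 ⟨Subset.rfl, fun _ h _ => h, fun x hx => ⟨x, hx, le_rfl⟩⟩

theorem isClubIn_Ioo (hc : c.IsRegular) {x : Ordinal.{u}} (hx : x < c.ord) :
    IsClubIn (Ioo x c.ord) c.ord := by
  refine isClubIn_iff.2 ⟨fun y hy => hy.2, fun δ hδ h => ⟨?_, hδ⟩, fun y hy => ?_⟩
  · obtain ⟨y, hy, -, h2⟩ := h.2 0 (pos_iff_ne_zero.2 h.1)
    exact hy.1.trans h2
  · have := (Cardinal.isSuccLimit_ord hc.1).add_one_lt (max_lt hx hy)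
    exact ⟨_, ⟨lt_of_le_of_lt (le_max_left x y) (lt_add_one _), this⟩,
      (le_max_right x y).trans (lt_add_one _).le⟩

theorem IsStatIn.inter_club (hc : c.IsRegular) (hc' : ℵ₀ < c) {S D : Set Ordinal.{u}}
    (hS : IsStatIn S c.ord) (hD : IsClubIn D c.ord) : IsStatIn (S ∩ D) c.ord :=
  isStatIn_iff.2 fun E hE => by
    obtain ⟨x, h1, h2, h3⟩ := isStatIn_iff.1 hS _ (hD.inter hc hc' hE)
    exact ⟨x, ⟨h1, h2⟩, h3⟩

theorem IsStatIn.unbounded (hc : c.IsRegular) {S : Set Ordinal.{u}}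
    (hS : IsStatIn S c.ord) {x : Ordinal.{u}} (hx : x < c.ord) : ∃ y ∈ S, x < y ∧ y < c.ord := by
  obtain ⟨y, h1, h2⟩ := isStatIn_iff.1 hS _ (isClubIn_Ioo hc hx)
  exact ⟨y, h1, h2⟩

theorem not_isStatIn_iff {S : Set Ordinal.{u}} {o : Ordinal.{u}} :
    ¬ IsStatIn S o ↔ ∃ D, IsClubIn D o ∧ ∀ x ∈ D, x ∉ S := by
  rw [isStatIn_iff]
  push Not
  refine exists_congr fun D => and_congr_right fun _ => ?_
  rw [Set.eq_empty_iff_forall_notMem]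
  exact ⟨fun h x hx hs => h x ⟨hs, hx⟩, fun h x hx => h x hx.2 hx.1⟩

theorem isClubIn_acc (hc : c.IsRegular) (hc' : ℵ₀ < c) {A : Set Ordinal.{u}}
    (hA : ∀ x < c.ord, ∃ y ∈ A, x < y ∧ y < c.ord) :
    IsClubIn {δ | δ < c.ord ∧ Acc A δ} c.ord := by
  have key : ∀ x : Ordinal.{u}, ∃ y, x < c.ord → y ∈ A ∧ x < y ∧ y < c.ord := by
    intro x
    by_cases h : x < c.ord
    · obtain ⟨y, hy⟩ := hA x h; exact ⟨y, fun _ => hy⟩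
    · exact ⟨0, fun h1 => absurd h1 h⟩
  choose n hn using key
  refine isClubIn_iff.2 ⟨fun x hx => hx.1, fun δ hδ hacc => ⟨hδ, hacc.1, fun x hx => ?_⟩, fun x hx => ?_⟩
  · obtain ⟨y, hy, h1, h2⟩ := hacc.2 x hx
    obtain ⟨z, hz, h3, h4⟩ := hy.2.2 x h1
    exact ⟨z, hz, h3, h4.trans h2⟩
  · obtain ⟨δ, h1, h2, -, h3⟩ := exists_closed hc hc' (F := fun y => {n y})
      (by rintro y hy _ rfl; exact (hn y hy).2.2) (fun y _ => mk_singleton_lt hc _) hx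
    refine ⟨δ, ⟨h1, (pos_of_gt h2).ne', fun y hy => ?_⟩, h2.le⟩
    exact ⟨_, (hn y (hy.trans h1)).1, (hn y (hy.trans h1)).2.1, h3 y hy _ rfl⟩

/-- A union of fewer than `c` nonstationary sets is nonstationary. -/
theorem IsStatIn.exists_biUnion (hc : c.IsRegular) (hc' : ℵ₀ < c) {X : Type (u + 1)} {s : Set X}
    {S : Set Ordinal.{u}} {f : Ordinal.{u} → X} (hs : #s < Cardinal.lift.{u + 1} c)
    (hS : IsStatIn S c.ord) (hf : ∀ x ∈ S, x < c.ord → f x ∈ s) :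
    ∃ i ∈ s, IsStatIn {x ∈ S | f x = i} c.ord := by
  by_contra hcon
  push Not at hcon
  have key : ∀ i, ∃ D, i ∈ s → IsClubIn D c.ord ∧ ∀ x ∈ D, x ∉ {x ∈ S | f x = i} := by
    intro i
    by_cases h : i ∈ s
    · obtain ⟨D, hD⟩ := not_isStatIn_iff.1 (hcon i h)
      exact ⟨D, fun _ => hD⟩
    · exact ⟨∅, fun h' => absurd h' h⟩
  choose D hD using key
  obtain ⟨x, h1, h2, h3⟩ := isStatIn_iff.1 hS _ (IsClubIn.biInter hc hc' hs fun i hi => (hD i hi).1)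
  simp only [mem_iInter] at h3
  exact (hD _ (hf x h1 h2)).2 x (h3 _ (hf x h1 h2)) ⟨h1, rfl⟩

/-- Fodor's lemma. -/
theorem IsStatIn.fodor (hc : c.IsRegular) (hc' : ℵ₀ < c) {S : Set Ordinal.{u}}
    {f : Ordinal.{u} → Ordinal.{u}} (hS : IsStatIn S c.ord)
    (hf : ∀ x ∈ S, x < c.ord → x ≠ 0 → f x < x) :
    ∃ i < c.ord, IsStatIn {x ∈ S | f x = i} c.ord := by
  by_contra hcon
  push Not at hcon
  have key : ∀ i, ∃ D, i < c.ord → IsClubIn D c.ord ∧ ∀ x ∈ D, x ∉ {x ∈ S | f x = i} := by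
    intro i
    by_cases h : i < c.ord
    · obtain ⟨D, hD⟩ := not_isStatIn_iff.1 (hcon i h)
      exact ⟨D, fun _ => hD⟩
    · exact ⟨∅, fun h' => absurd h' h⟩
  choose D hD using key
  obtain ⟨E, hE, hE'⟩ := isClubIn_diag hc hc' fun i hi => (hD i hi).1
  obtain ⟨x, h1, h2⟩ := isStatIn_iff.1 hS _ hE
  have hx : x < c.ord := hE.1 h2
  have hlt := hf x h1 hx (hE' x h2).1.ne_bot
  exact (hD _ (hlt.trans hx)).2 x ((hE' x h2).2 _ hlt) ⟨h1, rfl⟩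

/-- Fodor's lemma for regressive functions into finite sequences. -/
theorem IsStatIn.fodor_list (hc : c.IsRegular) (hc' : ℵ₀ < c) {S : Set Ordinal.{u}}
    {f : Ordinal.{u} → List Ordinal.{u}} (hS : IsStatIn S c.ord)
    (hf : ∀ x ∈ S, x < c.ord → ∀ y ∈ f x, y < x) :
    ∃ l, IsStatIn {x ∈ S | f x = l} c.ord := by
  -- There are countably many lengths, so one of them occurs stationarily often; the entries are
  -- then fixed one at a time.
  obtain ⟨⟨n⟩, -, hn⟩ := hS.exists_biUnion hc hc' (X := ULift.{u + 1} ℕ) (s := univ)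
    (f := fun x => ⟨(f x).length⟩)
    (by
      have h1 : #(univ : Set (ULift.{u + 1} ℕ)) ≤ ℵ₀ := Cardinal.mk_le_aleph0
      refine h1.trans_lt ?_
      simpa using hc') (fun _ _ _ => mem_univ _)
  simp only [ULift.up_inj] at hn
  induction n generalizing S f with
  | zero =>
    refine ⟨[], hn.mono ?_⟩
    rintro x ⟨⟨h1, h2⟩, -⟩
    exact ⟨h1, List.eq_nil_of_length_eq_zero h2⟩
  | succ n ih =>
    obtain ⟨i, -, hi⟩ := hn.fodor hc hc' (f := fun x => (f x).headD 0) (by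
      rintro x ⟨h1, h2⟩ hx h0
      obtain ⟨a, l, hl⟩ := List.exists_cons_of_length_eq_add_one h2
      simp only [hl, List.headD_cons]
      exact hf x h1 hx a (by simp [hl]))
    have hT : IsStatIn {x ∈ S | f x = i :: (f x).tail ∧ (f x).tail.length = n} c.ord := by
      refine hi.mono ?_
      rintro x ⟨⟨⟨h1, h2⟩, h3⟩, -⟩
      obtain ⟨a, l, hl⟩ := List.exists_cons_of_length_eq_add_one h2
      simp only [hl, List.headD_cons] at h3
      refine ⟨h1, ?_, ?_⟩
      · simp [hl, h3]
      · simpa [hl] using h2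
    obtain ⟨l, hl⟩ := ih (S := {x ∈ S | f x = i :: (f x).tail ∧ (f x).tail.length = n})
      (f := fun x => (f x).tail) hT
      (fun x hx hxc y hy => hf x hx.1 hxc y (List.mem_of_mem_tail hy))
      (hT.mono fun x hx => ⟨hx.1, hx.1.2.2⟩)
    refine ⟨i :: l, hl.mono ?_⟩
    rintro x ⟨⟨h1, h2⟩, -⟩
    refine ⟨h1.1, ?_⟩
    rw [h1.2.1]; simpa using h2

/-- The ordinals of cofinality `μ` form a stationary set. -/
theorem isStatIn_cof (hc : c.IsRegular) {μ : Cardinal.{u}} (hμ : μ.IsRegular)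
    (hμc : μ < c) : IsStatIn {δ | δ.cof = μ} c.ord := by
  refine isStatIn_iff.2 fun D hD => ?_
  obtain ⟨hDs, hDc, hDu⟩ := isClubIn_iff.1 hD
  have key : ∀ x : Ordinal.{u}, ∃ y, x < c.ord → y ∈ D ∧ x ≤ y := by
    intro x
    by_cases h : x < c.ord
    · obtain ⟨y, hy⟩ := hDu x h; exact ⟨y, fun _ => hy⟩
    · exact ⟨0, fun h1 => absurd h1 h⟩
  choose n hn using key
  have hμo : μ.ord < c.ord := Cardinal.ord_lt_ord.2 hμc
  -- A strictly increasing sequence of elements of `D`; its supremum at `μ.ord` has cofinality `μ`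
  -- and lies in `D` by closure.
  let g : Ordinal.{u} → Ordinal.{u} := WellFoundedLT.fix fun (i : Ordinal.{u}) ih =>
    n (sSup (range fun j : Iio i => ih j j.2 + 1))
  have hg : ∀ i, g i = n (sSup (range fun j : Iio i => g j + 1)) := fun i =>
    WellFoundedLT.fix_eq _ _
  have hsmall : ∀ (i : Ordinal.{u}) (f : Iio i → Ordinal.{u}), BddAbove (range f) := fun i f =>
    Ordinal.bddAbove_of_small
  have hgD : ∀ i < c.ord, g i ∈ D ∧ sSup (range fun j : Iio i => g j + 1) ≤ g i := by
    intro i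
    induction i using WellFoundedLT.induction with
    | ind i ih =>
      intro hi
      rw [hg]
      apply hn
      have h1 := Ordinal.sSup_add_one_lt_of_lt_cof (s := range fun j : Iio i => g j) (a := c.ord)
        (by
          rw [← Ordinal.lift_cof, hc.cof_ord]
          exact Cardinal.mk_range_le.trans_lt (mk_Iio_lt hi))
        (by rintro _ ⟨j, rfl⟩; exact hDs (ih j j.2 (lt_trans j.2 hi)).1)
      rwa [← range_comp] at h1
  have hmono : ∀ i < c.ord, ∀ j < i, g j < g i := by
    intro i hi j hj
    refine lt_of_lt_of_le ?_ (hgD i hi).2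
    exact lt_of_lt_of_le (lt_add_one _) (le_csSup (hsmall i _) ⟨⟨j, hj⟩, rfl⟩)
  have hsm : StrictMono fun j : Iio μ.ord => g j := fun a b hab =>
    hmono b (lt_trans b.2 hμo) a hab
  have hcof := Ordinal.cof_iSup_Iio hsm (Cardinal.isSuccLimit_ord hμ.1).isSuccPrelimit
  have hδ : ⨆ j : Iio μ.ord, g j < c.ord := by
    refine Ordinal.sSup_lt_of_lt_cof ?_ ?_
    · rw [← Ordinal.lift_cof, hc.cof_ord]
      exact Cardinal.mk_range_le.trans_lt (mk_Iio_lt hμo)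
    · rintro _ ⟨j, rfl⟩; exact hDs (hgD j (lt_trans j.2 hμo)).1
  have hpos : (⨆ j : Iio μ.ord, g j) ≠ 0 := by
    intro h0
    have h1 := (Cardinal.isSuccLimit_ord hμ.1).add_one_lt hμ.ord_pos
    have := hmono _ (h1.trans hμo) _ (lt_add_one 0)
    have h2 : g (0 + 1) ≤ ⨆ j : Iio μ.ord, g j := le_csSup (hsmall _ _) ⟨⟨_, h1⟩, rfl⟩
    rw [h0] at h2
    exact absurd (this.trans_le h2) (not_lt.2 zero_le)
  refine ⟨_, ?_, hDc _ hδ ⟨hpos, fun x hx => ?_⟩⟩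
  · show Ordinal.cof _ = μ
    rw [hcof, hμ.cof_ord]
  · obtain ⟨j, hj⟩ := Ordinal.lt_iSup_iff.1 hx
    have h1 := (Cardinal.isSuccLimit_ord hμ.1).add_one_lt j.2
    exact ⟨g j, (hgD j (lt_trans j.2 hμo)).1, hj, (hmono _ (h1.trans hμo) _ (lt_add_one _)).trans_le
      (le_csSup (hsmall _ _) ⟨⟨_, h1⟩, rfl⟩)⟩

end Regular


/-! ### Order types of sets of ordinals -/

section Otp

variable {A B C : Set Ordinal.{u}} {o δ : Ordinal.{u}}

theorem otp_mono (hAB : A ⊆ B) (hB : B ⊆ Iio o) : otp A ≤ otp B := by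
  rw [← Ordinal.lift_le.{u + 1}, lift_otp A o (hAB.trans hB), lift_otp B o hB]
  exact Ordinal.type_le_iff'.2 ⟨⟨⟨Set.inclusion hAB, Set.inclusion_injective hAB⟩, Iff.rfl⟩⟩

theorem lift_otp_inter_Iio (hA : A ⊆ Iio o) (y : A) :
    Ordinal.lift.{u + 1} (otp (A ∩ Iio (y : Ordinal.{u}))) =
      Ordinal.typein (fun x y : A => x < y) y := by
  rw [lift_otp _ o (inter_subset_left.trans hA), ← Ordinal.type_subrel]
  exact Ordinal.type_eq.2 ⟨⟨⟨fun x => ⟨⟨x, x.2.1⟩, x.2.2⟩, fun x => ⟨x.1, x.1.2, x.2⟩,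
    fun _ => rfl, fun _ => rfl⟩, Iff.rfl⟩⟩

theorem otp_inter_lt (hA : A ⊆ Iio o) {y : Ordinal.{u}} (hy : y ∈ A) :
    otp (A ∩ Iio y) < otp A := by
  rw [← Ordinal.lift_lt.{u + 1}, lift_otp_inter_Iio hA ⟨y, hy⟩, lift_otp A o hA]
  exact Ordinal.typein_lt_type _ _

theorem otp_inter_lt_otp_inter (hA : A ⊆ Iio o) {x y : Ordinal.{u}} (hx : x ∈ A)
    (hxy : x < y) : otp (A ∩ Iio x) < otp (A ∩ Iio y) := by
  have h := otp_inter_lt (o := o) (A := A ∩ Iio y) (inter_subset_left.trans hA) (y := x) ⟨hx, hxy⟩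
  rwa [inter_assoc, inter_eq_right.2 (Iio_subset_Iio hxy.le)] at h

theorem exists_otp_eq (hA : A ⊆ Iio o) {ξ : Ordinal.{u}} (hξ : ξ < otp A) :
    ∃ y ∈ A, otp (A ∩ Iio y) = ξ := by
  rw [← Ordinal.lift_lt.{u + 1}, lift_otp A o hA] at hξ
  obtain ⟨y, hy⟩ := Ordinal.typein_surj _ hξ
  refine ⟨y, y.2, ?_⟩
  exact Ordinal.lift_inj.1 ((lift_otp_inter_Iio hA y).trans hy)

theorem lift_card_otp (hA : A ⊆ Iio o) : Cardinal.lift.{u + 1} (otp A).card = #A := by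
  rw [Ordinal.lift_card, lift_otp A o hA, Ordinal.card_type]

theorem lift_cof_le_mk (hC : C ⊆ Iio δ) (hC' : ∀ x < δ, ∃ y ∈ C, x ≤ y) :
    Cardinal.lift.{u + 1} δ.cof ≤ #C := by
  rw [Ordinal.lift_cof, ← Ordinal.cof_Iio]
  refine (Order.cof_le (s := {x : Iio δ | (x : Ordinal) ∈ C}) ?_).trans ?_
  · intro x
    obtain ⟨y, hy, h⟩ := hC' x x.2
    exact ⟨⟨y, hC hy⟩, hy, h⟩
  · exact Cardinal.mk_le_of_injective (f := fun x => (⟨x.1, x.2⟩ : C)) fun x y h => by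
      simpa [Subtype.ext_iff] using h

theorem ord_cof_le_otp (hC : C ⊆ Iio δ) (hC' : ∀ x < δ, ∃ y ∈ C, x ≤ y) :
    δ.cof.ord ≤ otp C := by
  rw [Cardinal.ord_le, ← Cardinal.lift_le.{u + 1}, lift_card_otp hC]
  exact lift_cof_le_mk hC hC'

end Otp

/-! ### Complete and normal ideals -/

section Ideals

variable {c : Cardinal.{u}} {I : Set (Set Ordinal.{u})} {δ : Ordinal.{u}}

theorem IsComplete.biUnion (hI : IsComplete I c) {X : Type (u + 1)} {s : Set X}
    {A : X → Set Ordinal.{u}} (hs : #s < Cardinal.lift.{u + 1} c) (hA : ∀ x ∈ s, A x ∈ I) :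
    (⋃ x ∈ s, A x) ∈ I := by
  obtain ⟨d, hd, hdc⟩ := Cardinal.lt_lift_iff.1 hs
  have : Cardinal.lift.{u + 1} #d.out = Cardinal.lift.{u} #s := by
    rw [Cardinal.mk_out, hdc, Cardinal.lift_id'.{u, u + 1}]
  obtain ⟨e⟩ := Cardinal.lift_mk_eq'.1 this
  have h := hI d.out (fun i => A (e i)) (by rwa [Cardinal.mk_out]) fun i => hA _ (e i).2
  rw [biUnion_eq_iUnion]
  rwa [e.surjective.iUnion_comp (fun x : s => A x)] at h

theorem IsIdealOver.exists_pos (hI : IsIdealOver I δ) (hIc : IsComplete I c)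
    {X : Type (u + 1)} {s : Set X} {B : Set Ordinal.{u}} {f : Ordinal.{u} → X} (hB : B ∉ I)
    (hs : #s < Cardinal.lift.{u + 1} c) (hf : ∀ β ∈ B, f β ∈ s) :
    ∃ x ∈ s, {β ∈ B | f β = x} ∉ I := by
  by_contra hcon
  push Not at hcon
  refine hB (hI.mono _ (hIc.biUnion hs hcon) _ fun β hβ => ?_)
  simp only [mem_iUnion]
  exact ⟨f β, hf β hβ, hβ, rfl⟩

theorem IsIdealOver.diff (hI : IsIdealOver I δ) {B A : Set Ordinal.{u}} (hB : B ∉ I) (hA : A ∈ I) :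
    B \ A ∉ I := fun h =>
  hB (hI.mono _ (hI.union _ h _ hA) _ fun x hx => by by_cases hxA : x ∈ A <;> simp [hx, hxA])

theorem IsIdealOver.inter_Ici (hI : IsIdealOver I δ) {B : Set Ordinal.{u}} (hB : B ∉ I)
    {γ : Ordinal.{u}} (hγ : γ < δ) : {β ∈ B | γ ≤ β} ∉ I := by
  have := hI.diff hB (hI.bounded (Iio γ) γ hγ Subset.rfl)
  convert this using 2
  ext x; simp

/-- The diagonal union of sets in a normal ideal belongs to the ideal. -/
theorem IsNormalIdeal.diag (hc : c.IsRegular) (hI : IsIdealOver I c.ord) (hIc : IsComplete I c)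
    (hIn : IsNormalIdeal I c.ord) {A : Ordinal.{u} → Set Ordinal.{u}}
    (hA : ∀ i < c.ord, A i ∈ I) : {β | β < c.ord ∧ ∃ i < β, β ∈ A i} ∈ I := by
  by_contra hB
  have key : ∀ β : Ordinal.{u}, ∃ i, (∃ i < β, β ∈ A i) → i < β ∧ β ∈ A i := fun β => by
    by_cases h : ∃ i < β, β ∈ A i
    · obtain ⟨i, hi⟩ := h; exact ⟨i, fun _ => hi⟩
    · exact ⟨0, fun h' => absurd h' h⟩
  choose f hf using key
  -- On a positive diagonal union the choice of an index is regressive, hence bounded on a positive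
  -- set, and by completeness constant on a smaller one.
  obtain ⟨B', hB', ⟨-, hpos⟩, γ, hγ, hfγ⟩ := hIn _ f ⟨fun β h => h.1, hB⟩
    fun β hβ _ => (hf β hβ.2).1
  obtain ⟨i, hi, hipos⟩ := hI.exists_pos hIc hpos (mk_Iic_lt hc hγ) hfγ
  refine hipos (hI.mono _ (hA i (lt_of_le_of_lt hi hγ)) _ ?_)
  rintro β ⟨hβ, rfl⟩
  exact (hf β (hB' hβ).2).2

end Ideals

/-! ### Reduction to colorings of `lam` -/

/-- There are at most `lam` many colorings `lam → θ` such that for every (normal, if `N`)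
`lam`-complete ideal over `lam`, one of them has all its colors positive. -/
def HasColorings (lam θ : Cardinal.{u}) (N : Prop) : Prop :=
  ∃ (X : Type (u + 1)) (h : X → Ordinal.{u} → Ordinal.{u}), #X ≤ Cardinal.lift.{u + 1} lam ∧
    (∀ p, ∀ i < lam.ord, h p i < θ.ord) ∧
    ∀ I, IsIdealOver I lam.ord → IsComplete I lam → (N → IsNormalIdeal I lam.ord) →
      ∃ p, ∀ τ < θ.ord, {i | i < lam.ord ∧ h p i = τ} ∉ I

section Pushforward

variable {lam : Cardinal.{u}} {δ : Ordinal.{u}} {J : Set (Set Ordinal.{u})} {C B : Set Ordinal.{u}}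

/-- The image on the ordinal `lam` of the restriction of an ideal over `δ` to `B`, under the
map `β ↦ otp (C ∩ β)`. -/
def pushIdeal (lam : Cardinal.{u}) (J : Set (Set Ordinal.{u})) (C B : Set Ordinal.{u}) :
    Set (Set Ordinal.{u}) :=
  {A | A ⊆ Iio lam.ord ∧ {β ∈ B | otp (C ∩ Iio β) ∈ A} ∈ J}

variable (hlam : lam.IsRegular) (hδ : δ.cof = lam) (hC : IsClubIn C δ) (hCo : otp C ≤ lam.ord)
  (hJ : IsIdealOver J δ) (hJc : IsComplete J lam) (hBδ : B ⊆ Iio δ) (hB : B ∉ J)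

include hC hCo in
theorem otp_inter_lt_ord {β : Ordinal.{u}} (hβ : β < δ) : otp (C ∩ Iio β) < lam.ord := by
  obtain ⟨h1, -, h3⟩ := isClubIn_iff.1 hC
  obtain ⟨y, hy, hby⟩ := h3 β hβ
  refine (otp_mono (o := δ) (inter_subset_inter_right _ (Iio_subset_Iio hby))
    (inter_subset_left.trans h1)).trans_lt ((otp_inter_lt h1 hy).trans_le hCo)

include hδ hC in
theorem exists_mem_otp_eq {ξ : Ordinal.{u}} (hξ : ξ < lam.ord) :
    ∃ y ∈ C, y < δ ∧ otp (C ∩ Iio y) = ξ := by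
  obtain ⟨h1, -, h3⟩ := isClubIn_iff.1 hC
  have h := ord_cof_le_otp h1 h3
  rw [hδ] at h
  obtain ⟨y, hy, h4⟩ := exists_otp_eq h1 (hξ.trans_le h)
  exact ⟨y, hy, h1 hy, h4⟩

-- As `δ` has cofinality `lam`, the order type of `C` is at least `lam.ord`. So for `γ < lam.ord`
-- there is a `γ`-th element of `C`, and all `β` of index less than `γ` lie below it: bounded sets
-- pull back to bounded sets. Properness is the positivity of `B`.
include hδ hC hCo hJ hBδ hB in
theorem pushIdeal_isIdealOver : IsIdealOver (pushIdeal lam J C B) lam.ord where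
  subset A hA := hA.1
  mono A hA A' h := ⟨h.trans hA.1, hJ.mono _ hA.2 _ fun β hβ => ⟨hβ.1, h hβ.2⟩⟩
  union A hA A' hA' := ⟨union_subset hA.1 hA'.1, hJ.mono _ (hJ.union _ hA.2 _ hA'.2) _
    fun β hβ => hβ.2.imp (fun h => ⟨hβ.1, h⟩) fun h => ⟨hβ.1, h⟩⟩
  bounded A γ hγ h := by
    refine ⟨h.trans (Iio_subset_Iio hγ.le), ?_⟩
    obtain ⟨y, -, hyδ, hy⟩ := exists_mem_otp_eq hδ hC hγ
    refine hJ.bounded _ y hyδ fun β hβ => ?_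
    by_contra hlt
    have h1 := otp_mono (o := δ) (A := C ∩ Iio y) (B := C ∩ Iio β)
      (inter_subset_inter_right _ (Iio_subset_Iio (not_lt.1 hlt))) (inter_subset_left.trans hC.1)
    rw [hy] at h1
    exact absurd (h hβ.2) (not_lt.2 h1)
  proper h := hB (hJ.mono _ h.2 _ fun β hβ => ⟨hβ, otp_inter_lt_ord hC hCo (hBδ hβ)⟩)

include hJc in
theorem pushIdeal_isComplete : IsComplete (pushIdeal lam J C B) lam := fun ι A hι hA => by
  refine ⟨iUnion_subset fun i => (hA i).1, ?_⟩
  convert hJc ι _ hι fun i => (hA i).2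
  ext β; simp

-- A regressive `g` on `lam` pulls back to the function sending `β` to the element of `C` with index
-- `g (otp (C ∩ Iio β))`, which lies below `β`. A bound `γ < δ` for the latter gives the bound `otp
-- (C ∩ Iio γ)` for `g`.
include hlam hδ hC hCo hJ hBδ hB in
theorem pushIdeal_isNormalIdeal (hJn : IsNormalIdeal J δ) :
    IsNormalIdeal (pushIdeal lam J C B) lam.ord := by
  have hI := pushIdeal_isIdealOver hδ hC hCo hJ hBδ hB
  rintro A g ⟨hA, hAI⟩ hg
  have key : ∀ ξ : Ordinal.{u}, ∃ y, ξ < lam.ord → y ∈ C ∧ y < δ ∧ otp (C ∩ Iio y) = ξ := fun ξ => by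
    by_cases h : ξ < lam.ord
    · obtain ⟨y, hy⟩ := exists_mem_otp_eq hδ hC h; exact ⟨y, fun _ => hy⟩
    · exact ⟨0, fun h' => absurd h' h⟩
  choose e he using key
  have hmono : ∀ β β' : Ordinal.{u}, β ≤ β' → otp (C ∩ Iio β) ≤ otp (C ∩ Iio β') := fun β β' h =>
    otp_mono (o := δ) (inter_subset_inter_right _ (Iio_subset_Iio h)) (inter_subset_left.trans hC.1)
  obtain ⟨B', hB', ⟨-, hpos⟩, γ, hγ, hgγ⟩ := hJn {β ∈ B | otp (C ∩ Iio β) ∈ A}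
    (fun β => if otp (C ∩ Iio β) = 0 then 0 else e (g (otp (C ∩ Iio β))))
    ⟨fun β hβ => hBδ hβ.1, fun h => hAI ⟨hA, h⟩⟩
    (by
      intro β hβ h0
      split_ifs with h
      · exact pos_iff_ne_zero.2 h0
      · have h1 := hg _ hβ.2 h
        have h2 := he _ (h1.trans (hA hβ.2))
        by_contra hlt
        exact absurd ((hmono _ _ (not_lt.1 hlt)).trans_eq h2.2.2) (not_le.2 h1))
  refine ⟨{ξ ∈ A | ξ ≠ 0 ∧ g ξ ≤ otp (C ∩ Iio γ)}, fun ξ h => h.1, ⟨fun ξ h => hA h.1, fun h => ?_⟩,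
    _, otp_inter_lt_ord hC hCo hγ, fun ξ h => h.2.2⟩
  -- Regressiveness says nothing at index 0; the `β` of that index form a null set.
  have h1 : Iio 1 ∈ pushIdeal lam J C B := hI.bounded _ 1
    (by simpa using (Cardinal.isSuccLimit_ord hlam.1).add_one_lt hlam.ord_pos) Subset.rfl
  refine hpos (hJ.mono _ (hJ.union _ h.2 _ h1.2) _ fun β hβ => ?_)
  by_cases h0 : otp (C ∩ Iio β) = 0
  · exact Or.inr ⟨(hB' hβ).1, by simp [h0]⟩
  · refine Or.inl ⟨(hB' hβ).1, (hB' hβ).2, h0, ?_⟩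
    have h2 := hgγ β hβ
    simp only [h0, if_false] at h2
    have h3 := he _ ((hg _ (hB' hβ).2 h0).trans (hA (hB' hβ).2))
    rw [← h3.2.2]
    exact hmono _ _ h2

end Pushforward

theorem isRegular_of_mem_E {κ lam : Cardinal.{u}} (hlam : ℵ₀ ≤ lam) {δ : Ordinal.{u}}
    (hδ : δ ∈ E κ lam) : lam.IsRegular := by
  have h := hδ.2
  rw [← h] at hlam ⊢
  exact Cardinal.isRegular_cof (Ordinal.one_lt_cof_iff.1 (Cardinal.one_lt_aleph0.trans_le hlam))

/-- Were each coloring `h p` to fail on a club `D p`, the intersection of the `D p` would be guessed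
at some `δ`. The coloring that works for the ideal pushed forward from the guessing set then
contradicts its own failure at `δ`. -/
theorem HasColorings.guess {κ lam θ : Cardinal.{u}} {N : Prop} (hcol : HasColorings lam θ N)
    (hκ : κ.IsRegular) (hlam : lam.IsRegular) (hlamκ : lam < κ)
    {T : Set Ordinal.{u}} {J : Ordinal.{u} → Set (Set Ordinal.{u})}
    (hJ : ∀ δ ∈ E κ lam, IsIdealOver (J δ) δ ∧ IsComplete (J δ) lam)
    (hN : N → ∀ δ ∈ E κ lam, IsNormalIdeal (J δ) δ)
    {C : Ordinal.{u} → Set Ordinal.{u}}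
    (hC : ∀ δ ∈ E κ lam, IsClubIn (C δ) δ ∧ otp (C δ) ≤ lam.ord)
    (hguess : ∀ D, IsClubIn D κ.ord → ∃ δ ∈ E κ lam,
      IsPositive (J δ) δ {β | β < δ ∧ next (C δ) β ∈ D ∩ T}) :
    ∃ h : Ordinal.{u} → Ordinal.{u}, (∀ i < lam.ord, h i < θ.ord) ∧
      ∀ D, IsClubIn D κ.ord → ∃ δ ∈ E κ lam, ∀ τ < θ.ord,
        IsPositive (J δ) δ
          {β | β < δ ∧ h (otp (C δ ∩ Iio β)) = τ ∧ next (C δ) β ∈ D ∩ T} := by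
  obtain ⟨X, h, hX, hθ, hcol⟩ := hcol
  by_contra hcon
  push Not at hcon
  choose D hD hfail using fun p => hcon (h p) (hθ p)
  have hclub := IsClubIn.biInter hκ (hlam.1.trans_lt hlamκ) (s := univ) (D := D)
    (by rw [Cardinal.mk_univ]; exact hX.trans_lt (Cardinal.lift_lt.2 hlamκ)) fun p _ => hD p
  obtain ⟨δ, hδ, hBδ, hB⟩ := hguess _ hclub
  obtain ⟨hCc, hCo⟩ := hC δ hδ
  obtain ⟨hJi, hJc⟩ := hJ δ hδ
  obtain ⟨p, hp⟩ := hcol _ (pushIdeal_isIdealOver hδ.2 hCc hCo hJi hBδ hB)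
    (pushIdeal_isComplete hJc)
    fun n => pushIdeal_isNormalIdeal hlam hδ.2 hCc hCo hJi hBδ hB (hN n δ hδ)
  obtain ⟨τ, hτ, hneg⟩ := hfail p δ hδ
  refine hp τ hτ ⟨fun i hi => hi.1, ?_⟩
  by_contra hpos
  refine hneg ⟨fun β hβ => hβ.1, fun hmem => hpos (hJi.mono _ hmem _ ?_)⟩
  rintro β ⟨⟨h1, ⟨-, h2⟩, h3⟩, -, h4⟩
  simp only [mem_iInter] at h2
  exact ⟨h1, h4, h2 p (mem_univ _), h3⟩


/-! ### Coding functions by sets; the colorings from `lam ^< lam = lam` and from diamond star -/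

section Coding

variable {c : Cardinal.{u}} {X : Type (u + 1)}

theorem exists_pairing (hc : ℵ₀ ≤ c) (hX : #X ≤ Cardinal.lift.{u + 1} c) :
    ∃ φ : X → Ordinal.{u} → Ordinal.{u}, (∀ p, ∀ t < c.ord, φ p t < c.ord) ∧
      ∀ p p' t t', t < c.ord → t' < c.ord → φ p t = φ p' t' → p = p' ∧ t = t' := by
  have h : #(X × Iio c.ord) ≤ #(Iio c.ord) := by
    rw [Cardinal.mk_prod, Cardinal.lift_id, Cardinal.lift_id, Cardinal.mk_Iio_ordinal,
      Cardinal.card_ord]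
    exact (mul_le_mul_left hX _).trans_eq (Cardinal.mul_eq_self (by simpa using hc))
  obtain ⟨e⟩ := h
  refine ⟨fun p t => if ht : t < c.ord then e (p, ⟨t, ht⟩) else 0, fun p t ht => ?_,
    fun p p' t t' ht ht' h => ?_⟩
  · simp only [ht, dif_pos]; exact (e _).2
  · simp only [ht, ht', dif_pos] at h
    have := e.injective (Subtype.ext h)
    simpa [Subtype.ext_iff] using this

/-- The value at `p` of the function of which the set of codes of pairs is `A`. -/
noncomputable def decode (c : Cardinal.{u}) (φ : X → Ordinal.{u} → Ordinal.{u})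
    (A : Set Ordinal.{u}) (p : X) : Ordinal.{u} :=
  sInf {t | t < c.ord ∧ φ p t ∈ A}

theorem decode_lt (hc : 0 < c.ord) {φ : X → Ordinal.{u} → Ordinal.{u}} {A : Set Ordinal.{u}} {p : X} :
    decode c φ A p < c.ord := by
  unfold decode
  rcases eq_empty_or_nonempty {t | t < c.ord ∧ φ p t ∈ A} with h | h
  · rw [h, Ordinal.sInf_empty]; exact hc
  · exact (csInf_mem h).1

/-- By injectivity of the coding, `τ p` is the only candidate at `p`, so a trace of the coding set
suffices as soon as it contains this one code. -/
theorem decode_eq {φ : X → Ordinal.{u} → Ordinal.{u}}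
    (hφ : ∀ p p' t t', t < c.ord → t' < c.ord → φ p t = φ p' t' → p = p' ∧ t = t')
    {τ : X → Ordinal.{u}} (hτ : ∀ p, τ p < c.ord) {β : Ordinal.{u}} {p : X} (hp : φ p (τ p) < β) :
    decode c φ (range (fun p => φ p (τ p)) ∩ Iio β) p = τ p := by
  have : {t | t < c.ord ∧ φ p t ∈ range (fun p => φ p (τ p)) ∩ Iio β} = {τ p} := by
    ext t
    constructor
    · rintro ⟨ht, ⟨p', hp'⟩, -⟩
      obtain ⟨rfl, rfl⟩ := hφ _ _ _ _ (hτ p') ht hp'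
      rfl
    · rintro rfl
      exact ⟨hτ p, ⟨p, rfl⟩, hp⟩
  rw [decode, this, csInf_singleton]

end Coding

section Ideals

variable {c : Cardinal.{u}} {I : Set (Set Ordinal.{u})} {δ : Ordinal.{u}}

theorem IsIdealOver.Ico_notMem (hI : IsIdealOver I δ) {γ : Ordinal.{u}} (hγ : γ < δ) :
    Ico γ δ ∉ I := by
  convert hI.inter_Ici hI.proper hγ using 2
  ext x; simp [and_comm]

/-- On ω the predecessor function is regressive, but it is bounded only on bounded sets, which are
null. -/
theorem IsNormalIdeal.aleph0_lt (hc : ℵ₀ ≤ c) (hI : IsIdealOver I c.ord)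
    (hIn : IsNormalIdeal I c.ord) : ℵ₀ < c := by
  refine lt_of_le_of_ne hc ?_
  rintro rfl
  have key : ∀ β : Ordinal.{u}, ∃ y, β < Cardinal.ord ℵ₀ → β ≠ 0 → y < β ∧ β ≤ y + 1 := fun β => by
    by_cases h : β < Cardinal.ord ℵ₀
    · rw [Cardinal.ord_aleph0] at h
      obtain ⟨n, rfl⟩ := Ordinal.lt_omega0.1 h
      refine ⟨((n - 1 : ℕ) : Ordinal), fun _ h0 => ?_⟩
      have h1 : n ≠ 0 := by simpa using h0
      constructor
      · exact_mod_cast Nat.sub_lt (Nat.pos_of_ne_zero h1) one_pos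
      · exact_mod_cast (by omega : n ≤ n - 1 + 1)
    · exact ⟨0, fun h' => absurd h' h⟩
  choose f hf using key
  obtain ⟨B', hB', ⟨hB'', hpos⟩, γ, hγ, hfγ⟩ := hIn _ f ⟨Subset.rfl, hI.proper⟩
    fun β hβ h0 => (hf β hβ h0).1
  have hlim := Cardinal.isSuccLimit_ord.{u} le_rfl
  refine hpos (hI.bounded B' (γ + 1 + 1) (hlim.add_one_lt (hlim.add_one_lt hγ)) fun β hβ => ?_)
  rcases eq_or_ne β 0 with rfl | h0
  · exact pos_of_gt (lt_add_one (γ + 1))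
  · have h1 := (hf β (hB'' hβ) h0).2
    have h2 : f β + 1 < γ + 1 + 1 :=
      (Order.add_one_le_of_lt ((hfγ β hβ).trans_lt (lt_add_one γ))).trans_lt (lt_add_one _)
    exact h1.trans_lt h2

/-- Clubs belong to the dual filter of a normal ideal. -/
theorem IsNormalIdeal.diff_club (hc : c.IsRegular) (hI : IsIdealOver I c.ord) (hIc : IsComplete I c)
    (hIn : IsNormalIdeal I c.ord) {D : Set Ordinal.{u}} (hD : IsClubIn D c.ord) :
    Iio c.ord \ D ∈ I := by
  obtain ⟨h1, h2, h3⟩ := isClubIn_iff.1 hD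
  have hlim := Cardinal.isSuccLimit_ord hc.1
  have hA : ∀ x < c.ord, {β | β < c.ord ∧ ∀ y ∈ D, x < y → β ≤ y} ∈ I := fun x hx => by
    obtain ⟨y, hy, hxy⟩ := h3 _ (hlim.add_one_lt hx)
    refine hI.bounded _ (y + 1) (hlim.add_one_lt (h1 hy)) fun β hβ => ?_
    exact (hβ.2 y hy ((lt_add_one x).trans_le hxy)).trans_lt (lt_add_one y)
  -- A nonzero `β` outside `D` is not a limit of `D`: for some `x < β` no element of `D` lies
  -- strictly between. For a fixed `x` these `β` are bounded by the next element of `D`, so the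
  -- complement of `D` is, up to 0, a diagonal union of bounded sets.
  refine hI.mono _ (hI.union _ (hIn.diag hc hI hIc hA) _
    (hI.bounded {0} (0 + 1) (hlim.add_one_lt hc.ord_pos) (by simp))) _ fun β hβ => ?_
  by_cases h0 : β = 0
  · exact Or.inr h0
  · refine Or.inl ⟨hβ.1, ?_⟩
    by_contra hcon
    refine hβ.2 (h2 β hβ.1 ⟨h0, fun x hx => ?_⟩)
    by_contra hno
    refine hcon ⟨x, hx, hβ.1, fun y hy hxy => ?_⟩
    by_contra hlt
    exact hno ⟨y, hy, hxy, not_le.1 hlt⟩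

end Ideals

/-- Let `e ξ`, `ξ < lam.ord`, enumerate the functions from `ν` to `lam`. Since `β` has at most `ν`
predecessors, one `x β` can meet every `e ξ` with `ξ < β`, each at its own coordinate. If `i ↦ τ i`
lists null colors and equals `e ξ`, all `β > ξ` lie in a union of `ν` null sets. -/
theorem hasColorings_of_powerlt {lam ν : Cardinal.{u}} (hlam : lam.IsRegular) (hpow : lam ^< lam = lam)
    (hν : lam = Order.succ ν) (N : Prop) : HasColorings lam lam N := by
  have hνlam : ν < lam := hν ▸ Order.lt_succ ν
  have hpow' : lam ^ ν ≤ lam := (Cardinal.le_powerlt lam hνlam).trans_eq hpow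
  have hX : #(Iio ν.ord) = Cardinal.lift.{u + 1} ν := by rw [Cardinal.mk_Iio_ordinal, Cardinal.card_ord]
  have hlam' : #(Iio lam.ord) = Cardinal.lift.{u + 1} lam := by
    rw [Cardinal.mk_Iio_ordinal, Cardinal.card_ord]
  have hfun : #(Iio ν.ord → Iio lam.ord) ≤ #(Iio lam.ord) := by
    rw [← Cardinal.power_def, hX, hlam', ← Cardinal.lift_power]
    exact Cardinal.lift_le.2 hpow'
  have : Nonempty (Iio lam.ord) := ⟨⟨0, hlam.ord_pos⟩⟩
  obtain ⟨j⟩ := hfun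
  let e := Function.invFun j
  have he : Function.Surjective e := Function.invFun_surjective j.injective
  have key : ∀ β : Ordinal.{u}, ∃ x : Iio ν.ord → Iio lam.ord, β < lam.ord →
      ∀ ξ : Iio lam.ord, (ξ : Ordinal) < β → ∃ i, x i = e ξ i := fun β => by
    by_cases hβ : β < lam.ord
    · have h1 : #(Iio β) ≤ #(Iio ν.ord) := by
        rw [hX, Cardinal.mk_Iio_ordinal, Cardinal.lift_le, ← Order.lt_succ_iff, ← hν]
        exact Cardinal.lt_ord.1 hβ
      obtain ⟨k⟩ := h1
      rcases isEmpty_or_nonempty (Iio β) with hem | hne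
      · exact ⟨fun _ => ⟨0, hlam.ord_pos⟩, fun _ ξ hξ => (hem.false ⟨ξ, hξ⟩).elim⟩
      · refine ⟨fun i => e ⟨(Function.invFun k i : Iio β), (mem_Iio.1 (Function.invFun k i).2).trans hβ⟩ i,
          fun _ ξ hξ => ⟨k ⟨ξ, hξ⟩, ?_⟩⟩
        have h2 : Function.invFun k (k ⟨ξ, hξ⟩) = ⟨(ξ : Ordinal.{u}), hξ⟩ :=
          Function.leftInverse_invFun k.injective _
        exact congrArg (fun z => e z (k ⟨ξ, hξ⟩))
          (Subtype.ext (congrArg (fun z : Iio β => (z : Ordinal.{u})) h2))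
    · exact ⟨fun _ => ⟨0, hlam.ord_pos⟩, fun h => absurd h hβ⟩
  choose x hx using key
  refine ⟨Iio ν.ord, fun i β => x β i, hX.trans_le (Cardinal.lift_le.2 hνlam.le),
    fun i β _ => (x β i).2, fun I hI hIc _ => ?_⟩
  by_contra hcon
  push Not at hcon
  choose τ hτ hτI using hcon
  obtain ⟨ξ, hξ⟩ := he fun i => ⟨τ i, hτ i⟩
  refine hI.Ico_notMem ((Cardinal.isSuccLimit_ord hlam.1).add_one_lt ξ.2) (hI.mono _
    (hIc.biUnion (s := univ) (by rw [Cardinal.mk_univ, hX]; exact Cardinal.lift_lt.2 hνlam)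
      fun i _ => hτI i) _ fun β hβ => ?_)
  obtain ⟨i, hi⟩ := hx β hβ.2 ξ ((lt_add_one _).trans_le hβ.1)
  simp only [mem_iUnion]
  refine ⟨i, mem_univ _, hβ.2, ?_⟩
  rw [hi, hξ]

/-- If `τ i` is a null color of the `i`-th coloring, the code of `τ` is guessed at club many `β`, as
the `ξ`-th member of the family for some `ξ < β`. If `β` is also closed under coding, the `ξ`-th
coloring takes the value `τ ξ` at `β`. So a club lies in the diagonal union of null sets. -/
theorem hasColorings_of_diamondStar {lam : Cardinal.{u}} (hlam : lam.IsRegular)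
    (hd : DiamondStar lam) : HasColorings lam lam True := by
  obtain ⟨𝒜, hA, hguess⟩ := hd
  have hlim := Cardinal.isSuccLimit_ord hlam.1
  have hX : #(Iio lam.ord) ≤ Cardinal.lift.{u + 1} lam := by
    rw [Cardinal.mk_Iio_ordinal, Cardinal.card_ord]
  obtain ⟨φ, hφ, hφi⟩ := exists_pairing hlam.1 hX
  have key : ∀ β : Ordinal.{u}, ∃ e : Ordinal.{u} → Set Ordinal.{u}, β < lam.ord →
      ∀ A ∈ 𝒜 β, ∃ ξ < β, e ξ = A := fun β => by
    by_cases hβ : β < lam.ord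
    · have h1 : #(𝒜 β) ≤ #(Iio β) := by
        rw [Cardinal.mk_Iio_ordinal]
        exact (hA β hβ).2
      obtain ⟨k⟩ := h1
      refine ⟨fun ξ => {t | ∃ A : 𝒜 β, (k A : Ordinal) = ξ ∧ t ∈ (A : Set Ordinal.{u})},
        fun _ A hA => ⟨k ⟨A, hA⟩, (k _).2, ?_⟩⟩
      ext t
      constructor
      · rintro ⟨A', h, ht⟩
        rwa [k.injective (Subtype.ext h)] at ht
      · exact fun ht => ⟨⟨A, hA⟩, rfl, ht⟩
    · exact ⟨fun _ => ∅, fun h => absurd h hβ⟩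
  choose e he using key
  refine ⟨Iio lam.ord, fun i β => decode lam φ (e β i) i, hX,
    fun i β _ => decode_lt hlam.ord_pos, fun I hI hIc hIn => ?_⟩
  replace hIn := hIn trivial
  have hlam' := hIn.aleph0_lt hlam.1 hI
  by_contra hcon
  push Not at hcon
  choose τ hτ hτI using hcon
  obtain ⟨D, hD, hDX⟩ := hguess (range fun i => φ i (τ i))
    (by rintro _ ⟨i, rfl⟩; exact hφ i _ (hτ i))
  have hcl := isClubIn_closed hlam hlam'
    (F := fun y => {z | ∃ hy : y < lam.ord, z = φ ⟨y, hy⟩ (τ ⟨y, hy⟩)})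
    (by rintro y hy _ ⟨_, rfl⟩; exact hφ _ _ (hτ _))
    (by
      intro y hy
      convert mk_singleton_lt hlam (φ ⟨y, hy⟩ (τ ⟨y, hy⟩)) using 4
      ext z; simp [hy])
  have hAI : ∀ i < lam.ord, {β | ∃ hi : i < lam.ord, β < lam.ord ∧
      decode lam φ (e β i) ⟨i, hi⟩ = τ ⟨i, hi⟩} ∈ I := fun i hi => by
    convert hτI ⟨i, hi⟩ using 2
    ext β; simp [hi]
  refine hI.proper (hI.mono _ (hI.union _ (hIn.diag hlam hI hIc hAI) _
    (hIn.diff_club hlam hI hIc (hD.inter hlam hlam' hcl))) _ fun β hβ => ?_)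
  by_cases hβD : β ∈ D ∩ {δ | δ < lam.ord ∧ Order.IsSuccLimit δ ∧
      ∀ y < δ, ∀ z ∈ {z | ∃ hy : y < lam.ord, z = φ ⟨y, hy⟩ (τ ⟨y, hy⟩)}, z < δ}
  · obtain ⟨ξ, hξ, hξe⟩ := he β hβ _ (hDX β hβD.1)
    refine Or.inl ⟨hβ, ξ, hξ, lt_trans hξ hβ, hβ, ?_⟩
    rw [hξe]
    exact decode_eq hφi hτ (hβD.2.2.2 ξ hξ _ ⟨lt_trans hξ hβ, rfl⟩)
  · exact Or.inr ⟨hβ, hβD⟩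


/-! ### Moving ordinals by finite words; the colorings from diamond -/

section Words

/-- Finite words with parameters below `μ`. -/
def Words (μ : Ordinal.{u}) : Set (List (Fin 4 × Ordinal.{u})) :=
  {s | ∀ p ∈ s, p.2 < μ}

theorem Words.mono {μ ν : Ordinal.{u}} (h : μ ≤ ν) : Words μ ⊆ Words ν := fun _ hs p hp =>
  (hs p hp).trans_le h

theorem nil_mem_Words (μ : Ordinal.{u}) : [] ∈ Words μ := fun p hp => by simp at hp

theorem cons_mem_Words {μ ν : Ordinal.{u}} {s : List (Fin 4 × Ordinal.{u})} (hs : s ∈ Words μ)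
    (hν : ν < μ) (i : Fin 4) : (i, ν) :: s ∈ Words μ := fun p hp => by
  rcases List.mem_cons.1 hp with rfl | hp
  · exact hν
  · exact hs p hp

theorem exists_mem_Words_add_one {μ : Ordinal.{u}} (hμ : Order.IsSuccLimit μ)
    {s : List (Fin 4 × Ordinal.{u})} (hs : s ∈ Words μ) : ∃ y < μ, s ∈ Words (y + 1) := by
  induction s with
  | nil => exact ⟨0, hμ.bot_lt, nil_mem_Words _⟩
  | cons p s ih =>
    obtain ⟨y, hy, hsy⟩ := ih fun q hq => hs q (List.mem_cons_of_mem _ hq)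
    refine ⟨max y p.2, max_lt hy (hs p List.mem_cons_self), ?_⟩
    exact cons_mem_Words (Words.mono (by gcongr; exact le_max_left _ _) hsy)
      ((le_max_right y p.2).trans_lt (lt_add_one _)) p.1

theorem mk_Words_le {c : Cardinal.{u}} (hc : ℵ₀ ≤ c) {μ : Ordinal.{u}} (hμ : μ.card ≤ c) :
    #(Words μ) ≤ Cardinal.lift.{u + 1} c := by
  have h1 : Words μ ⊆ range (List.map (fun p : Fin 4 × Iio μ => (p.1, (p.2 : Ordinal)))) := by
    intro s hs
    induction s with
    | nil => exact ⟨[], rfl⟩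
    | cons p s ih =>
      obtain ⟨l, hl⟩ := ih fun q hq => hs q (List.mem_cons_of_mem _ hq)
      exact ⟨(p.1, ⟨p.2, hs p List.mem_cons_self⟩) :: l, by simp [hl]⟩
  have hc' : ℵ₀ ≤ Cardinal.lift.{u + 1} c := by simpa using hc
  refine (Cardinal.mk_le_mk_of_subset h1).trans (Cardinal.mk_range_le.trans ?_)
  refine (Cardinal.mk_list_le_max _).trans (max_le hc' ?_)
  rw [Cardinal.mk_prod, Cardinal.lift_id', Cardinal.mk_Iio_ordinal]
  refine Cardinal.mul_le_of_le hc' ?_ (by simpa [-Ordinal.lift_card] using hμ)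
  refine le_trans ?_ hc'
  simp

theorem mk_Words_lt {c : Cardinal.{u}} (hc : ℵ₀ < c) {μ : Ordinal.{u}} (hμ : μ < c.ord) :
    #(Words μ) < Cardinal.lift.{u + 1} c :=
  (mk_Words_le (le_max_left _ _) (le_max_right ℵ₀ μ.card)).trans_lt
    (Cardinal.lift_lt.2 (max_lt hc (Cardinal.lt_ord.1 hμ)))

/-- The action of a word on an ordinal, when the letters act by `op`. -/
def act (op : Fin 4 → Ordinal.{u} → Ordinal.{u} → Ordinal.{u})
    (s : List (Fin 4 × Ordinal.{u})) (β : Ordinal.{u}) : Ordinal.{u} :=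
  s.foldr (fun p α => op p.1 p.2 α) β

end Words

theorem exists_cofinal_seq (α : Ordinal.{u}) :
    ∃ f : Ordinal.{u} → Ordinal.{u}, (∀ j < α.cof.ord, f j < α) ∧
      ∀ x < α, ∃ j < α.cof.ord, x ≤ f j := by
  obtain ⟨s, hs, hsc⟩ := Order.exists_cof_eq (α := Iio α)
  rw [Ordinal.cof_Iio, ← Ordinal.lift_cof] at hsc
  have : #s = #(Iio α.cof.ord) := by rw [hsc, Cardinal.mk_Iio_ordinal, Cardinal.card_ord]
  obtain ⟨e⟩ := Cardinal.eq.1 this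
  refine ⟨fun j => if hj : j < α.cof.ord then ((e.symm ⟨j, hj⟩ : s) : Iio α) else 0,
    fun j hj => ?_, fun x hx => ?_⟩
  · simp only [hj, dif_pos]; exact (e.symm ⟨j, hj⟩ : s).1.2
  · obtain ⟨y, hy, hxy⟩ := hs ⟨x, hx⟩
    refine ⟨e ⟨y, hy⟩, (e ⟨y, hy⟩).2, ?_⟩
    have h : ((e ⟨y, hy⟩ : Iio α.cof.ord) : Ordinal) < α.cof.ord := (e ⟨y, hy⟩).2
    have h2 : e.symm ⟨(e ⟨y, hy⟩ : Iio α.cof.ord), h⟩ = ⟨y, hy⟩ := e.symm_apply_apply _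
    simp only [h, dif_pos, h2]
    exact hxy

theorem mem_Reg_of_cof {α : Ordinal.{u}} (hα : Order.IsSuccLimit α) (h : α ≤ α.cof.ord) : α ∈ Reg :=
  ⟨α.cof, Cardinal.isRegular_cof hα, le_antisymm (Ordinal.ord_cof_le α) h⟩

/-- If every uncountable regular cardinal below `lam` has a nonstationary trace of some `M η` then
every `β` can be moved, by a word with parameters below `μ`, to `μ` or else to some `δ > μ` for
which `μ` lies in a club in `δ` disjoint from some `M η` with `η < μ`. -/
theorem exists_op {lam : Ordinal.{u}} {M : Ordinal.{u} → Set Ordinal.{u}}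
    (hM : ∀ α < lam, α ∈ Reg → Ordinal.omega0 < α → ∃ η < α, ¬ IsStatIn (M η) α) :
    ∃ (op : Fin 4 → Ordinal.{u} → Ordinal.{u} → Ordinal.{u}) (C : Ordinal.{u} → Set Ordinal.{u})
      (η : Ordinal.{u} → Ordinal.{u}),
      (∀ ν α, op 3 ν α = sInf (C α \ Iio ν)) ∧
      ∀ μ, Order.IsSuccLimit μ → Ordinal.omega0 < μ → ∀ β, μ ≤ β → β < lam →
        (∃ s ∈ Words μ, act op s β = μ) ∨
        ∃ s ∈ Words μ, μ < act op s β ∧ act op s β < lam ∧ η (act op s β) < μ ∧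
          IsClubIn (C (act op s β)) (act op s β) ∧
          (∀ x ∈ C (act op s β), x ∉ M (η (act op s β))) ∧ μ ∈ C (act op s β) ∧
          ∀ ν < μ, op 3 ν (act op s β) < μ := by
  have key : ∀ α : Ordinal.{u}, ∃ (η : Ordinal.{u}) (C : Set Ordinal.{u}),
      α < lam → α ∈ Reg → Ordinal.omega0 < α →
        η < α ∧ IsClubIn C α ∧ ∀ x ∈ C, x ∉ M η := fun α => by
    by_cases h : α < lam ∧ α ∈ Reg ∧ Ordinal.omega0 < α
    · obtain ⟨η, hη, hst⟩ := hM α h.1 h.2.1 h.2.2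
      obtain ⟨C, hC, hC'⟩ := not_isStatIn_iff.1 hst
      exact ⟨η, C, fun _ _ _ => ⟨hη, hC, hC'⟩⟩
    · exact ⟨0, ∅, fun h1 h2 h3 => absurd ⟨h1, h2, h3⟩ h⟩
  choose η C hηC using key
  choose f hf hf' using exists_cofinal_seq.{u}
  let op : Fin 4 → Ordinal.{u} → Ordinal.{u} → Ordinal.{u} := fun i ν α =>
    ![α.cof.ord, η α, f α ν, sInf (C α \ Iio ν)] i
  refine ⟨op, C, η, fun ν α => rfl, fun μ hμ hωμ β hμβ hβ => ?_⟩
  -- Let `δ` be the least ordinal, not below `μ`, that words with parameters below `μ` reach from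
  -- `β`. A further letter with parameter below `μ` that lowers `δ` must lower it below `μ`.
  have hne : {γ | μ ≤ γ ∧ ∃ s ∈ Words μ, act op s β = γ}.Nonempty :=
    ⟨β, hμβ, [], nil_mem_Words μ, rfl⟩
  obtain ⟨hδμ, s, hs, hsδ⟩ := csInf_mem hne
  have hmin : ∀ γ, (∃ s ∈ Words μ, act op s β = γ) → γ < sInf {γ | μ ≤ γ ∧ ∃ s ∈ Words μ, act op s β = γ} →
      γ < μ := fun γ h1 h2 => by
    by_contra h3
    have h4 : γ ∈ {γ | μ ≤ γ ∧ ∃ s ∈ Words μ, act op s β = γ} := ⟨not_lt.1 h3, h1⟩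
    exact absurd (csInf_le' h4) (not_le.2 h2)
  have hδβ : sInf {γ | μ ≤ γ ∧ ∃ s ∈ Words μ, act op s β = γ} ≤ β :=
    csInf_le' ⟨hμβ, [], nil_mem_Words μ, rfl⟩
  rcases hδμ.eq_or_lt with heq | hlt
  · exact Or.inl ⟨s, hs, hsδ.trans heq.symm⟩
  refine Or.inr ⟨s, hs, ?_⟩
  rw [hsδ]
  set δ := sInf {γ | μ ≤ γ ∧ ∃ s ∈ Words μ, act op s β = γ} with hδ
  have hstep : ∀ (i : Fin 4) (ν : Ordinal.{u}), ν < μ → op i ν δ < δ → op i ν δ < μ := by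
    intro i ν hν h
    refine hmin _ ⟨(i, ν) :: s, cons_mem_Words hs hν i, ?_⟩ h
    show op i ν (act op s β) = _
    rw [hsδ]
  have h0 : 0 < μ := hμ.bot_lt
  have hδlam : δ < lam := hδβ.trans_lt hβ
  -- If `δ` were singular, letter 0 would put its cofinality below `μ`, and letter 2 would then
  -- reach a member of its cofinal sequence in the interval from `μ` to `δ`.
  have hcofδ : ¬ δ.cof.ord < δ := fun h => by
    have h1 : δ.cof.ord < μ := hstep 0 0 h0 h
    obtain ⟨j, hj, hj'⟩ := hf' δ μ hlt
    exact absurd (hstep 2 j (hj.trans h1) (hf δ j hj)) (not_lt.2 hj')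
  have hδlim : Order.IsSuccLimit δ := by
    rw [← Ordinal.one_lt_cof_iff]
    have h1 : Ordinal.omega0 < δ.cof.ord := (hωμ.trans hlt).trans_le (not_lt.1 hcofδ)
    rw [← Cardinal.ord_aleph0, Cardinal.ord_lt_ord] at h1
    exact Cardinal.one_lt_aleph0.trans h1
  have hReg := mem_Reg_of_cof hδlim (not_lt.1 hcofδ)
  obtain ⟨h1, h2, h3⟩ := hηC δ hδlam hReg (hωμ.trans hlt)
  obtain ⟨hCs, hCc, hCu⟩ := isClubIn_iff.1 h2
  have h3' : ∀ ν < μ, sInf (C δ \ Iio ν) ∈ C δ \ Iio ν ∧ sInf (C δ \ Iio ν) < μ := by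
    intro ν hν
    obtain ⟨y, hy, hνy⟩ := hCu ν (hν.trans hlt)
    have hmem : sInf (C δ \ Iio ν) ∈ C δ \ Iio ν := csInf_mem ⟨y, hy, not_lt.2 hνy⟩
    exact ⟨hmem, hstep 3 ν hν (hCs hmem.1)⟩
  -- Letter 3 finds elements of `C δ` below `μ` and above any given `x < μ`, so `μ` is in `C δ` by
  -- closure.
  refine ⟨hlt, hδlam, hstep 1 0 h0 h1, h2, h3, hCc μ hlt ⟨h0.ne', fun x hx => ?_⟩,
    fun ν hν => (h3' ν hν).2⟩
  obtain ⟨⟨h4, h5⟩, h6⟩ := h3' (x + 1) (hμ.add_one_lt hx)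
  exact ⟨_, h4, (lt_add_one x).trans_le (not_lt.1 h5), h6⟩

section Diamond

/-- As `D` is closed and omits `α`, it is bounded below `α`. -/
theorem not_isStatIn_of_notMem {α : Ordinal.{u}} (hα : α ∈ Reg) {lam : Ordinal.{u}} (hlam : α < lam)
    {D : Set Ordinal.{u}} (hD : IsClubIn D lam) (hαD : α ∉ D) : ¬ IsStatIn D α := by
  obtain ⟨c, hc, rfl⟩ := hα
  rw [not_isStatIn_iff]
  have h : ∃ x < c.ord, ∀ y ∈ D, x < y → c.ord ≤ y := by
    by_contra hcon
    push Not at hcon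
    exact hαD ((isClubIn_iff.1 hD).2.1 _ hlam ⟨hc.ord_pos.ne', hcon⟩)
  obtain ⟨x, hx, hx'⟩ := h
  exact ⟨_, isClubIn_Ioo hc hx, fun y hy hyD => absurd (hx' y hyD hy.1) (not_le.2 hy.2)⟩

/-- There are no limits below ω, so every unbounded subset of ω is a club. -/
theorem IsStatIn.omega0 {S : Set Ordinal.{u}} (hS : IsStatIn S (Cardinal.ord ℵ₀)) :
    ∃ n < (Cardinal.ord ℵ₀ : Ordinal.{u}), ∀ x, n < x → x < Cardinal.ord ℵ₀ → x ∈ S := by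
  by_contra hcon
  push Not at hcon
  have hclub : IsClubIn {x | x < Cardinal.ord ℵ₀ ∧ x ∉ S} (Cardinal.ord ℵ₀) := by
    refine isClubIn_iff.2 ⟨fun x hx => hx.1, fun δ hδ hacc => ?_, fun x hx => ?_⟩
    · exfalso
      rw [Cardinal.ord_aleph0] at hδ
      obtain ⟨n, rfl⟩ := Ordinal.lt_omega0.1 hδ
      rcases n with _ | n
      · exact hacc.1 (by simp)
      · obtain ⟨y, -, h1, h2⟩ := hacc.2 n (by exact_mod_cast Nat.lt_succ_self n)
        rw [Nat.cast_add_one] at h2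
        exact absurd (Order.add_one_le_of_lt h1) (not_le.2 h2)
    · obtain ⟨y, h1, h2, h3⟩ := hcon x hx
      exact ⟨y, ⟨h2, h3⟩, h1.le⟩
  obtain ⟨x, hxS, -, hx⟩ := isStatIn_iff.1 hS _ hclub
  exact hx hxS

theorem not_diamond_aleph0 : ¬ Diamond.{u} ℵ₀ := by
  rintro ⟨A, -, hA⟩
  have hlim := Cardinal.isSuccLimit_ord.{u} le_rfl
  obtain ⟨m, hm, hm'⟩ := (hA ∅ (empty_subset _)).omega0
  obtain ⟨n, hn, hn'⟩ := (hA {0} (by simp)).omega0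
  have hx : max m n + 1 < Cardinal.ord ℵ₀ := hlim.add_one_lt (max_lt hm hn)
  have h1 := hm' _ ((le_max_left m n).trans_lt (lt_add_one _)) hx
  have h2 := hn' _ ((le_max_right m n).trans_lt (lt_add_one _)) hx
  have h3 : (0 : Ordinal.{u}) ∈ ({0} : Set Ordinal.{u}) ∩ Iio (max m n + 1) :=
    ⟨rfl, mem_Iio.2 (lt_of_le_of_lt zero_le (lt_add_one _))⟩
  rw [← show A _ = _ from h2, show A _ = _ from h1] at h3
  exact h3.1

/-- Let the club `D` miss all regular cardinals and choose `μ ∈ D` at which the code of the null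
colors `τ` is guessed. The second alternative of `exists_op` would put `μ` into a club disjoint from
`D`, so every `β ≥ μ` is moved to `μ` by a word `s` with parameters below `μ`, and the coloring of
`s` has value `τ s` at `β`. There are fewer than `lam` such words. -/
theorem hasColorings_of_diamond {lam : Cardinal.{u}} (hlam : lam.IsRegular) (hd : Diamond lam)
    (hM : ¬ IsMahlo lam) (N : Prop) : HasColorings lam lam N := by
  have hlam' : ℵ₀ < lam := lt_of_le_of_ne hlam.1 fun h => not_diamond_aleph0 (h ▸ hd)
  obtain ⟨D, hD, hDReg⟩ := not_isStatIn_iff.1 fun h => hM ⟨hlam, hlam', h⟩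
  obtain ⟨op, C, η, -, hop⟩ := exists_op (lam := lam.ord) (M := fun _ => D)
    fun α hα hReg hω => ⟨0, pos_of_gt hω, not_isStatIn_of_notMem hReg hα hD fun h => hDReg α h hReg⟩
  obtain ⟨A, -, hA⟩ := hd
  have hX : #(Words lam.ord) ≤ Cardinal.lift.{u + 1} lam := mk_Words_le hlam.1 (by simp)
  obtain ⟨φ, hφ, hφi⟩ := exists_pairing hlam.1 hX
  refine ⟨Words lam.ord, fun s β => decode lam φ (A (act op s β)) s, hX,
    fun _ _ _ => decode_lt hlam.ord_pos, fun I hI hIc _ => ?_⟩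
  by_contra hcon
  push Not at hcon
  choose τ hτ hτI using hcon
  have hcl := isClubIn_closed hlam hlam'
    (F := fun y => (fun s : Words lam.ord => φ s (τ s)) '' {s | (s : List _) ∈ Words (y + 1)})
    (by rintro y hy _ ⟨s, -, rfl⟩; exact hφ _ _ (hτ _))
    (by
      intro y hy
      refine Cardinal.mk_image_le.trans_lt (lt_of_le_of_lt ?_ (mk_Words_lt hlam'
        ((Cardinal.isSuccLimit_ord hlam.1).add_one_lt hy)))
      exact Cardinal.mk_le_of_injective (f := fun s => (⟨s.1.1, s.2⟩ : Words (y + 1)))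
        fun s t h => by simpa [Subtype.ext_iff] using h)
  have hω : Ordinal.omega0 < lam.ord := by rwa [← Cardinal.ord_aleph0, Cardinal.ord_lt_ord]
  obtain ⟨μ, hμA, ⟨hμD, hμω, -⟩, hμlam, hμlim, hμcl⟩ := isStatIn_iff.1
    (hA (range fun s => φ s (τ s)) (by rintro _ ⟨s, rfl⟩; exact hφ s _ (hτ s))) _
    ((hD.inter hlam hlam' (isClubIn_Ioo hlam hω)).inter hlam hlam' hcl)
  refine hI.Ico_notMem hμlam (hI.mono _ (hIc.biUnion (s := {s : Words lam.ord | (s : List _) ∈ Words μ})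
    (A := fun s => {β | β < lam.ord ∧ decode lam φ (A (act op s β)) s = τ s})
    ?_ fun s _ => hτI s) _ fun β hβ => ?_)
  · refine lt_of_le_of_lt ?_ (mk_Words_lt hlam' hμlam)
    exact Cardinal.mk_le_of_injective (f := fun s => (⟨s.1.1, s.2⟩ : Words μ))
      fun s t h => by simpa [Subtype.ext_iff] using h
  · simp only [mem_iUnion]
    rcases hop μ hμlim hμω β hβ.1 hβ.2 with ⟨s, hs, hsμ⟩ | ⟨s, hs, -, -, -, -, h1, h2, -⟩
    · refine ⟨⟨s, Words.mono hμlam.le hs⟩, hs, hβ.2, ?_⟩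
      rw [hsμ, show A μ = _ from hμA]
      obtain ⟨y, hy, hsy⟩ := exists_mem_Words_add_one hμlim hs
      exact decode_eq hφi hτ (hμcl y hy _ ⟨_, hsy, rfl⟩)
    · exact absurd hμD (h1 μ h2)

end Diamond


theorem IsClubIn.isStatIn {c : Cardinal.{u}} (hc : c.IsRegular) (hc' : ℵ₀ < c) {D : Set Ordinal.{u}}
    (hD : IsClubIn D c.ord) : IsStatIn D c.ord :=
  isStatIn_iff.2 fun E hE => by
    obtain ⟨x, hx, -⟩ := (isClubIn_iff.1 (hD.inter hc hc' hE)).2.2 0 hc.ord_pos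
    exact ⟨x, hx⟩

theorem IsIdealOver.nonempty_of_notMem {I : Set (Set Ordinal.{u})} {δ : Ordinal.{u}}
    (hI : IsIdealOver I δ) (hδ : 0 < δ) {B : Set Ordinal.{u}} (hB : B ∉ I) : B.Nonempty := by
  rw [nonempty_iff_ne_empty]
  rintro rfl
  exact hB (hI.bounded ∅ 0 hδ (empty_subset _))

/-! ### Greatly Mahlo cardinals and simultaneous reflection -/

section GreatlyMahlo

variable {c : Cardinal.{u}}

/-- The uncountable regular cardinals below `c` which reflect all `M η` of smaller index. -/
def reflecting (c : Cardinal.{u}) (M : Ordinal.{u} → Set Ordinal.{u}) : Set Ordinal.{u} :=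
  {α | α < c.ord ∧ α ∈ Reg ∧ Ordinal.omega0 < α ∧ ∀ η < α, IsStatIn (M η) α}

/-- The ideal generated by the nonstationary ideal and the complements of the sets
`reflecting c M`, where `M` ranges over the sequences of stationary sets. -/
def reflectionIdeal (c : Cardinal.{u}) : Set (Set Ordinal.{u}) :=
  {A | A ⊆ Iio c.ord ∧ ∃ M : Ordinal.{u} → Set Ordinal.{u},
    (∀ η < c.ord, IsStatIn (M η) c.ord) ∧
      ∃ D, IsClubIn D c.ord ∧ ∀ x ∈ D, x ∈ reflecting c M → x ∉ A}

/-- A pairing function merges the witnesses for all `A i` into one sequence of stationary sets. If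
`α` is closed under the pairing and reflects the merged sequence, it reflects those for every `A i`
with `i < α`. This one statement yields finite unions, completeness and normality. -/
theorem reflectionIdeal_diag (hc : c.IsRegular) (hc' : ℵ₀ < c) {A : Ordinal.{u} → Set Ordinal.{u}}
    (hA : ∀ i < c.ord, A i ∈ reflectionIdeal c) {B : Set Ordinal.{u}} (hB : B ⊆ Iio c.ord)
    {γ : Ordinal.{u}} (hγ : γ < c.ord) (hBA : ∀ β ∈ B, γ < β → ∃ i < β, β ∈ A i) :
    B ∈ reflectionIdeal c := by
  have hX : #(Iio c.ord) ≤ Cardinal.lift.{u + 1} c := by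
    rw [Cardinal.mk_Iio_ordinal, Cardinal.card_ord]
  have key : ∀ i : Ordinal.{u}, ∃ M D, i < c.ord → (∀ η < c.ord, IsStatIn (M η) c.ord) ∧
      IsClubIn D c.ord ∧ ∀ x ∈ D, x ∈ reflecting c M → x ∉ A i := fun i => by
    by_cases h : i < c.ord
    · obtain ⟨-, M, hM, D, hD⟩ := hA i h; exact ⟨M, D, fun _ => ⟨hM, hD⟩⟩
    · exact ⟨fun _ => ∅, ∅, fun h' => absurd h' h⟩
  choose M D hMD using key
  obtain ⟨φ, hφ, hφi⟩ := exists_pairing hc.1 hX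
  obtain ⟨Δ, hΔ, hΔD⟩ := isClubIn_diag hc hc' fun i hi => (hMD i hi).2.1
  have hcl := isClubIn_closed hc hc'
    (F := fun y => (fun p : Iio c.ord × Ordinal.{u} => φ p.1 p.2) '' ({i : Iio c.ord | (i : Ordinal) ≤ y} ×ˢ Iic y))
    (by rintro y hy _ ⟨⟨i, η⟩, ⟨-, h⟩, rfl⟩; exact hφ _ _ (lt_of_le_of_lt h hy))
    (by
      intro y hy
      refine Cardinal.mk_image_le.trans_lt ?_
      rw [Cardinal.mk_setProd]
      refine Cardinal.mul_lt_of_lt (by simpa using hc.1) (lt_of_le_of_lt ?_ (mk_Iic_lt hc hy))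
        (mk_Iic_lt hc hy)
      exact Cardinal.mk_le_of_injective (f := fun s => (⟨s.1.1, s.2⟩ : Iic y))
        fun s t h => by simpa [Subtype.ext_iff] using h)
  have huniv : IsStatIn (Iio c.ord) c.ord := isClubIn_Iio.isStatIn hc hc'
  refine ⟨hB, fun ζ => {x | ∀ (i : Iio c.ord), ∀ η < c.ord, φ i η = ζ → x ∈ M i η}, fun ζ hζ => ?_,
    _, (hΔ.inter hc hc' (isClubIn_Ioo hc hγ)).inter hc hc' hcl, ?_⟩
  · by_cases h : ∃ (i : Iio c.ord), ∃ η < c.ord, φ i η = ζ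
    · obtain ⟨i, η, hη, rfl⟩ := h
      refine ((hMD i i.2).1 η hη).mono fun x hx i' η' hη' h => ?_
      obtain ⟨rfl, rfl⟩ := hφi _ _ _ _ hη' hη h
      exact hx.1
    · exact huniv.mono fun x _ i η hη h' => absurd ⟨i, η, hη, h'⟩ h
  · rintro α ⟨⟨hαΔ, hγα, -⟩, hαc, -, hαcl⟩ ⟨-, hReg, hω, hrefl⟩ hαB
    obtain ⟨i, hi, hαi⟩ := hBA α hαB hγα
    have hic := hi.trans hαc
    refine (hMD i hic).2.2 α ((hΔD α hαΔ).2 i hi) ⟨hαc, hReg, hω, fun η hη => ?_⟩ hαi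
    have h1 : φ ⟨i, hic⟩ η < α := hαcl (max i η) (max_lt hi hη) _
      ⟨(⟨i, hic⟩, η), ⟨show i ≤ max i η from le_max_left _ _, show η ≤ max i η from le_max_right _ _⟩, rfl⟩
    exact (hrefl _ h1).mono fun x ⟨hx, _⟩ => hx ⟨i, hic⟩ η (hη.trans hαc) rfl

/-- The hypothesis makes `reflectionIdeal c` proper. For closure under `Tr`, let `M` and `D` witness
that the complement of `A` is null. Then `reflecting c M ∩ D` is a stationary subset of `A`, and the
points that reflect the constant sequence with this value belong to `Tr c A`. -/
theorem isGreatlyMahlo_of_reflecting (hc : c.IsRegular) (hc' : ℵ₀ < c)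
    (h : ∀ M : Ordinal.{u} → Set Ordinal.{u}, (∀ η < c.ord, IsStatIn (M η) c.ord) →
      IsStatIn (reflecting c M) c.ord) : IsGreatlyMahlo c := by
  have hclub : IsClubIn (Iio c.ord) c.ord := isClubIn_Iio
  have huniv := hclub.isStatIn hc hc'
  have hsmall : ∀ A : Set Ordinal.{u}, A ⊆ Iio c.ord → ∀ γ < c.ord, (∀ x ∈ A, x ≤ γ) →
      A ∈ reflectionIdeal c := fun A hA γ hγ hAγ =>
    ⟨hA, fun _ => Iio c.ord, fun _ _ => huniv, _, isClubIn_Ioo hc hγ,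
      fun x hx _ hxA => absurd (hAγ x hxA) (not_le.2 hx.1)⟩
  have hdiag := @reflectionIdeal_diag c hc hc'
  refine ⟨hc, hc', reflectionIdeal c, ⟨fun A hA => hA.1, ?_, ?_, ?_, ?_⟩, ?_, ?_, ?_, ?_⟩
  · rintro A ⟨hA, M, hM, D, hD, hDA⟩ B hBA
    exact ⟨hBA.trans hA, M, hM, D, hD, fun x hx hr hB => hDA x hx hr (hBA hB)⟩
  · intro A hA B hB
    have h1 : (1 : Ordinal.{u}) < c.ord := by
      simpa using (Cardinal.isSuccLimit_ord hc.1).add_one_lt hc.ord_pos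
    refine hdiag (A := fun i => if i = 0 then A else B)
      (fun i _ => by split_ifs <;> assumption) (union_subset hA.1 hB.1) h1 fun β hβ hlt => ?_
    rcases hβ with hβ | hβ
    · exact ⟨0, zero_lt_one.trans hlt, by simpa⟩
    · exact ⟨1, hlt, by simpa⟩
  · exact fun A γ hγ hA => hsmall A (hA.trans (Iio_subset_Iio hγ.le)) γ hγ fun x hx => le_of_lt (hA hx)
  · rintro ⟨-, M, hM, D, hD, hDM⟩
    obtain ⟨x, hx, hxD⟩ := isStatIn_iff.1 (h M hM) D hD
    exact hDM x hxD hx hx.1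
  · intro X A hX hA
    have : Cardinal.lift.{u + 1} #X = Cardinal.lift.{u} #(Iio (#X).ord) := by
      rw [Cardinal.mk_Iio_ordinal, Cardinal.card_ord, Cardinal.lift_id'.{u, u + 1}]
    obtain ⟨e⟩ := Cardinal.lift_mk_eq'.1 this
    refine hdiag (A := fun i => {x | ∃ hi : i < (#X).ord, x ∈ A (e.symm ⟨i, hi⟩)})
      (fun i _ => ?_) (iUnion_subset fun i => (hA i).1) (γ := (#X).ord) (Cardinal.ord_lt_ord.2 hX)
      fun β hβ hlt => ?_
    · by_cases hi : i < (#X).ord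
      · simp only [hi, exists_true_left]; exact hA _
      · simp only [hi, IsEmpty.exists_iff]
        exact hsmall _ (by simp) 0 hc.ord_pos (by simp)
    · obtain ⟨j, hj⟩ := mem_iUnion.1 hβ
      refine ⟨e j, lt_trans (e j).2 hlt, (e j).2, ?_⟩
      convert hj using 2
      exact e.symm_apply_apply j
  · rintro B f ⟨hBc, hB⟩ hf
    by_contra hcon
    refine hB (hdiag (A := fun i => {β ∈ B | f β = i}) (fun i hi => ?_) hBc hc.ord_pos fun β hβ h0 =>
      ⟨f β, hf β hβ h0.ne', hβ, rfl⟩)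
    by_contra hpos
    exact hcon ⟨_, fun β hβ => hβ.1, ⟨fun β hβ => hBc hβ.1, hpos⟩, i, hi, fun β hβ => hβ.2.le⟩
  · exact ⟨sdiff_subset, fun _ => Iio c.ord, fun _ _ => huniv, _, hclub,
      fun x _ hr hx => hx.2 hr.2.1⟩
  · rintro A hA ⟨-, M, hM, D, hD, hDM⟩
    refine ⟨sdiff_subset, fun _ => reflecting c M ∩ D, fun _ _ => (h M hM).inter_club hc hc' hD, _,
      hclub, fun α hα hr hx => hx.2 ⟨hα, ?_, ?_⟩⟩
    · obtain ⟨-, ⟨d, hd, rfl⟩, hω, -⟩ := hr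
      rwa [hd.cof_ord, ← Cardinal.ord_lt_ord, Cardinal.ord_aleph0]
    · refine (hr.2.2.2 0 (pos_of_gt hr.2.2.1)).mono fun x hx => ?_
      by_contra hxA
      exact hDM x hx.1.2 hx.1.1 ⟨hx.1.1.1, hxA⟩

/-- Some sequence has a nonstationary set of reflecting points. Intersecting its members with a club
`D` avoiding that set leaves none: a regular `α` outside `D` reflects no subset of `D`. -/
theorem exists_nonreflecting (hc : c.IsRegular) (hc' : ℵ₀ < c) (h : ¬ IsGreatlyMahlo c) :
    ∃ M : Ordinal.{u} → Set Ordinal.{u}, (∀ η < c.ord, IsStatIn (M η) c.ord) ∧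
      ∀ α < c.ord, α ∈ Reg → Ordinal.omega0 < α → ∃ η < α, ¬ IsStatIn (M η) α := by
  by_contra hcon
  push Not at hcon
  refine h (isGreatlyMahlo_of_reflecting hc hc' fun M hM => ?_)
  by_contra hns
  obtain ⟨D, hD, hDM⟩ := not_isStatIn_iff.1 hns
  obtain ⟨α, hα, hReg, hω, hst⟩ := hcon (fun η => M η ∩ D) fun η hη => (hM η hη).inter_club hc hc' hD
  have hαD : α ∈ D := by
    by_contra hαD
    exact not_isStatIn_of_notMem hReg hα hD hαD
      ((hst 0 (pos_of_gt hω)).mono fun x hx => hx.1.2)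
  exact hDM α hαD ⟨hα, hReg, hω, fun η hη => (hst η hη).mono fun x hx => hx.1.1⟩

end GreatlyMahlo

/-- If every word `s` had null fibers from some `χ s` on, then, for `μ₁` closed under `χ`, almost
every `β` would avoid all of a given interval starting at `μ₁` under words with parameters below
`μ₁`. Together with `exists_op` this puts some member `μ₁` of a stationary `M η` into a club
disjoint from `M η`. -/
theorem exists_unbounded {lam : Cardinal.{u}} (hlam : lam.IsRegular) (hlam' : ℵ₀ < lam)
    (hM : ¬ IsGreatlyMahlo lam) :
    ∃ op : Fin 4 → Ordinal.{u} → Ordinal.{u} → Ordinal.{u}, ∀ I, IsIdealOver I lam.ord →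
      IsComplete I lam → ∃ s ∈ Words lam.ord, ∀ γ < lam.ord, ∃ γ' < lam.ord, γ ≤ γ' ∧
        {β | β < lam.ord ∧ act op s β = γ'} ∉ I := by
  obtain ⟨M, hMst, hMns⟩ := exists_nonreflecting hlam hlam' hM
  obtain ⟨op, C, η, hop3, hop⟩ := exists_op hMns
  have hlim := Cardinal.isSuccLimit_ord hlam.1
  refine ⟨op, fun I hI hIc => ?_⟩
  by_contra hcon
  have key : ∀ s : List (Fin 4 × Ordinal.{u}), ∃ χ, s ∈ Words lam.ord → χ < lam.ord ∧
      ∀ γ < lam.ord, χ ≤ γ → {β | β < lam.ord ∧ act op s β = γ} ∈ I := fun s => by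
    by_cases hs : s ∈ Words lam.ord
    · by_contra hno
      push Not at hno
      refine hcon ⟨s, hs, fun γ hγ => ?_⟩
      obtain ⟨-, h⟩ := hno γ
      obtain ⟨γ', h1, h2, h3⟩ := h hγ
      exact ⟨γ', h1, h2, h3⟩
    · exact ⟨0, fun h => absurd h hs⟩
  choose χ hχ using key
  have hcl := isClubIn_closed hlam hlam' (F := fun y => χ '' Words (y + 1))
    (by
      rintro y hy _ ⟨s, hs, rfl⟩
      exact (hχ s (Words.mono (hlim.add_one_lt hy).le hs)).1)
    (fun y hy => Cardinal.mk_image_le.trans_lt (mk_Words_lt hlam' (hlim.add_one_lt hy)))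
  have hω : Ordinal.omega0 < lam.ord := by rwa [← Cardinal.ord_aleph0, Cardinal.ord_lt_ord]
  have hE := hcl.inter hlam hlam' (isClubIn_Ioo hlam hω)
  set D : Set Ordinal.{u} := _ ∩ Ioo Ordinal.omega0 lam.ord with hDdef
  -- almost no `β` is moved into `[μ₁, μ]` by a word with parameters below `μ₁ ∈ D`
  have hnull : ∀ μ₁ ∈ D, ∀ μ < lam.ord,
      {β | β < lam.ord ∧ ∃ s ∈ Words μ₁, μ₁ ≤ act op s β ∧ act op s β ≤ μ} ∈ I := by
    rintro μ₁ ⟨⟨h1, h2, h3⟩, -⟩ μ hμ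
    refine hI.mono _ (hIc.biUnion (s := Words μ₁ ×ˢ Icc μ₁ μ)
      (A := fun p => {β | β < lam.ord ∧ act op p.1 β = p.2}) ?_ ?_) _ ?_
    · rw [Cardinal.mk_setProd]
      exact Cardinal.mul_lt_of_lt (by simpa using hlam.1) (mk_Words_lt hlam' h1)
        ((Cardinal.mk_le_mk_of_subset Icc_subset_Iic_self).trans_lt (mk_Iic_lt hlam hμ))
    · rintro ⟨s, γ⟩ ⟨hs, hγ, hγ'⟩
      obtain ⟨y, hy, hsy⟩ := exists_mem_Words_add_one h2 hs
      refine (hχ s (Words.mono h1.le hs)).2 γ (lt_of_le_of_lt hγ' hμ) (le_trans ?_ hγ)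
      exact (h3 y hy _ ⟨s, hsy, rfl⟩).le
    · rintro β ⟨hβ, s, hs, h4, h5⟩
      simp only [mem_iUnion]
      exact ⟨(s, act op s β), ⟨hs, h4, h5⟩, hβ, rfl⟩
  have hpos : ∀ μ : Ordinal.{u}, ∃ p : List (Fin 4 × Ordinal.{u}) × Ordinal.{u}, μ ∈ D →
      p.1 ∈ Words μ ∧ p.2 < μ ∧ {β | β < lam.ord ∧ μ < act op p.1 β ∧ act op p.1 β < lam.ord ∧
        IsClubIn (C (act op p.1 β)) (act op p.1 β) ∧
        (∀ x ∈ C (act op p.1 β), x ∉ M p.2) ∧ 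
        ∀ ν < μ, op 3 ν (act op p.1 β) < μ} ∉ I := fun μ => by
    by_cases hμD : μ ∈ D
    · have hμlam : μ < lam.ord := hE.1 hμD
      -- Up to a null set, no `β ≥ μ` is moved to `μ` itself, so the second alternative of `hop`
      -- holds; completeness then fixes the word and the index `η`.
      have hB := hI.diff (hI.Ico_notMem hμlam) (hnull μ hμD μ hμlam)
      have hs : ∀ β, ∃ s, β ∈ Ico μ lam.ord \ {β | β < lam.ord ∧ ∃ s ∈ Words μ, μ ≤ act op s β ∧ act op s β ≤ μ} →
          s ∈ Words μ ∧ μ < act op s β ∧ act op s β < lam.ord ∧ η (act op s β) < μ ∧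
          IsClubIn (C (act op s β)) (act op s β) ∧
          (∀ x ∈ C (act op s β), x ∉ M (η (act op s β))) ∧ μ ∈ C (act op s β) ∧
          ∀ ν < μ, op 3 ν (act op s β) < μ := fun β => by
        by_cases hβ : β ∈ Ico μ lam.ord \ {β | β < lam.ord ∧ ∃ s ∈ Words μ, μ ≤ act op s β ∧ act op s β ≤ μ}
        · rcases hop μ hμD.1.2.1 hμD.2.1 β hβ.1.1 hβ.1.2 with ⟨s, hs, h⟩ | ⟨s, hs, h⟩
          · exact absurd ⟨hβ.1.2, s, hs, h.ge, h.le⟩ hβ.2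
          · exact ⟨s, fun _ => ⟨hs, h⟩⟩
        · exact ⟨[], fun h => absurd h hβ⟩
      choose s hs using hs
      obtain ⟨p, hp, hpI⟩ := hI.exists_pos hIc (f := fun β => (s β, η (act op (s β) β)))
        (s := Words μ ×ˢ Iio μ) hB
        (by
          rw [Cardinal.mk_setProd]
          exact Cardinal.mul_lt_of_lt (by simpa using hlam.1) (mk_Words_lt hlam' hμlam)
            (mk_Iio_lt hμlam))
        fun β hβ => ⟨(hs β hβ).1, (hs β hβ).2.2.2.1⟩
      refine ⟨p, fun _ => ⟨hp.1, hp.2, fun h => hpI (hI.mono _ h _ ?_)⟩⟩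
      rintro β ⟨hβ, rfl⟩
      obtain ⟨h1, h2, h3, h4, h5, h6, h7, h8⟩ := hs β hβ
      exact ⟨hβ.1.2, h2, h3, h5, h6, h8⟩
    · exact ⟨([], 0), fun h => absurd h hμD⟩
  choose p hp using hpos
  -- The letters take countably many values and the parameters lie below `μ`, so the same word and
  -- index serve stationarily many `μ`.
  obtain ⟨⟨t⟩, -, ht⟩ := (hE.isStatIn hlam hlam').exists_biUnion hlam hlam'
    (X := ULift.{u + 1} (List (Fin 4))) (s := univ) (f := fun μ => ⟨(p μ).1.map Prod.fst⟩)
    (by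
      have h1 : #(univ : Set (ULift.{u + 1} (List (Fin 4)))) ≤ ℵ₀ := Cardinal.mk_le_aleph0
      refine h1.trans_lt ?_
      simpa using hlam') (fun _ _ _ => mem_univ _)
  obtain ⟨l, hl⟩ := ht.fodor_list hlam hlam' (f := fun μ => (p μ).2 :: (p μ).1.map Prod.snd) (by
    rintro μ ⟨hμ, -⟩ - y hy
    obtain ⟨h1, h2, -⟩ := hp μ hμ
    rcases List.mem_cons.1 hy with rfl | hy
    · exact h2
    · obtain ⟨q, hq, rfl⟩ := List.mem_map.1 hy
      exact h1 q hq)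
  obtain ⟨μ₀, ⟨⟨hμ₀, hμ₀t⟩, hμ₀l⟩, -, hμ₀lam⟩ := hl.unbounded hlam hlam.ord_pos
  have hconst : ∀ μ, (ULift.up.{u + 1} ((p μ).1.map Prod.fst) = ⟨t⟩) →
      (p μ).2 :: (p μ).1.map Prod.snd = l → p μ = p μ₀ := fun μ h1 h2 => by
    simp only [← hμ₀t, ULift.up_inj] at h1
    simp only [← hμ₀l, List.cons.injEq] at h2
    refine Prod.ext ?_ h2.1
    rw [← List.zip_unzip (p μ).1, ← List.zip_unzip (p μ₀).1]
    simp only [List.unzip_eq_map, h1, h2.2]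
  obtain ⟨h1, h2, -⟩ := hp μ₀ hμ₀
  obtain ⟨μ₁, hμ₁M, hμ₁D, hμ₁, hμ₁lam⟩ := isStatIn_iff.1 (hMst _ (h2.trans hμ₀lam)) _
    (hE.inter hlam hlam' (isClubIn_Ioo hlam hμ₀lam))
  obtain ⟨μ, ⟨⟨hμ, hμt⟩, hμl⟩, hμ₁μ, hμlam⟩ := hl.unbounded hlam hμ₁lam
  obtain ⟨-, -, hpos⟩ := hp μ hμ
  rw [hconst μ hμt hμl] at hpos
  have hne := hI.diff hpos (hnull μ₁ hμ₁D μ hμlam)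
  obtain ⟨β, ⟨hβ, h3, h4, h5, h6, h7⟩, h8⟩ := hI.nonempty_of_notMem hlam.ord_pos hne
  refine h6 μ₁ ((isClubIn_iff.1 h5).2.1 μ₁ (hμ₁μ.trans h3) ⟨(pos_of_gt hμ₁).ne', fun x hx => ?_⟩) hμ₁M
  have hx' : x + 1 < μ₁ := hμ₁D.1.2.1.add_one_lt hx
  have h9 := h7 (x + 1) (hx'.trans hμ₁μ)
  -- Otherwise the word prolonged by letter 3 would land between `μ₁` and `μ`, which `h8` excludes.
  have h10 : op 3 (x + 1) (act op (p μ₀).1 β) < μ₁ := by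
    by_contra hge
    exact h8 ⟨hβ, (3, x + 1) :: (p μ₀).1, cons_mem_Words (Words.mono hμ₁.le h1) hx' 3,
      not_lt.1 hge, h9.le⟩
  rw [hop3] at h10
  obtain ⟨z, hz, hz'⟩ := (isClubIn_iff.1 h5).2.2 (x + 1) (hx'.trans (hμ₁μ.trans h3))
  have hmem : sInf (C (act op (p μ₀).1 β) \ Iio (x + 1)) ∈ C (act op (p μ₀).1 β) \ Iio (x + 1) :=
    csInf_mem ⟨z, hz, not_lt.2 hz'⟩
  exact ⟨_, hmem.1, (lt_add_one x).trans_le (not_lt.1 hmem.2), h10⟩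


/-! ### Club guessing, and colorings when `Order.succ θ < lam` -/

section Guessing

variable {c : Cardinal.{u}}

/-- The nonzero projections of the elements of `A` to a club `D`. -/
def projSet (A D : Set Ordinal.{u}) : Set Ordinal.{u} :=
  {v | 0 < v ∧ ∃ x ∈ A, v = sSup (D ∩ Iio x)}

theorem bddAbove_inter_Iio (D : Set Ordinal.{u}) (x : Ordinal.{u}) : BddAbove (D ∩ Iio x) :=
  ⟨x, fun _ h => le_of_lt h.2⟩

theorem sSup_inter_Iio_le (D : Set Ordinal.{u}) (x : Ordinal.{u}) : sSup (D ∩ Iio x) ≤ x := by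
  rcases (D ∩ Iio x).eq_empty_or_nonempty with h | h
  · rw [h, csSup_empty]; exact bot_le
  · exact csSup_le h fun _ hy => le_of_lt hy.2

theorem sSup_inter_Iio_mem {D : Set Ordinal.{u}} {o : Ordinal.{u}} (hD : IsClubIn D o)
    {x : Ordinal.{u}} (hx : x < o) (h0 : 0 < sSup (D ∩ Iio x)) : sSup (D ∩ Iio x) ∈ D := by
  by_contra hmem
  refine hmem ((isClubIn_iff.1 hD).2.1 _ ((sSup_inter_Iio_le D x).trans_lt hx) ⟨h0.ne', fun y hy => ?_⟩)
  obtain ⟨z, hz, hyz⟩ := exists_lt_of_lt_csSup' hy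
  exact ⟨z, hz.1, hyz, lt_of_le_of_ne (le_csSup (bddAbove_inter_Iio D x) hz) fun h => hmem (h ▸ hz.1)⟩

/-- Club guessing, for cofinalities whose successor is below `c`. -/
theorem exists_guessing (hc : c.IsRegular) {θ : Cardinal.{u}} (hθ : θ.IsRegular)
    (hθc : Order.succ θ < c) :
    ∃ A : Ordinal.{u} → Set Ordinal.{u}, ∀ D, IsClubIn D c.ord →
      ∃ δ < c.ord, δ.cof = θ ∧ A δ ⊆ D ∩ Iio δ ∧ ∀ x < δ, ∃ y ∈ A δ, x ≤ y := by
  have hc' : ℵ₀ < c := hθ.1.trans_lt ((Order.lt_succ θ).trans hθc)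
  have hθs := Cardinal.isRegular_succ hθ.1
  have hθs' : (Order.succ θ).ord < c.ord := Cardinal.ord_lt_ord.2 hθc
  choose f hf hf' using exists_cofinal_seq.{u}
  let A₀ : Ordinal.{u} → Set Ordinal.{u} := fun δ => f δ '' Iio δ.cof.ord
  by_contra hcon
  push Not at hcon
  choose bad hbad hbad' using fun D : Set Ordinal.{u} => hcon fun δ => projSet (A₀ δ) D
  -- Each club is refined by one on which its projections fail to guess. The recursion is used up to
  -- θ⁺, where the intersection is still a club.
  let D : Ordinal.{u} → Set Ordinal.{u} := WellFoundedLT.fix fun (α : Ordinal.{u}) ih =>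
    Iio c.ord ∩ ⋂ β : Iio α, bad (ih β β.2)
  have hD : ∀ α, D α = Iio c.ord ∩ ⋂ β ∈ Iio α, bad (D β) := fun α => by
    rw [biInter_eq_iInter]
    exact WellFoundedLT.fix_eq _ _
  have hDclub : ∀ α < c.ord, IsClubIn (D α) c.ord := fun α hα => by
    rw [hD]
    exact IsClubIn.biInter hc hc' (mk_Iio_lt hα) fun β _ => hbad _
  have hDbad : ∀ α β, β < α → D α ⊆ bad (D β) := fun α β h x hx => by
    rw [hD] at hx
    exact mem_iInter₂.1 hx.2 β h
  have hDanti : ∀ α β, β ≤ α → D α ⊆ D β := fun α β h x hx => by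
    rw [hD] at hx ⊢
    exact ⟨hx.1, mem_iInter₂.2 fun γ hγ => mem_iInter₂.1 hx.2 γ (lt_of_lt_of_le hγ h)⟩
  have hlast := hDclub _ hθs'
  obtain ⟨δ, hδθ, hδc, hδacc⟩ := isStatIn_iff.1 (isStatIn_cof hc hθ ((Order.lt_succ θ).trans hθc)) _
    (isClubIn_acc hc hc' (A := D (Order.succ θ).ord) fun x hx => by
      obtain ⟨y, hy, h⟩ := (isClubIn_iff.1 hlast).2.2 _ ((Cardinal.isSuccLimit_ord hc.1).add_one_lt hx)
      exact ⟨y, hy, (lt_add_one x).trans_le h, hlast.1 hy⟩)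
  have hA₀δ : ∀ x ∈ A₀ δ, x < δ := by rintro _ ⟨j, hj, rfl⟩; exact hf δ j hj
  -- As the clubs decrease, the projections of `x` to them decrease, hence stabilize before θ⁺. The
  -- set `A₀ δ` has at most θ elements, so one `α` serves them all.
  have hstab : ∀ x, ∃ α < (Order.succ θ).ord, ∀ β, α ≤ β → β < (Order.succ θ).ord →
      sSup (D β ∩ Iio x) = sSup (D α ∩ Iio x) := fun x => by
    have hne : ((fun α => sSup (D α ∩ Iio x)) '' Iio (Order.succ θ).ord).Nonempty :=
      ⟨_, 0, hθs.ord_pos, rfl⟩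
    obtain ⟨α, hα, hαx⟩ := csInf_mem hne
    refine ⟨α, hα, fun β hαβ hβ => le_antisymm ?_ ?_⟩
    · exact csSup_le_csSup' (bddAbove_inter_Iio _ _) (inter_subset_inter_left _ (hDanti _ _ hαβ))
    · exact hαx.trans_le (csInf_le' ⟨β, hβ, rfl⟩)
  choose st hst hst' using hstab
  obtain ⟨α, hα, hαst⟩ := exists_bound hθs (s := st '' A₀ δ)
    (by rintro _ ⟨x, -, rfl⟩; exact hst x)
    (by
      refine Cardinal.mk_image_le.trans_lt (Cardinal.mk_image_le.trans_lt ?_)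
      rw [Cardinal.mk_Iio_ordinal, Cardinal.card_ord, Cardinal.lift_lt, show δ.cof = θ from hδθ]
      exact Order.lt_succ θ)
  have hα1 : α + 1 < (Order.succ θ).ord := (Cardinal.isSuccLimit_ord hθs.1).add_one_lt hα
  -- The projections of `A₀ δ` to `D α` and `D (α + 1)` coincide, so they lie in `bad (D α)`. The
  -- failure to guess must then be one of cofinality, which is impossible as `δ` is a limit of the
  -- last club.
  obtain ⟨x, hx, hx'⟩ := hbad' (D α) δ hδc hδθ (by
    rintro v ⟨hv, x, hx, rfl⟩
    have heq : sSup (D α ∩ Iio x) = sSup (D (α + 1) ∩ Iio x) := by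
      have h1 := (hαst _ ⟨x, hx, rfl⟩).le
      rw [hst' x α h1 hα, hst' x (α + 1) (h1.trans (lt_add_one α).le) hα1]
    rw [heq] at hv ⊢
    have hmem := sSup_inter_Iio_mem (hDclub _ (hα1.trans hθs')) ((hA₀δ x hx).trans hδc) hv
    exact ⟨hDbad _ _ (lt_add_one α) hmem, (sSup_inter_Iio_le _ _).trans_lt (hA₀δ x hx)⟩)
  obtain ⟨y, hy, hxy, hyδ⟩ := hδacc.2 x hx
  obtain ⟨j, hj, hyj⟩ := hf' δ (y + 1) ((show Order.IsSuccLimit δ from by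
    rw [← Ordinal.one_lt_cof_iff, show δ.cof = θ from hδθ]
    exact Cardinal.one_lt_aleph0.trans_le hθ.1).add_one_lt hyδ)
  have h1 : y ≤ sSup (D α ∩ Iio (f δ j)) := le_csSup (bddAbove_inter_Iio _ _)
    ⟨hDanti _ _ hα.le hy, (lt_add_one y).trans_le hyj⟩
  have h2 : x < sSup (D α ∩ Iio (f δ j)) := hxy.trans_le h1
  exact absurd (hx' _ ⟨pos_of_gt h2, f δ j, ⟨j, hj, rfl⟩, rfl⟩) (not_lt.2 h2.le)

/-- There are `c` many maps `c → θ`, one of which maps any given unbounded subset onto `θ`. -/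
theorem exists_onto (hc : c.IsRegular) {θ : Cardinal.{u}} (hθ : θ.IsRegular)
    (hθc : Order.succ θ < c) :
    ∃ g : Ordinal.{u} → Ordinal.{u} → Ordinal.{u}, (∀ δ γ, g δ γ < θ.ord) ∧
      ∀ U : Set Ordinal.{u}, (∀ x < c.ord, ∃ y ∈ U, x < y ∧ y < c.ord) →
        ∃ δ < c.ord, ∀ τ < θ.ord, ∃ γ ∈ U, γ < c.ord ∧ g δ γ = τ := by
  obtain ⟨A, hA⟩ := exists_guessing hc hθ hθc
  have hc' : ℵ₀ < c := hθ.1.trans_lt ((Order.lt_succ θ).trans hθc)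
  -- The color is `j` if `γ` lies past the `j`-th element of `A δ` but not past the next one, and 0
  -- if there is no such `j`.
  let g : Ordinal.{u} → Ordinal.{u} → Ordinal.{u} := fun δ γ =>
    sInf {j | j < θ.ord ∧ otp (A δ ∩ Iio γ) = j + 1}
  refine ⟨g, fun δ γ => ?_, fun U hU => ?_⟩
  · rcases eq_empty_or_nonempty {j | j < θ.ord ∧ otp (A δ ∩ Iio γ) = j + 1} with h | h
    · show sInf _ < _
      rw [h, Ordinal.sInf_empty]; exact hθ.ord_pos
    · exact (csInf_mem h).1
  · obtain ⟨δ, hδ, hδθ, hAδ, hAu⟩ := hA _ (isClubIn_acc hc hc' hU)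
    have hAs : A δ ⊆ Iio δ := fun x hx => (hAδ hx).2
    have hotp := ord_cof_le_otp hAs hAu
    rw [hδθ] at hotp
    refine ⟨δ, hδ, fun τ hτ => ?_⟩
    have hτ1 : τ + 1 < θ.ord := (Cardinal.isSuccLimit_ord hθ.1).add_one_lt hτ
    obtain ⟨y, hy, hyτ⟩ := exists_otp_eq hAs (hτ.trans_le hotp)
    obtain ⟨z, hz, hzτ⟩ := exists_otp_eq hAs (hτ1.trans_le hotp)
    have hyz : y < z := by
      by_contra h
      have := otp_mono (o := δ) (inter_subset_inter_right (A δ) (Iio_subset_Iio (not_lt.1 h)))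
        (inter_subset_left.trans hAs)
      rw [hyτ, hzτ] at this
      exact absurd (lt_add_one τ) (not_lt.2 this)
    -- The guessed club is that of limits of `U`, so `U` has an element between consecutive elements
    -- of `A δ`.
    obtain ⟨γ, hγ, hyγ, hγz⟩ := (hAδ hz).1.2.2 y hyz
    have h1 : otp (A δ ∩ Iio γ) = τ + 1 := by
      refine le_antisymm ?_ ?_
      · rw [← hzτ]
        exact otp_mono (o := δ) (inter_subset_inter_right _ (Iio_subset_Iio hγz.le))
          (inter_subset_left.trans hAs)
      · rw [← hyτ]
        exact Order.add_one_le_of_lt (otp_inter_lt_otp_inter hAs hy hyγ)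
    refine ⟨γ, hγ, hγz.trans ((hAs hz).trans hδ), ?_⟩
    have h2 : {j | j < θ.ord ∧ otp (A δ ∩ Iio γ) = j + 1} = {τ} := by
      ext j
      rw [h1]
      constructor
      · rintro ⟨-, h⟩
        exact (Order.add_one_inj.1 h).symm
      · rintro rfl
        exact ⟨hτ, rfl⟩
    show sInf _ = _
    rw [h2, csInf_singleton]

end Guessing

theorem hasColorings_of_succ_lt {lam θ : Cardinal.{u}} (hlam : lam.IsRegular) (hθ : θ.IsRegular)
    (hθlam : Order.succ θ < lam) (hM : ¬ IsGreatlyMahlo lam) (N : Prop) : HasColorings lam θ N := by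
  have hlam' : ℵ₀ < lam := hθ.1.trans_lt ((Order.lt_succ θ).trans hθlam)
  obtain ⟨op, hop⟩ := exists_unbounded hlam hlam' hM
  obtain ⟨g, hg, hgU⟩ := exists_onto hlam hθ hθlam
  refine ⟨Words lam.ord × Iio lam.ord, fun p β => g p.2 (act op p.1 β), ?_, fun p β _ => hg _ _,
    fun I hI hIc _ => ?_⟩
  · rw [Cardinal.mk_prod, Cardinal.lift_id, Cardinal.lift_id]
    exact Cardinal.mul_le_of_le (by simpa using hlam.1) (mk_Words_le hlam.1 (by simp)) (by
      rw [Cardinal.mk_Iio_ordinal, Cardinal.card_ord])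
  · obtain ⟨s, hs, hsU⟩ := hop I hI hIc
    obtain ⟨δ, hδ, hδτ⟩ := hgU {γ | {β | β < lam.ord ∧ act op s β = γ} ∉ I} fun x hx => by
      obtain ⟨γ, h1, h2, h3⟩ := hsU (x + 1) ((Cardinal.isSuccLimit_ord hlam.1).add_one_lt hx)
      exact ⟨γ, h3, (lt_add_one x).trans_le h2, h1⟩
    refine ⟨(⟨s, hs⟩, ⟨δ, hδ⟩), fun τ hτ h => ?_⟩
    obtain ⟨γ, hγ, -, hγτ⟩ := hδτ τ hτ
    exact hγ (hI.mono _ h _ fun β hβ => ⟨hβ.1, by simpa [hβ.2] using hγτ⟩)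


/-! ### Walks on ordinals and their weights -/

/-- Below `o`, the sequence `C` chooses cofinal subsets of order type at most `θ`. -/
def IsLadder (C : Ordinal.{u} → Set Ordinal.{u}) (θ : Cardinal.{u}) (o : Ordinal.{u}) : Prop :=
  ∀ α < o, C α ⊆ Iio α ∧ (∀ x < α, ∃ y ∈ C α, x ≤ y) ∧ otp (C α) ≤ θ.ord

theorem exists_isLadder (θ : Cardinal.{u}) : ∃ C, IsLadder C θ (Order.succ θ).ord := by
  have key : ∀ α : Ordinal.{u}, ∃ C, α < (Order.succ θ).ord →
      C ⊆ Iio α ∧ (∀ x < α, ∃ y ∈ C, x ≤ y) ∧ otp C ≤ θ.ord := fun α => by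
    obtain ⟨s, hs, hst⟩ := Ordinal.exists_ord_cof_eq (Iio α)
    have hsub : Subtype.val '' s ⊆ Iio α := by rintro _ ⟨x, -, rfl⟩; exact x.2
    refine ⟨Subtype.val '' s, fun hα => ⟨hsub, fun x hx => ?_, ?_⟩⟩
    · obtain ⟨y, hy, hxy⟩ := hs ⟨x, hx⟩
      exact ⟨y, ⟨y, hy, rfl⟩, hxy⟩
    · rw [← Ordinal.lift_le.{u + 1}, lift_otp _ α hsub]
      have h1 : Ordinal.type (fun x y : Subtype.val '' s => x < y) = Ordinal.type (fun x y : s => x < y) := by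
        refine (Ordinal.type_eq.2 ⟨⟨Equiv.Set.image Subtype.val s Subtype.val_injective, ?_⟩⟩).symm
        intro a b
        rfl
      rw [h1]
      refine (le_of_eq hst).trans ?_
      rw [Ordinal.cof_Iio, ← Ordinal.lift_cof, ← Cardinal.lift_ord, Ordinal.lift_le, Cardinal.ord_le_ord]
      exact (Ordinal.cof_le_card α).trans (Order.lt_succ_iff.1 (Cardinal.lt_ord.1 hα))
  choose C hC using key
  exact ⟨C, hC⟩

section Walks

variable (C : Ordinal.{u} → Set Ordinal.{u})

/-- The first step of the walk from `β` down to `i`. -/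
noncomputable def step (β i : Ordinal.{u}) : Ordinal.{u} :=
  sInf (C β \ Iio i)

/-- The maximal weight of the walk from `β` down to `ξ`. -/
noncomputable def weight (ξ β : Ordinal.{u}) : Ordinal.{u} :=
  open scoped Classical in
  if _h : ξ < β ∧ step C β ξ < β then
    max (otp (C β ∩ Iio ξ)) (weight ξ (step C β ξ))
  else 0
termination_by β
decreasing_by exact _h.2

/-- The trace of the walk from `β` down to `i`: the running maxima, starting from `η`, of
the suprema of the ladders below `i`. -/
noncomputable def trace (i β η : Ordinal.{u}) : List Ordinal.{u} :=
  open scoped Classical in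
  if _h : i < β ∧ step C β i < β then
    max η (sSup (C β ∩ Iio i)) :: trace i (step C β i) (max η (sSup (C β ∩ Iio i)))
  else []
termination_by β
decreasing_by exact _h.2

/-- The vertices of the walk from `β` down to `i`. -/
noncomputable def vertex : ℕ → Ordinal.{u} → Ordinal.{u} → Ordinal.{u}
  | 0, β, _ => β
  | k + 1, β, i => vertex k (step C β i) i

variable {C} {θ : Cardinal.{u}} {o : Ordinal.{u}}

theorem trace_self (i η : Ordinal.{u}) : trace C i i η = [] := by
  rw [trace, dif_neg fun h => lt_irrefl _ h.1]

section

variable (hC : IsLadder C θ o)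

include hC

theorem IsLadder.step_mem {β i : Ordinal.{u}} (hβ : β < o) (hi : i < β) : step C β i ∈ C β \ Iio i := by
  obtain ⟨y, hy, hiy⟩ := (hC β hβ).2.1 i hi
  exact csInf_mem ⟨y, hy, not_lt.2 hiy⟩

theorem IsLadder.step_lt {β i : Ordinal.{u}} (hβ : β < o) (hi : i < β) : step C β i < β :=
  (hC β hβ).1 (hC.step_mem hβ hi).1

theorem IsLadder.le_step {β i : Ordinal.{u}} (hβ : β < o) (hi : i < β) : i ≤ step C β i :=
  not_lt.1 (hC.step_mem hβ hi).2

theorem IsLadder.inter_step {β i : Ordinal.{u}} (hβ : β < o) (hi : i < β) :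
    C β ∩ Iio (step C β i) = C β ∩ Iio i := by
  ext y
  refine and_congr_right fun hy => ⟨fun h => ?_, fun h => lt_of_lt_of_le h (hC.le_step hβ hi)⟩
  by_contra hiy
  exact absurd (csInf_le' (s := C β \ Iio i) ⟨hy, hiy⟩) (not_le.2 h)

theorem IsLadder.weight_eq {ξ β : Ordinal.{u}} (hβ : β < o) (hξ : ξ < β) :
    weight C ξ β = max (otp (C β ∩ Iio ξ)) (weight C ξ (step C β ξ)) := by
  rw [weight, dif_pos ⟨hξ, hC.step_lt hβ hξ⟩]

theorem IsLadder.trace_eq {i β : Ordinal.{u}} (hβ : β < o) (hi : i < β) (η : Ordinal.{u}) :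
    trace C i β η =
      max η (sSup (C β ∩ Iio i)) :: trace C i (step C β i) (max η (sSup (C β ∩ Iio i))) := by
  rw [trace, dif_pos ⟨hi, hC.step_lt hβ hi⟩]

theorem IsLadder.otp_inter_lt {β i : Ordinal.{u}} (hβ : β < o) (hi : i < β) :
    otp (C β ∩ Iio i) < θ.ord := by
  obtain ⟨h1, h2, h3⟩ := hC β hβ
  rw [← hC.inter_step hβ hi]
  exact (ClubGuess.otp_inter_lt h1 (hC.step_mem hβ hi).1).trans_le h3

theorem IsLadder.mk_inter_lt {β i : Ordinal.{u}} (hβ : β < o) (hi : i < β) :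
    #(C β ∩ Iio i : Set Ordinal.{u}) < Cardinal.lift.{u + 1} θ := by
  rw [← lift_card_otp (o := β) (inter_subset_left.trans (hC β hβ).1), Cardinal.lift_lt]
  exact Cardinal.lt_ord.1 (hC.otp_inter_lt hβ hi)

theorem IsLadder.weight_lt (hθ : 0 < θ.ord) {ξ β : Ordinal.{u}} (hβ : β < o) : weight C ξ β < θ.ord := by
  induction β using WellFoundedLT.induction with
  | ind β ih =>
    by_cases hξ : ξ < β
    · rw [hC.weight_eq hβ hξ]
      exact max_lt (hC.otp_inter_lt hβ hξ) (ih _ (hC.step_lt hβ hξ) ((hC.step_lt hβ hξ).trans hβ))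
    · rw [weight, dif_neg fun h => hξ h.1]
      exact hθ

/-- A weight at most `ν` forces the first step to one of fewer than `θ` initial points of the ladder
of `β`, and the induction hypothesis applies at each of them. -/
theorem IsLadder.mk_weight_le_lt (hθ : θ.IsRegular) {β ν : Ordinal.{u}} (hβ : β < o) (hν : ν < θ.ord) :
    #{ξ | ξ < β ∧ weight C ξ β ≤ ν} < Cardinal.lift.{u + 1} θ := by
  induction β using WellFoundedLT.induction with
  | ind β ih =>
    obtain ⟨h1, -, -⟩ := hC β hβ
    have hsub : {ξ | ξ < β ∧ weight C ξ β ≤ ν} ⊆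
        ⋃ y ∈ {y | y ∈ C β ∧ otp (C β ∩ Iio y) ≤ ν}, insert y {ξ | ξ < y ∧ weight C ξ y ≤ ν} := by
      rintro ξ ⟨hξ, hw⟩
      rw [hC.weight_eq hβ hξ, max_le_iff] at hw
      refine mem_biUnion (x := step C β ξ) ⟨(hC.step_mem hβ hξ).1, ?_⟩ ?_
      · rw [hC.inter_step hβ hξ]; exact hw.1
      · rcases (hC.le_step hβ hξ).eq_or_lt with h | h
        · exact Or.inl h
        · exact Or.inr ⟨h, hw.2⟩
    refine (Cardinal.mk_le_mk_of_subset hsub).trans_lt (mk_biUnion_lt hθ ?_ fun y hy => ?_)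
    · refine lt_of_le_of_lt ?_ (mk_Iic_lt hθ hν)
      refine Cardinal.mk_le_of_injective (f := fun y => (⟨otp (C β ∩ Iio y.1), y.2.2⟩ : Iic ν)) ?_
      rintro ⟨x, hx⟩ ⟨y, hy⟩ hxy
      replace hxy := congrArg Subtype.val hxy
      refine Subtype.ext ?_
      show x = y
      by_contra hne
      rcases lt_or_gt_of_ne hne with h | h
      · exact absurd hxy (otp_inter_lt_otp_inter h1 hx.1 h).ne
      · exact absurd hxy (otp_inter_lt_otp_inter h1 hy.1 h).ne'
    · refine (Cardinal.mk_insert_le).trans_lt (Cardinal.add_lt_of_lt (by simpa using hθ.1)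
        (ih y (h1 hy.1) ((h1 hy.1).trans hβ)) ?_)
      exact Cardinal.one_lt_aleph0.trans_le (by simpa using hθ.1)

/-- Coherence, by induction on `β`. A disagreement of `α` and `β` at `ξ` has one of three causes: a
weight at most `otp (C β ∩ Iio α)`, a disagreement of `α` with the first step from `β` to `α`, or
the case that the step from `β` to `ξ` is some `y < α` in `C β`, and `ξ` is `y` or a disagreement of
`y` and `α`. Each occurs fewer than `θ` times. -/
theorem IsLadder.mk_weight_ne_lt (hθ : θ.IsRegular) {α β : Ordinal.{u}} (hβ : β < o) (hαβ : α ≤ β) :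
    #{ξ | ξ < α ∧ weight C ξ α ≠ weight C ξ β} < Cardinal.lift.{u + 1} θ := by
  have hθ' : ℵ₀ ≤ Cardinal.lift.{u + 1} θ := by simpa using hθ.1
  induction β using WellFoundedLT.induction generalizing α with
  | ind β ih =>
    rcases hαβ.eq_or_lt with rfl | hlt
    · simpa using hθ.pos
    · have hαo := hlt.trans hβ
      have hsub : {ξ | ξ < α ∧ weight C ξ α ≠ weight C ξ β} ⊆
          ({ξ | ξ < α ∧ weight C ξ α ≤ otp (C β ∩ Iio α)} ∪
            {ξ | ξ < α ∧ weight C ξ α ≠ weight C ξ (step C β α)}) ∪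
          ⋃ y ∈ C β ∩ Iio α, insert y {ξ | ξ < y ∧ weight C ξ y ≠ weight C ξ α} := by
        rintro ξ ⟨hξ, hne⟩
        by_contra hcon
        simp only [mem_union, not_or, mem_iUnion, not_exists] at hcon
        obtain ⟨⟨h1, h2⟩, h3⟩ := hcon
        have hξβ := hξ.trans hlt
        have h4 : otp (C β ∩ Iio ξ) < weight C ξ α := by
          refine lt_of_le_of_lt ?_ (not_le.1 fun h => h1 ⟨hξ, h⟩)
          exact otp_mono (o := β) (inter_subset_inter_right _ (Iio_subset_Iio hξ.le))
            (inter_subset_left.trans (hC β hβ).1)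
        have h5 : weight C ξ (step C β ξ) = weight C ξ α := by
          by_cases hy : step C β ξ < α
          · have h6 := h3 _ ⟨(hC.step_mem hβ hξβ).1, hy⟩
            by_contra hne'
            refine h6 ?_
            rcases (hC.le_step hβ hξβ).eq_or_lt with h | h
            · exact Or.inl h
            · exact Or.inr ⟨h, hne'⟩
          · have h6 : step C β ξ = step C β α := by
              refine le_antisymm (csInf_le' ⟨(hC.step_mem hβ hlt).1, ?_⟩)
                (csInf_le' ⟨(hC.step_mem hβ hξβ).1, hy⟩)
              exact not_lt.2 (hξ.le.trans (hC.le_step hβ hlt))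
            rw [h6]
            by_contra hne'
            exact h2 ⟨hξ, Ne.symm hne'⟩
        refine hne ?_
        rw [hC.weight_eq hβ hξβ, h5, max_eq_right h4.le]
      refine (Cardinal.mk_le_mk_of_subset hsub).trans_lt ((Cardinal.mk_union_le _ _).trans_lt
        (Cardinal.add_lt_of_lt hθ' ((Cardinal.mk_union_le _ _).trans_lt
          (Cardinal.add_lt_of_lt hθ' ?_ ?_)) ?_))
      · exact hC.mk_weight_le_lt hθ hαo (hC.otp_inter_lt hβ hlt)
      · exact ih _ (hC.step_lt hβ hlt) ((hC.step_lt hβ hlt).trans hβ) (hC.le_step hβ hlt)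
      · refine mk_biUnion_lt hθ (hC.mk_inter_lt hβ hlt) fun y hy => ?_
        exact (Cardinal.mk_insert_le).trans_lt (Cardinal.add_lt_of_lt hθ'
          (ih α hlt hαo (le_of_lt hy.2)) (Cardinal.one_lt_aleph0.trans_le hθ'))

/-- Fewer than `θ` disagreements cannot be cofinal in an ordinal of cofinality `θ`. -/
theorem IsLadder.exists_weight_eq (hθ : θ.IsRegular) {δ β : Ordinal.{u}} (hδ : δ.cof = θ) (hβ : β < o)
    (hδβ : δ ≤ β) : ∃ γ < δ, ∀ ξ, γ ≤ ξ → ξ < δ → weight C ξ β = weight C ξ δ := by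
  have hmk := hC.mk_weight_ne_lt hθ hβ hδβ
  by_contra hcon
  push Not at hcon
  have := lift_cof_le_mk (δ := δ) (C := {ξ | ξ < δ ∧ weight C ξ δ ≠ weight C ξ β}) (fun ξ h => h.1)
    fun x hx => by
      obtain ⟨ξ, h1, h2, h3⟩ := hcon x hx
      exact ⟨ξ, ⟨h2, h3.symm⟩, h1⟩
  rw [hδ] at this
  exact absurd hmk (not_lt.2 this)

theorem IsLadder.sSup_inter_lt {δ β : Ordinal.{u}} (hδ : δ.cof = θ) (hβ : β < o)
    (hδβ : δ < β) : sSup (C β ∩ Iio δ) < δ := by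
  refine lt_of_le_of_ne (sSup_inter_Iio_le _ _) fun heq => ?_
  have := lift_cof_le_mk (δ := δ) (C := C β ∩ Iio δ) inter_subset_right fun x hx => by
    rw [← heq] at hx
    obtain ⟨y, hy, hxy⟩ := exists_lt_of_lt_csSup' hx
    exact ⟨y, hy, hxy.le⟩
  rw [hδ] at this
  exact absurd (hC.mk_inter_lt hβ hδβ) (not_lt.2 this)

theorem IsLadder.trace_le {i β : Ordinal.{u}} (hβ : β < o) (hi : i ≤ β) {η : Ordinal.{u}} (hη : η ≤ i) :
    ∀ ξ ∈ trace C i β η, ξ ≤ i := by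
  induction β using WellFoundedLT.induction generalizing η with
  | ind β ih =>
    rcases hi.eq_or_lt with rfl | hi
    · simp [trace_self]
    · rw [hC.trace_eq hβ hi]
      have h := max_le hη (sSup_inter_Iio_le (C β) i)
      intro ξ hξ
      rcases List.mem_cons.1 hξ with rfl | hξ
      · exact h
      · exact ih _ (hC.step_lt hβ hi) ((hC.step_lt hβ hi).trans hβ) (hC.le_step hβ hi) h ξ hξ

theorem IsLadder.lt_of_mem_trace {δ β η : Ordinal.{u}} (hδ : δ.cof = θ) (hβ : β < o)
    (hη : η < δ) (hδβ : δ ≤ β) : ∀ ξ ∈ trace C δ β η, ξ < δ := by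
  induction β using WellFoundedLT.induction generalizing η with
  | ind β ih =>
    intro ξ hξ
    rcases hδβ.eq_or_lt with rfl | hlt
    · rw [trace_self] at hξ; simp at hξ
    · rw [hC.trace_eq hβ hlt] at hξ
      have hm := max_lt hη (hC.sSup_inter_lt hδ hβ hlt)
      rcases List.mem_cons.1 hξ with rfl | hξ
      · exact hm
      · exact ih _ (hC.step_lt hβ hlt) ((hC.step_lt hβ hlt).trans hβ) hm (hC.le_step hβ hlt) ξ hξ

theorem IsLadder.le_of_mem_trace {i β η : Ordinal.{u}} (hβ : β < o) (hi : i ≤ β) :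
    ∀ ξ ∈ trace C i β η, η ≤ ξ := by
  induction β using WellFoundedLT.induction generalizing η with
  | ind β ih =>
    intro ξ hξ
    rcases hi.eq_or_lt with rfl | hlt
    · rw [trace_self] at hξ; simp at hξ
    · rw [hC.trace_eq hβ hlt] at hξ
      rcases List.mem_cons.1 hξ with rfl | hξ
      · exact le_max_left _ _
      · exact (le_max_left _ _).trans
          (ih _ (hC.step_lt hβ hlt) ((hC.step_lt hβ hlt).trans hβ) (hC.le_step hβ hlt) ξ hξ)

theorem IsLadder.trace_ne_nil {i β η : Ordinal.{u}} (hβ : β < o) (hi : i < β) : trace C i β η ≠ [] := by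
  rw [hC.trace_eq hβ hi]; simp

/-- A trace is not affected by starting values below an element of the first ladder. -/
theorem IsLadder.trace_congr {i β η x : Ordinal.{u}} (hβ : β < o) (hx : x ∈ C β) (hxi : x < i)
    (hi : i < β) (hη : η ≤ x) : trace C i β η = trace C i β 0 ∧ ∀ ξ ∈ trace C i β 0, x ≤ ξ := by
  have h1 : x ≤ sSup (C β ∩ Iio i) := le_csSup (bddAbove_inter_Iio _ _) ⟨hx, hxi⟩
  rw [hC.trace_eq hβ hi, hC.trace_eq hβ hi, max_eq_right (hη.trans h1), max_eq_right zero_le]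
  refine ⟨rfl, fun ξ hξ => h1.trans ?_⟩
  rcases List.mem_cons.1 hξ with rfl | hξ
  · exact le_rfl
  · exact hC.le_of_mem_trace ((hC.step_lt hβ hi).trans hβ) (hC.le_step hβ hi) ξ hξ

/-- A walk to `i` passes through `δ` if the trace of the walk to `δ` lies below `i`. -/
theorem IsLadder.trace_append {i δ β η : Ordinal.{u}} (hβ : β < o) (hi : i ≤ δ) (hδβ : δ ≤ β)
    (h : ∀ ξ ∈ trace C δ β η, ξ < i) :
    trace C i β η = trace C δ β η ++ trace C i δ ((trace C δ β η).getLastD η) ∧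
      (∀ k ≤ (trace C δ β η).length, vertex C k β i = vertex C k β δ) ∧
      vertex C (trace C δ β η).length β δ = δ := by
  induction β using WellFoundedLT.induction generalizing η with
  | ind β ih =>
    rcases hδβ.eq_or_lt with rfl | hlt
    · rw [trace_self]
      refine ⟨rfl, fun k hk => ?_, rfl⟩
      obtain rfl : k = 0 := by simpa using hk
      rfl
    · have hoβ := (hC.step_lt hβ hlt).trans hβ
      rw [hC.trace_eq hβ hlt] at h ⊢
      -- The first entry of the trace bounds `C β ∩ Iio δ`, so `C β` has no element in the interval
      -- from `i` to `δ`, and the first steps to `i` and to `δ` coincide.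
      have hs : ∀ y ∈ C β, y < δ → y < i := fun y hy hyδ =>
        ((le_csSup (bddAbove_inter_Iio _ _) ⟨hy, hyδ⟩).trans (le_max_right η _)).trans_lt
          (h _ List.mem_cons_self)
      have hinter : C β ∩ Iio i = C β ∩ Iio δ := by
        ext y
        exact and_congr_right fun hy => ⟨fun h => lt_of_lt_of_le h hi, hs y hy⟩
      have hilt := hi.trans_lt hlt
      have hstep : step C β i = step C β δ := by
        unfold step
        congr 1
        ext y
        exact and_congr_right fun hy => not_congr ⟨fun h => lt_of_lt_of_le h hi, hs y hy⟩
      obtain ⟨h1, h2, h3⟩ := ih _ (hC.step_lt hβ hlt) hoβ (hC.le_step hβ hlt)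
        (fun ξ hξ => h ξ (List.mem_cons_of_mem _ hξ))
      refine ⟨?_, fun k hk => ?_, h3⟩
      · rw [hC.trace_eq hβ hilt, hstep, hinter, h1, List.cons_append, List.getLastD_cons]
      · rcases k with _ | k
        · rfl
        · show vertex C k (step C β i) i = vertex C k (step C β δ) δ
          rw [hstep]
          exact h2 k (by simpa using hk)

end

end Walks


/-! ### Oscillations of finite sequences, 2-adic valuations and Ulam partitions -/

section Osc

/-- The number of switches from `false` to `true` in a sequence, with initial state `s`. -/
def osc : Bool → List Bool → ℕ
  | _, [] => 0
  | s, b :: l => (if !s && b then 1 else 0) + osc b l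

theorem osc_append (s : Bool) (l l' : List Bool) :
    osc s (l ++ l') = osc s l + osc (l.getLastD s) l' := by
  induction l generalizing s with
  | nil => simp [osc]
  | cons b l ih => simp only [List.cons_append, osc, ih, List.getLastD_cons, add_assoc]

theorem osc_of_false {l : List Bool} (h : ∀ b ∈ l, b = false) (s : Bool) : osc s l = 0 := by
  induction l generalizing s with
  | nil => rfl
  | cons b l ih =>
    obtain rfl := h b List.mem_cons_self
    simp [osc, ih fun c hc => h c (List.mem_cons_of_mem _ hc)]

theorem osc_of_true {l : List Bool} (h : ∀ b ∈ l, b = true) (hl : l ≠ []) (s : Bool) :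
    osc s l = if s then 0 else 1 := by
  have key : ∀ l : List Bool, (∀ b ∈ l, b = true) → osc true l = 0 := fun l hl => by
    induction l with
    | nil => rfl
    | cons b l ih =>
      obtain rfl := hl b List.mem_cons_self
      simp [osc, ih fun c hc => hl c (List.mem_cons_of_mem _ hc)]
  rcases l with _ | ⟨b, l⟩
  · exact absurd rfl hl
  · obtain rfl := h b List.mem_cons_self
    rw [osc, key l fun c hc => h c (List.mem_cons_of_mem _ hc)]
    cases s <;> rfl

theorem getLastD_const {s a : Bool} {l : List Bool} (h : ∀ b ∈ l, b = s) (hl : l ≠ []) :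
    l.getLastD a = s := by
  rw [List.getLastD_eq_getLast?, List.getLast?_eq_some_getLast hl]
  exact h _ (List.getLast_mem hl)

theorem getLastD_append {s : Bool} {l l' : List Bool} :
    (l ++ l').getLastD s = l'.getLastD (l.getLastD s) := by
  induction l generalizing s with
  | nil => rfl
  | cons b l ih => rw [List.cons_append, List.getLastD_cons, List.getLastD_cons, ih]

/-- The bound on `k` depends on `q` alone: the number of consecutive oscillations to be provided is
known before the offset `c` is. -/
theorem exists_padicValNat_eq (q c : ℕ) : ∃ k ≤ 2 ^ (q + 2), padicValNat 2 (c + k) = q := by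
  have h0 : 0 < 2 ^ (q + 1) := by positivity
  have h1 := Nat.div_add_mod c (2 ^ (q + 1))
  have h2 := Nat.mod_lt c h0
  have h3 : 2 ^ (q + 1) = 2 * 2 ^ q := by ring
  have h4 : 2 ^ (q + 2) = 4 * 2 ^ q := by ring
  set a := c / 2 ^ (q + 1)
  have h5 : 2 ^ q * (2 * (a + 1) + 1) = 2 ^ (q + 1) * a + 3 * 2 ^ q := by rw [h3]; ring
  -- An odd multiple of `2 ^ q` exceeding `c` by at most `3 * 2 ^ q`.
  refine ⟨2 ^ q * (2 * (a + 1) + 1) - c, by omega, ?_⟩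
  rw [Nat.add_sub_cancel' (by omega), padicValNat.mul (by positivity) (by omega),
    padicValNat.prime_pow, padicValNat.eq_zero_of_not_dvd (by omega), add_zero]

end Osc

theorem exists_list_bound {o : Ordinal.{u}} (h0 : 0 < o) (l : List Ordinal.{u}) (hl : ∀ x ∈ l, x < o) :
    ∃ b < o, ∀ x ∈ l, x ≤ b := by
  induction l with
  | nil => exact ⟨0, h0, by simp⟩
  | cons a l ih =>
    obtain ⟨b, hb, hb'⟩ := ih fun x hx => hl x (List.mem_cons_of_mem _ hx)
    refine ⟨max a b, max_lt (hl a List.mem_cons_self) hb, fun x hx => ?_⟩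
    rcases List.mem_cons.1 hx with rfl | hx
    · exact le_max_left _ _
    · exact (hb' x hx).trans (le_max_right _ _)

theorem mk_lists_lt {c : Cardinal.{u}} (hc : ℵ₀ < c) {δ : Ordinal.{u}} (hδ : δ < c.ord) :
    #{l : List Ordinal.{u} | ∀ x ∈ l, x < δ} < Cardinal.lift.{u + 1} c := by
  refine lt_of_le_of_lt ?_ (mk_Words_lt hc hδ)
  refine Cardinal.mk_le_of_injective (f := fun l => (⟨l.1.map fun x => (0, x), ?_⟩ : Words δ)) ?_
  · intro p hp
    obtain ⟨x, hx, rfl⟩ := List.mem_map.1 hp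
    exact l.2 x hx
  · intro l l' h
    refine Subtype.ext (List.map_injective_iff.2 (fun x y h => ?_) (congrArg Subtype.val h))
    exact (Prod.ext_iff.1 h).2

/-- Ulam's theorem: a stationary subset of a successor cardinal `θ⁺` splits into `θ` many
stationary sets. -/
theorem exists_partition {θ : Cardinal.{u}} (hθ : ℵ₀ ≤ θ) {S : Set Ordinal.{u}}
    (hS : IsStatIn S (Order.succ θ).ord) :
    ∃ f : Ordinal.{u} → Ordinal.{u}, (∀ β, f β < θ.ord) ∧
      ∀ n < θ.ord, IsStatIn {β ∈ S | f β = n} (Order.succ θ).ord := by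
  have hc := Cardinal.isRegular_succ hθ
  have hc' : ℵ₀ < Order.succ θ := hθ.trans_lt (Order.lt_succ θ)
  have hθ0 : 0 < θ.ord := (Cardinal.isSuccLimit_ord hθ).bot_lt
  have hX : #(Iio θ.ord) = Cardinal.lift.{u + 1} θ := by rw [Cardinal.mk_Iio_ordinal, Cardinal.card_ord]
  have key : ∀ β : Ordinal.{u}, ∃ j : Ordinal.{u} → Ordinal.{u}, β < (Order.succ θ).ord →
      (∀ ξ < β, j ξ < θ.ord) ∧ ∀ ξ < β, ∀ ξ' < β, j ξ = j ξ' → ξ = ξ' := fun β => by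
    by_cases hβ : β < (Order.succ θ).ord
    · have h1 : #(Iio β) ≤ #(Iio θ.ord) := by
        rw [hX, Cardinal.mk_Iio_ordinal, Cardinal.lift_le, ← Order.lt_succ_iff]
        exact Cardinal.lt_ord.1 hβ
      obtain ⟨k⟩ := h1
      refine ⟨fun ξ => if hξ : ξ < β then k ⟨ξ, hξ⟩ else 0, fun _ => ⟨fun ξ hξ => ?_,
        fun ξ hξ ξ' hξ' h => ?_⟩⟩
      · simp only [hξ, dif_pos]; exact (k _).2
      · simp only [hξ, hξ', dif_pos] at h
        exact congrArg Subtype.val (k.injective (Subtype.ext h))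
    · exact ⟨fun _ => 0, fun h => absurd h hβ⟩
  choose j hj hj' using key
  -- The Ulam matrix: each row `ξ` has a stationary entry `η ξ`, and many rows share the same
  -- column. Entries of one column are disjoint because `j β` is injective.
  have key2 : ∀ ξ : Ordinal.{u}, ∃ η, ξ < (Order.succ θ).ord →
      η < θ.ord ∧ IsStatIn {β ∈ S | ξ < β ∧ j β ξ = η} (Order.succ θ).ord := fun ξ => by
    by_cases hξ : ξ < (Order.succ θ).ord
    · obtain ⟨η, hη, hst⟩ := (hS.inter_club hc hc' (isClubIn_Ioo hc hξ)).exists_biUnion hc hc'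
        (s := Iio θ.ord) (f := fun β => j β ξ)
        (by rw [hX]; exact Cardinal.lift_lt.2 (Order.lt_succ θ))
        fun β hβ hβc => hj β hβc ξ hβ.2.1
      exact ⟨η, fun _ => ⟨hη, hst.mono fun β hβ => ⟨hβ.1.1.1, hβ.1.1.2.1, hβ.1.2⟩⟩⟩
    · exact ⟨0, fun h => absurd h hξ⟩
  choose η hη hηst using key2
  obtain ⟨η₀, -, hQ⟩ := (isClubIn_Iio.isStatIn hc hc').exists_biUnion hc hc' (s := Iio θ.ord) (f := η)
    (by rw [hX]; exact Cardinal.lift_lt.2 (Order.lt_succ θ)) fun ξ hξ _ => hη ξ hξ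
  have hQmk := lift_cof_le_mk (C := {ξ ∈ Iio (Order.succ θ).ord | η ξ = η₀}) (fun ξ h => h.1)
    fun x hx => by
      obtain ⟨y, hy, hxy, -⟩ := hQ.unbounded hc hx
      exact ⟨y, hy, hxy.le⟩
  rw [hc.cof_ord] at hQmk
  have hle : #(Iio θ.ord) ≤ #{ξ ∈ Iio (Order.succ θ).ord | η ξ = η₀} := by
    rw [hX]
    exact (Cardinal.lift_le.2 (Order.le_succ θ)).trans hQmk
  obtain ⟨k⟩ := hle
  have hf : ∀ β : Ordinal.{u}, ∃ n : Iio θ.ord, ∀ m : Iio θ.ord, β < (Order.succ θ).ord →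
      (k m : Ordinal) < β → j β (k m) = η₀ → n = m := fun β => by
    by_cases h : ∃ m : Iio θ.ord, β < (Order.succ θ).ord ∧ (k m : Ordinal) < β ∧ j β (k m) = η₀
    · obtain ⟨m, h1, h2, h3⟩ := h
      refine ⟨m, fun m' _ h2' h3' => k.injective (Subtype.ext ?_)⟩
      exact hj' β h1 _ h2 _ h2' (h3.trans h3'.symm)
    · exact ⟨⟨0, hθ0⟩, fun m h1 h2 h3 => absurd ⟨m, h1, h2, h3⟩ h⟩
  choose f hf using hf
  refine ⟨fun β => f β, fun β => (f β).2, fun n hn => ?_⟩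
  obtain ⟨h1, h2⟩ := (k ⟨n, hn⟩).2
  refine (hηst _ h1).mono ?_
  rintro β ⟨⟨hβ, h3, h4⟩, hβc⟩
  refine ⟨hβ, ?_⟩
  exact congrArg Subtype.val (hf β ⟨n, hn⟩ hβc h3 (h4.trans h2))


/-! ### Labels of walks and their prolongation -/

section Oscillation

/-- The trace of the walk from `β` to `δ`, together with the weights at its entries. -/
noncomputable def label (C : Ordinal.{u} → Set Ordinal.{u}) (δ β : Ordinal.{u}) :
    List (Ordinal.{u} × Ordinal.{u}) :=
  (trace C δ β 0).map fun ξ => (ξ, weight C ξ β)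

/-- The places at which the weights of `i` differ from the given ones. -/
noncomputable def bits (C : Ordinal.{u} → Set Ordinal.{u}) (i : Ordinal.{u})
    (t : List (Ordinal.{u} × Ordinal.{u})) : List Bool :=
  open scoped Classical in t.map fun p => decide (weight C p.1 i ≠ p.2)

/-- The ordinals for which the walk to `δ` has label `t`, and color `n` at its `q`th vertex. -/
def labeled (C : Ordinal.{u} → Set Ordinal.{u}) (f : Ordinal.{u} → Ordinal.{u}) (n o : Ordinal.{u})
    (q : ℕ) (δ : Ordinal.{u}) (t : List (Ordinal.{u} × Ordinal.{u})) : Set Ordinal.{u} :=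
  {β | δ < β ∧ β < o ∧ label C δ β = t ∧ f (vertex C q β δ) = n}

theorem bits_append (C : Ordinal.{u} → Set Ordinal.{u}) (i : Ordinal.{u})
    (t t' : List (Ordinal.{u} × Ordinal.{u})) : bits C i (t ++ t') = bits C i t ++ bits C i t' := by
  simp [bits]

theorem bits_eq_false {C : Ordinal.{u} → Set Ordinal.{u}} {i : Ordinal.{u}}
    {t : List (Ordinal.{u} × Ordinal.{u})} (h : ∀ p ∈ t, weight C p.1 i = p.2) :
    ∀ b ∈ bits C i t, b = false := by
  intro b hb
  obtain ⟨p, hp, rfl⟩ := List.mem_map.1 hb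
  simp [h p hp]

theorem bits_eq_true {C : Ordinal.{u} → Set Ordinal.{u}} {i : Ordinal.{u}}
    {t : List (Ordinal.{u} × Ordinal.{u})} (h : ∀ p ∈ t, weight C p.1 i ≠ p.2) :
    ∀ b ∈ bits C i t, b = true := by
  intro b hb
  obtain ⟨p, hp, rfl⟩ := List.mem_map.1 hb
  simp [h p hp]

theorem bits_ne_nil {C : Ordinal.{u} → Set Ordinal.{u}} {i : Ordinal.{u}}
    {t : List (Ordinal.{u} × Ordinal.{u})} (h : t ≠ []) : bits C i t ≠ [] := by
  simpa [bits] using h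

variable {lam θ : Cardinal.{u}} {C : Ordinal.{u} → Set Ordinal.{u}} {I : Set (Set Ordinal.{u})}
  {f : Ordinal.{u} → Ordinal.{u}} {n : Ordinal.{u}} {q : ℕ}

/-- If the ladders at a stationary set are cofinal then many pairs of its elements are
linked. -/
theorem isStatIn_linked (hlam : lam.IsRegular) (hlam' : ℵ₀ < lam) (hC : IsLadder C θ lam.ord)
    {S : Set Ordinal.{u}} (hS : IsStatIn S lam.ord) {γ : Ordinal.{u}} (hγ : γ < lam.ord) :
    IsStatIn {δ ∈ S | ∃ δ' ∈ S, δ < δ' ∧ δ' < lam.ord ∧ ∃ x ∈ C δ', γ ≤ x ∧ x < δ} lam.ord := by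
  by_contra hns
  obtain ⟨D, hD, hDS⟩ := not_isStatIn_iff.1 hns
  have hS' := (hS.inter_club hlam hlam' hD).inter_club hlam hlam' (isClubIn_Ioo hlam hγ)
  -- Take `δ'` in the set to be a limit of its elements in `D`: beyond any point of its ladder there
  -- is such an element below `δ'`, which is linked to `δ'`.
  obtain ⟨δ', ⟨⟨hδ'S, -⟩, hγδ', hδ'⟩, -, hacc⟩ := isStatIn_iff.1 hS' _
    (isClubIn_acc hlam hlam' fun x hx => hS'.unbounded hlam hx)
  obtain ⟨x, hx, hγx⟩ := (hC δ' hδ').2.1 γ hγδ'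
  obtain ⟨δ, ⟨⟨hδS, hδD⟩, -⟩, hxδ, hδδ'⟩ := hacc.2 x ((hC δ' hδ').1 hx)
  exact hDS δ hδD ⟨hδS, δ', hδ'S, hδδ', hδ', x, hx, hγx, hxδ⟩

theorem label_fst_lt (hC : IsLadder C θ lam.ord) (hθ : θ.IsRegular) {δ β : Ordinal.{u}}
    (hδ : δ.cof = θ) (hδβ : δ ≤ β) (hβ : β < lam.ord) : ∀ p ∈ label C δ β, p.1 < δ := by
  intro p hp
  obtain ⟨ξ, hξ, rfl⟩ := List.mem_map.1 hp
  refine hC.lt_of_mem_trace hδ hβ ?_ hδβ ξ hξ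
  rw [← Ordinal.cof_pos, hδ]
  exact hθ.pos

/-- Walks with a given label to `δ'`, followed by the walk from `δ'` to `i`. -/
theorem label_append (hC : IsLadder C θ lam.ord) {i δ β γ x : Ordinal.{u}}
    {t : List (Ordinal.{u} × Ordinal.{u})} (hi : i < δ) (hδβ : δ < β) (hβ : β < lam.ord)
    (ht : label C δ β = t) (htγ : ∀ p ∈ t, p.1 ≤ γ) (hx : x ∈ C δ) (hγx : γ ≤ x) (hxi : x < i)
    (hw : ∀ ξ, γ ≤ ξ → ξ < δ → weight C ξ β = weight C ξ δ)
    (htr : ∀ ξ ∈ trace C i δ 0, ξ < δ) :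
    label C i β = t ++ label C i δ ∧ (∀ k ≤ t.length, vertex C k β i = vertex C k β δ) ∧
      vertex C t.length β δ = δ := by
  subst ht
  have h1 : ∀ ξ ∈ trace C δ β 0, ξ ≤ γ := fun ξ hξ => htγ _ (List.mem_map.2 ⟨ξ, hξ, rfl⟩)
  obtain ⟨h2, h3, h4⟩ := hC.trace_append hβ hi.le hδβ.le (η := 0)
    fun ξ hξ => ((h1 ξ hξ).trans hγx).trans_lt hxi
  have hlen : (label C δ β).length = (trace C δ β 0).length := by simp [label]
  have hlast : (trace C δ β 0).getLastD 0 ≤ x := by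
    refine le_trans ?_ hγx
    rcases hnil : trace C δ β 0 with _ | ⟨a, l⟩
    · exact zero_le
    · rw [hnil] at h1
      rw [List.getLastD_eq_getLast?, List.getLast?_eq_some_getLast (by simp)]
      exact h1 _ (List.getLast_mem _)
  obtain ⟨h5, h6⟩ := hC.trace_congr (hδβ.trans hβ) hx hxi hi hlast
  rw [hlen]
  refine ⟨?_, h3, h4⟩
  unfold label
  rw [h2, List.map_append, h5]
  congr 1
  refine List.map_congr_left fun ξ hξ => ?_
  rw [hw ξ (hγx.trans (h6 ξ hξ)) (htr ξ hξ)]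

variable (hθ : θ.IsRegular) (hlamθ : lam = Order.succ θ) (hC : IsLadder C θ lam.ord)
  (hI : IsIdealOver I lam.ord) (hIc : IsComplete I lam)

-- Each `β` agrees with `δ` from some point below `δ` on. There are fewer than `lam` candidates for
-- that point, so completeness fixes one.
include hθ hC hI hIc in
theorem exists_labeled_coherent {δ : Ordinal.{u}} (hδ : δ.cof = θ) (hδlam : δ < lam.ord)
    {t : List (Ordinal.{u} × Ordinal.{u})} (ht : labeled C f n lam.ord q δ t ∉ I) :
    ∃ γ < δ, {β ∈ labeled C f n lam.ord q δ t |
      ∀ ξ, γ ≤ ξ → ξ < δ → weight C ξ β = weight C ξ δ} ∉ I := by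
  have key : ∀ β : Ordinal.{u}, ∃ γ, δ < β → β < lam.ord →
      γ < δ ∧ ∀ ξ, γ ≤ ξ → ξ < δ → weight C ξ β = weight C ξ δ := fun β => by
    by_cases h : δ < β ∧ β < lam.ord
    · obtain ⟨γ, hγ⟩ := hC.exists_weight_eq hθ hδ h.2 h.1.le
      exact ⟨γ, fun _ _ => hγ⟩
    · exact ⟨0, fun h1 h2 => absurd ⟨h1, h2⟩ h⟩
  choose g hg using key
  obtain ⟨γ, hγ, hpos⟩ := hI.exists_pos hIc (f := g) (s := Iio δ) ht (mk_Iio_lt hδlam)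
    fun β hβ => (hg β hβ.1 hβ.2.1).1
  refine ⟨γ, hγ, fun h => hpos (hI.mono _ h _ ?_)⟩
  rintro β ⟨hβ, rfl⟩
  exact ⟨hβ, (hg β hβ.1 hβ.2.1).2⟩

include hθ hlamθ hC hI hIc

/-- Finitely many labels that are positive on a stationary set can be prolonged
simultaneously. -/
theorem exists_prolong {S A : Set Ordinal.{u}} (hS : IsStatIn S lam.ord) (hSlam : S ⊆ Iio lam.ord)
    (hSθ : ∀ δ ∈ S, δ.cof = θ) (hA : ∀ x < lam.ord, ∃ i ∈ A, x ≤ i ∧ i < lam.ord)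
    {T : List (List (Ordinal.{u} × Ordinal.{u}))} (hTq : ∀ t ∈ T, q ≤ t.length)
    (hT : ∀ δ ∈ S, ∀ t ∈ T, labeled C f n lam.ord q δ t ∉ I) :
    ∃ γ₀ < lam.ord, ∀ γ, γ₀ ≤ γ → γ < lam.ord → ∃ S' ⊆ S, ∃ u : List (Ordinal.{u} × Ordinal.{u}),
      IsStatIn S' lam.ord ∧ u ≠ [] ∧ (∀ p ∈ u, γ ≤ p.1 ∧ p.1 < lam.ord ∧ p.2 < θ.ord) ∧
      (∀ δ ∈ S', ∀ t ∈ T, labeled C f n lam.ord q δ (t ++ u) ∉ I) ∧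
      ∀ x < lam.ord, ∃ i ∈ A, x ≤ i ∧ i < lam.ord ∧ ∀ p ∈ u, weight C p.1 i = p.2 := by
  have hlam : lam.IsRegular := hlamθ ▸ Cardinal.isRegular_succ hθ.1
  have hθlam : θ < lam := hlamθ ▸ Order.lt_succ θ
  have hlam' : ℵ₀ < lam := hθ.1.trans_lt hθlam
  have hS0 : ∀ δ ∈ S, 0 < δ := fun δ hδ => by
    rw [← Ordinal.cof_pos, hSθ δ hδ]
    exact hθ.pos
  have key : ∀ δ t, ∃ γ, δ ∈ S → t ∈ T → γ < δ ∧ {β ∈ labeled C f n lam.ord q δ t |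
      ∀ ξ, γ ≤ ξ → ξ < δ → weight C ξ β = weight C ξ δ} ∉ I := fun δ t => by
    by_cases h : δ ∈ S ∧ t ∈ T
    · obtain ⟨γ, hγ⟩ := exists_labeled_coherent hθ hC hI hIc (hSθ δ h.1) (hSlam h.1)
        (hT δ h.1 t h.2)
      exact ⟨γ, fun _ _ => hγ⟩
    · exact ⟨0, fun h1 h2 => absurd ⟨h1, h2⟩ h⟩
  choose g hg using key
  have keyA : ∀ δ : Ordinal.{u}, ∃ i γ, δ ∈ S → i ∈ A ∧ δ ≤ i ∧ i < lam.ord ∧ γ < δ ∧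
      ∀ ξ, γ ≤ ξ → ξ < δ → weight C ξ i = weight C ξ δ := fun δ => by
    by_cases h : δ ∈ S
    · obtain ⟨i, hi, hδi, hilam⟩ := hA δ (hSlam h)
      obtain ⟨γ, hγ⟩ := hC.exists_weight_eq hθ (hSθ δ h) hilam hδi
      exact ⟨i, γ, fun _ => ⟨hi, hδi, hilam, hγ⟩⟩
    · exact ⟨0, 0, fun h' => absurd h' h⟩
  choose a gA ha using keyA
  -- The points from which `δ` agrees with `a δ`, and with positively many `β` of each label, are
  -- regressive, hence constant on a stationary set.
  obtain ⟨l, hl⟩ := hS.fodor_list hlam hlam' (f := fun δ => gA δ :: T.map (g δ)) (by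
    intro δ hδ _ y hy
    rcases List.mem_cons.1 hy with rfl | hy
    · exact (ha δ hδ).2.2.2.1
    · obtain ⟨t, ht, rfl⟩ := List.mem_map.1 hy
      exact (hg δ t hδ ht).1)
  obtain ⟨μ₀, ⟨hμ₀S, hμ₀l⟩, -, hμ₀⟩ := hl.unbounded hlam hlam.ord_pos
  refine ⟨μ₀, hμ₀, fun γ hγ₀ hγ => ?_⟩
  have hgA : ∀ δ ∈ {δ ∈ S | gA δ :: T.map (g δ) = l}, gA δ ≤ γ := by
    rintro δ ⟨hδ, hδl⟩
    have h1 : gA δ ∈ l := hδl ▸ List.mem_cons_self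
    rw [← hμ₀l] at h1
    refine le_trans (le_of_lt ?_) hγ₀
    rcases List.mem_cons.1 h1 with h1 | h1
    · rw [h1]; exact (ha μ₀ hμ₀S).2.2.2.1
    · obtain ⟨t, ht, h1⟩ := List.mem_map.1 h1
      rw [← h1]; exact (hg μ₀ t hμ₀S ht).1
  have hgT : ∀ δ ∈ {δ ∈ S | gA δ :: T.map (g δ) = l}, ∀ t ∈ T, g δ t ≤ γ := by
    rintro δ ⟨hδ, hδl⟩ t ht
    have h1 : g δ t ∈ l := hδl ▸ List.mem_cons_of_mem _ (List.mem_map.2 ⟨t, ht, rfl⟩)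
    rw [← hμ₀l] at h1
    refine le_trans (le_of_lt ?_) hγ₀
    rcases List.mem_cons.1 h1 with h1 | h1
    · rw [h1]; exact (ha μ₀ hμ₀S).2.2.2.1
    · obtain ⟨t, ht, h1⟩ := List.mem_map.1 h1
      rw [← h1]; exact (hg μ₀ t hμ₀S ht).1
  have hTγ : ∀ t ∈ T, ∀ p ∈ t, p.1 ≤ γ := fun t ht p hp => by
    obtain ⟨β, h1, h2, h3, -⟩ := hI.nonempty_of_notMem hlam.ord_pos (hT μ₀ hμ₀S t ht)
    rw [← h3] at hp
    exact (label_fst_lt hC hθ (hSθ μ₀ hμ₀S) h1.le h2 p hp).le.trans hγ₀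
  have hθord : θ.ord < lam.ord := Cardinal.ord_lt_ord.2 hθlam
  have hlink := (isStatIn_linked hlam hlam' hC hl hγ).inter_club hlam hlam' (isClubIn_Ioo hlam hθord)
  have key' : ∀ δ : Ordinal.{u}, ∃ δ' x, δ ∈ {δ ∈ {δ ∈ S | gA δ :: T.map (g δ) = l} |
      ∃ δ' ∈ {δ ∈ S | gA δ :: T.map (g δ) = l}, δ < δ' ∧ δ' < lam.ord ∧ ∃ x ∈ C δ', γ ≤ x ∧ x < δ} ∩
        Ioo θ.ord lam.ord →
      δ' ∈ {δ ∈ S | gA δ :: T.map (g δ) = l} ∧ δ < δ' ∧ x ∈ C δ' ∧ γ ≤ x ∧ x < δ := fun δ => by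
    by_cases h : δ ∈ {δ ∈ {δ ∈ S | gA δ :: T.map (g δ) = l} |
      ∃ δ' ∈ {δ ∈ S | gA δ :: T.map (g δ) = l}, δ < δ' ∧ δ' < lam.ord ∧ ∃ x ∈ C δ', γ ≤ x ∧ x < δ} ∩
        Ioo θ.ord lam.ord
    · obtain ⟨δ', h1, h2, -, x, h3, h4⟩ := h.1.2
      exact ⟨δ', x, fun _ => ⟨h1, h2, h3, h4⟩⟩
    · exact ⟨0, 0, fun h' => absurd h' h⟩
  choose d x hd using key'
  have htr : ∀ δ, δ ∈ {δ ∈ {δ ∈ S | gA δ :: T.map (g δ) = l} |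
      ∃ δ' ∈ {δ ∈ S | gA δ :: T.map (g δ) = l}, δ < δ' ∧ δ' < lam.ord ∧ ∃ x ∈ C δ', γ ≤ x ∧ x < δ} ∩
        Ioo θ.ord lam.ord → ∀ ξ ∈ trace C δ (d δ) 0, ξ < δ := fun δ hδ ξ hξ =>
    hC.lt_of_mem_trace (hSθ δ hδ.1.1.1) (hSlam (hd δ hδ).1.1) (hS0 δ hδ.1.1.1) (hd δ hδ).2.1.le ξ hξ
  -- The label of the walk from `d δ` to `δ` consists of ordinals below `δ`, the weights because `δ
  -- > θ.ord`. So it is constant on a stationary set, and this is `u`.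
  obtain ⟨l₁, hl₁⟩ := hlink.fodor_list hlam hlam' (f := fun δ => trace C δ (d δ) 0)
    fun δ hδ _ => htr δ hδ
  obtain ⟨l₂, hl₂⟩ := hl₁.fodor_list hlam hlam'
    (f := fun δ => (trace C δ (d δ) 0).map fun ξ => weight C ξ (d δ)) (by
      rintro δ ⟨hδ, -⟩ _ y hy
      obtain ⟨ξ, -, rfl⟩ := List.mem_map.1 hy
      exact (hC.weight_lt hθ.ord_pos (hSlam (hd δ hδ).1.1)).trans hδ.2.1)
  have hlab : ∀ δ, trace C δ (d δ) 0 = l₁ → ((trace C δ (d δ) 0).map fun ξ => weight C ξ (d δ)) = l₂ →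
      label C δ (d δ) = l₁.zip l₂ := fun δ h1 h2 => by
    rw [← h2, h1, ← List.map_prod_left_eq_zip]
    unfold label
    rw [h1]
  refine ⟨_, ?_, l₁.zip l₂, hl₂, ?_, ?_, ?_, ?_⟩
  · rintro δ ⟨⟨hδ, -⟩, -⟩
    exact hδ.1.1.1
  · obtain ⟨δ, ⟨⟨hδ, h1⟩, h2⟩, -⟩ := hl₂.unbounded hlam hlam.ord_pos
    rw [← hlab δ h1 h2]
    have := hC.trace_ne_nil (η := 0) (hSlam (hd δ hδ).1.1) (hd δ hδ).2.1
    simpa [label] using this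
  · obtain ⟨δ, ⟨⟨hδ, h1⟩, h2⟩, -, hδlam⟩ := hl₂.unbounded hlam hlam.ord_pos
    rw [← hlab δ h1 h2]
    intro p hp
    obtain ⟨ξ, hξ, rfl⟩ := List.mem_map.1 hp
    obtain ⟨hd1, hd2, hd3, hd4, hd5⟩ := hd δ hδ
    refine ⟨hd4.trans ((hC.trace_congr (hSlam hd1.1) hd3 hd5 hd2 zero_le).2 ξ hξ),
      (htr δ hδ ξ hξ).trans hδlam, hC.weight_lt hθ.ord_pos (hSlam hd1.1)⟩
  · rintro δ ⟨⟨hδ, h1⟩, h2⟩ t ht h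
    rw [← hlab δ h1 h2] at h
    obtain ⟨hd1, hd2, hd3, hd4, hd5⟩ := hd δ hδ
    refine (hg (d δ) t hd1.1 ht).2 (hI.mono _ h _ ?_)
    rintro β ⟨⟨hβ1, hβ2, hβ3, hβ4⟩, hβ5⟩
    -- By the link, the walk from `β` to `δ` passes through `d δ`, and `β` agrees with `d δ` on the
    -- rest of it.
    obtain ⟨h3, h4, -⟩ := label_append hC hd2 hβ1 hβ2 hβ3 (hTγ t ht) hd3 hd4 hd5
      (fun ξ hξ hξ' => hβ5 ξ ((hgT _ hd1 t ht).trans hξ) hξ') fun ξ hξ => (htr δ hδ ξ hξ).trans hd2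
    exact ⟨hd2.trans hβ1, hβ2, h3, by rw [h4 q (hTq t ht)]; exact hβ4⟩
  · intro y hy
    obtain ⟨δ, ⟨⟨hδ, h1⟩, h2⟩, hyδ, -⟩ := hl₂.unbounded hlam hy
    obtain ⟨hd1, hd2, hd3, hd4, hd5⟩ := hd δ hδ
    obtain ⟨ha1, ha2, ha3, -, ha4⟩ := ha (d δ) hd1.1
    refine ⟨a (d δ), ha1, ((hyδ.trans hd2).trans_le ha2).le, ha3, ?_⟩
    rw [← hlab δ h1 h2]
    intro p hp
    obtain ⟨ξ, hξ, rfl⟩ := List.mem_map.1 hp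
    have hxξ := (hC.trace_congr (hSlam hd1.1) hd3 hd5 hd2 zero_le).2 ξ hξ
    exact ha4 ξ ((hgA _ hd1).trans (hd4.trans hxξ)) ((htr δ hδ ξ hξ).trans hd2)

/-- Otherwise, for each large `γ`, the prolongation `u` above `γ` shares a weight with every large
`i ∈ A`. So each such `i` has a weight at most `ν γ` at some place between `γ` and `b γ`. With `ν`
constant on a stationary set and a limit of cofinality `θ` of that set below `i`, this gives `θ`
places of bounded weight, against `IsLadder.mk_weight_le_lt`. -/
theorem exists_prolong_ne {S A : Set Ordinal.{u}} (hS : IsStatIn S lam.ord) (hSlam : S ⊆ Iio lam.ord)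
    (hSθ : ∀ δ ∈ S, δ.cof = θ) (hA : ∀ x < lam.ord, ∃ i ∈ A, x ≤ i ∧ i < lam.ord)
    {T : List (List (Ordinal.{u} × Ordinal.{u}))} (hTq : ∀ t ∈ T, q ≤ t.length)
    (hT : ∀ δ ∈ S, ∀ t ∈ T, labeled C f n lam.ord q δ t ∉ I) :
    ∃ S' ⊆ S, ∃ u : List (Ordinal.{u} × Ordinal.{u}), IsStatIn S' lam.ord ∧ u ≠ [] ∧
      (∀ δ ∈ S', ∀ t ∈ T, labeled C f n lam.ord q δ (t ++ u) ∉ I) ∧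
      ∀ x < lam.ord, ∃ i ∈ A, x ≤ i ∧ i < lam.ord ∧ ∀ p ∈ u, weight C p.1 i ≠ p.2 := by
  have hlam : lam.IsRegular := hlamθ ▸ Cardinal.isRegular_succ hθ.1
  have hθlam : θ < lam := hlamθ ▸ Order.lt_succ θ
  have hlam' : ℵ₀ < lam := hθ.1.trans_lt hθlam
  by_contra hcon
  obtain ⟨γ₀, hγ₀, hpro⟩ := exists_prolong hθ hlamθ hC hI hIc hS hSlam hSθ hA hTq hT
  have key : ∀ γ : Ordinal.{u}, ∃ (b ν : Ordinal.{u}), b < lam.ord ∧ ν < θ.ord ∧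
      (γ₀ ≤ γ → γ < lam.ord → ∀ i ∈ A, b ≤ i → i < lam.ord →
        ∃ ξ, γ ≤ ξ ∧ ξ ≤ b ∧ weight C ξ i ≤ ν) := fun γ => by
    by_cases h : γ₀ ≤ γ ∧ γ < lam.ord
    · obtain ⟨S', hS', u, h1, h2, h3, h4, -⟩ := hpro γ h.1 h.2
      have h5 : ∃ x < lam.ord, ∀ i ∈ A, x ≤ i → i < lam.ord → ∃ p ∈ u, weight C p.1 i = p.2 := by
        by_contra hno
        push Not at hno
        exact hcon ⟨S', hS', u, h1, h2, h4, hno⟩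
      obtain ⟨x, hx, hx'⟩ := h5
      obtain ⟨ε, hε, hε'⟩ := exists_list_bound hlam.ord_pos (u.map Prod.fst) fun y hy => by
        obtain ⟨p, hp, rfl⟩ := List.mem_map.1 hy; exact (h3 p hp).2.1
      obtain ⟨ν, hν, hν'⟩ := exists_list_bound hθ.ord_pos (u.map Prod.snd) fun y hy => by
        obtain ⟨p, hp, rfl⟩ := List.mem_map.1 hy; exact (h3 p hp).2.2
      refine ⟨max x ε, ν, max_lt hx hε, hν, fun _ _ i hi hbi hilam => ?_⟩
      obtain ⟨p, hp, hpi⟩ := hx' i hi ((le_max_left _ _).trans hbi) hilam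
      exact ⟨p.1, (h3 p hp).1, (hε' _ (List.mem_map.2 ⟨p, hp, rfl⟩)).trans (le_max_right _ _),
        hpi.trans_le (hν' _ (List.mem_map.2 ⟨p, hp, rfl⟩))⟩
    · exact ⟨0, 0, hlam.ord_pos, hθ.ord_pos, fun h1 h2 => absurd ⟨h1, h2⟩ h⟩
  choose b ν hb hν hbν using key
  have hcl := isClubIn_closed hlam hlam' (F := fun y => {b y}) (by rintro y - _ rfl; exact hb y)
    fun y _ => mk_singleton_lt hlam _
  obtain ⟨ν₀, hν₀, hQ'⟩ := ((hcl.inter hlam hlam' (isClubIn_Ioo hlam hγ₀)).isStatIn hlam hlam').exists_biUnion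
    hlam hlam' (f := ν) (s := Iio θ.ord)
    (by rw [Cardinal.mk_Iio_ordinal, Cardinal.card_ord]; exact Cardinal.lift_lt.2 hθlam)
    fun γ _ _ => hν γ
  obtain ⟨Q, hQb, hQγ, hQν, hQ⟩ : ∃ Q : Set Ordinal.{u}, (∀ γ ∈ Q, ∀ y < γ, b y < γ) ∧
      (∀ γ ∈ Q, γ₀ < γ ∧ γ < lam.ord) ∧ (∀ γ ∈ Q, ν γ = ν₀) ∧ IsStatIn Q lam.ord :=
    ⟨_, fun γ hγ y hy => hγ.1.1.2.2 y hy _ rfl, fun γ hγ => hγ.1.2, fun γ hγ => hγ.2, hQ'⟩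
  obtain ⟨κ, hκθ, hκlam, hκacc⟩ := isStatIn_iff.1 (isStatIn_cof hlam hθ hθlam) _
    (isClubIn_acc hlam hlam' fun x hx => hQ.unbounded hlam hx)
  obtain ⟨i, hi, hκi, hilam⟩ := hA κ hκlam
  have key2 : ∀ γ : Ordinal.{u}, ∃ ξ, γ ∈ Q → γ < κ →
      γ ≤ ξ ∧ ξ ≤ b γ ∧ b γ < κ ∧ weight C ξ i ≤ ν₀ := fun γ => by
    by_cases h : γ ∈ Q ∧ γ < κ
    · obtain ⟨hγQ, hγκ⟩ := h
      obtain ⟨y, hy, hγy, hyκ⟩ := hκacc.2 γ hγκ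
      have h1 : b γ < κ := (hQb y hy γ hγy).trans hyκ
      obtain ⟨ξ, h2, h3, h4⟩ := hbν γ (hQγ γ hγQ).1.le (hQγ γ hγQ).2 i hi (h1.le.trans hκi) hilam
      exact ⟨ξ, fun _ _ => ⟨h2, h3, h1, hQν γ hγQ ▸ h4⟩⟩
    · exact ⟨0, fun h1 h2 => absurd ⟨h1, h2⟩ h⟩
  choose ξ hξ using key2
  have hmk := lift_cof_le_mk (δ := κ) (C := Q ∩ Iio κ) inter_subset_right fun x hx => by
    obtain ⟨y, hy, hxy, hyκ⟩ := hκacc.2 x hx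
    exact ⟨y, ⟨hy, hyκ⟩, hxy.le⟩
  rw [show κ.cof = θ from hκθ] at hmk
  refine absurd (hC.mk_weight_le_lt hθ hilam hν₀) (not_lt.2 (hmk.trans ?_))
  refine Cardinal.mk_le_of_injective (f := fun γ : (Q ∩ Iio κ : Set Ordinal.{u}) =>
    (⟨ξ γ, ?_⟩ : {ξ | ξ < i ∧ weight C ξ i ≤ ν₀})) ?_
  · obtain ⟨h1, h2, h3, h4⟩ := hξ γ γ.2.1 γ.2.2
    exact ⟨(h2.trans_lt h3).trans_le hκi, h4⟩
  -- Elements of `Q` are closed under `b`, so the intervals from `γ` to `b γ` are disjoint.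
  · have hlt : ∀ γ ∈ Q ∩ Iio κ, ∀ γ' ∈ Q ∩ Iio κ, γ < γ' → ξ γ < ξ γ' := by
      intro γ hγ γ' hγ' h
      obtain ⟨h1, h2, h3, h4⟩ := hξ γ hγ.1 hγ.2
      have h5 : b γ < γ' := hQb γ' hγ'.1 γ h
      exact (h2.trans_lt h5).trans_le (hξ γ' hγ'.1 hγ'.2).1
    rintro ⟨γ, hγ⟩ ⟨γ', hγ'⟩ h
    replace h : ξ γ = ξ γ' := congrArg Subtype.val h
    refine Subtype.ext ?_
    show γ = γ'
    by_contra hne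
    rcases lt_or_gt_of_ne hne with h' | h'
    · exact absurd h (hlt γ hγ γ' hγ' h').ne
    · exact absurd h (hlt γ' hγ' γ hγ h').ne'

end Oscillation


/-! ### Consecutive oscillations, and colorings when `lam = Order.succ θ` -/

section Oscillation

variable {lam θ : Cardinal.{u}} {C : Ordinal.{u} → Set Ordinal.{u}} {I : Set (Set Ordinal.{u})}
  {f : Ordinal.{u} → Ordinal.{u}} {n : Ordinal.{u}} {q : ℕ}

variable (hθ : θ.IsRegular) (hlamθ : lam = Order.succ θ) (hC : IsLadder C θ lam.ord)
  (hI : IsIdealOver I lam.ord) (hIc : IsComplete I lam)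

include hθ hC hIc in
/-- Stationarily many `δ` have the same positive label, with `δ` itself as the vertex at the end. -/
theorem exists_labeled (hlamθ : lam = Order.succ θ) (hI : IsIdealOver I lam.ord) {S : Set Ordinal.{u}}
    (hS : IsStatIn S lam.ord) (hSθ : ∀ δ ∈ S, δ.cof = θ)
    (hSn : ∀ δ ∈ S, f δ = n) :
    ∃ S' ⊆ S, ∃ t : List (Ordinal.{u} × Ordinal.{u}), IsStatIn S' lam.ord ∧
      ∀ δ ∈ S', labeled C f n lam.ord t.length δ t ∉ I := by
  have hlam : lam.IsRegular := hlamθ ▸ Cardinal.isRegular_succ hθ.1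
  have hθlam : θ < lam := hlamθ ▸ Order.lt_succ θ
  have hlam' : ℵ₀ < lam := hθ.1.trans_lt hθlam
  have hθord : θ.ord < lam.ord := Cardinal.ord_lt_ord.2 hθlam
  have hlim := Cardinal.isSuccLimit_ord hlam.1
  have htr : ∀ δ ∈ S, ∀ β, δ ≤ β → β < lam.ord → ∀ ξ ∈ trace C δ β 0, ξ < δ := fun δ hδ β h1 h2 =>
    hC.lt_of_mem_trace (hSθ δ hδ) h2 (by rw [← Ordinal.cof_pos, hSθ δ hδ]; exact hθ.pos) h1
  have key : ∀ δ : Ordinal.{u}, ∃ p : List Ordinal.{u} × List Ordinal.{u}, δ ∈ S ∩ Ioo θ.ord lam.ord →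
      (∀ x ∈ p.1, x < δ) ∧ (∀ x ∈ p.2, x < δ) ∧
      labeled C f n lam.ord (p.1.zip p.2).length δ (p.1.zip p.2) ∉ I := fun δ => by
    by_cases hδ : δ ∈ S ∩ Ioo θ.ord lam.ord
    · obtain ⟨hδS, hδθ, hδlam⟩ := hδ
      -- There are fewer than `lam` candidates for the label of a walk to `δ`, so one of them is
      -- positive.
      obtain ⟨p, hp, hpos⟩ := hI.exists_pos hIc (B := Ico (δ + 1) lam.ord)
        (s := {l : List Ordinal.{u} | ∀ x ∈ l, x < δ} ×ˢ {l : List Ordinal.{u} | ∀ x ∈ l, x < δ})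
        (f := fun β => (trace C δ β 0, (trace C δ β 0).map fun ξ => weight C ξ β))
        (hI.Ico_notMem (hlim.add_one_lt hδlam))
        (by
          rw [Cardinal.mk_setProd]
          exact Cardinal.mul_lt_of_lt (by simpa using hlam.1) (mk_lists_lt hlam' hδlam)
            (mk_lists_lt hlam' hδlam))
        fun β hβ => ⟨htr δ hδS β ((lt_add_one δ).le.trans hβ.1) hβ.2, fun x hx => by
          obtain ⟨ξ, -, rfl⟩ := List.mem_map.1 hx
          exact (hC.weight_lt hθ.ord_pos hβ.2).trans hδθ⟩
      refine ⟨p, fun _ => ⟨hp.1, hp.2, fun h => hpos (hI.mono _ h _ ?_)⟩⟩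
      rintro β ⟨⟨hβ1, hβ2⟩, rfl⟩
      have hlt : δ < β := (lt_add_one δ).trans_le hβ1
      have hlab : label C δ β = (trace C δ β 0).zip ((trace C δ β 0).map fun ξ => weight C ξ β) := by
        rw [← List.map_prod_left_eq_zip]; rfl
      refine ⟨hlt, hβ2, hlab, ?_⟩
      have hlen : ((trace C δ β 0).zip ((trace C δ β 0).map fun ξ => weight C ξ β)).length =
          (trace C δ β 0).length := by simp
      show f (vertex C (List.length (List.zip _ _)) β δ) = n
      rw [hlen, (hC.trace_append hβ2 le_rfl hlt.le (htr δ hδS β hlt.le hβ2)).2.2]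
      exact hSn δ hδS
    · exact ⟨([], []), fun h => absurd h hδ⟩
  choose p hp using key
  obtain ⟨l₁, hl₁⟩ := (hS.inter_club hlam hlam' (isClubIn_Ioo hlam hθord)).fodor_list hlam hlam'
    (f := fun δ => (p δ).1) fun δ hδ _ => (hp δ hδ).1
  obtain ⟨l₂, hl₂⟩ := hl₁.fodor_list hlam hlam' (f := fun δ => (p δ).2) fun δ hδ _ => (hp δ hδ.1).2.1
  refine ⟨_, fun δ hδ => ?_, l₁.zip l₂, hl₂, fun δ hδ => ?_⟩
  · exact hδ.1.1.1
  · have h := (hp δ hδ.1.1).2.2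
    rwa [show (p δ).1 = l₁ from hδ.1.2, show (p δ).2 = l₂ from hδ.2] at h

include hθ hlamθ hC hI hIc

/-- There are, for every `m`, labels `t 0, …, t m` that are positive on a stationary set, whose
oscillations with the members of some unbounded set are consecutive numbers. -/
theorem exists_labels_osc {S A : Set Ordinal.{u}} {t₀ : List (Ordinal.{u} × Ordinal.{u})}
    (hS : IsStatIn S lam.ord) (hSlam : S ⊆ Iio lam.ord)
    (hSθ : ∀ δ ∈ S, δ.cof = θ) (hA : IsStatIn A lam.ord) (hq : q ≤ t₀.length)
    (ht₀ : ∀ δ ∈ S, labeled C f n lam.ord q δ t₀ ∉ I) (m : ℕ) :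
    ∃ S' ⊆ S, ∃ A' ⊆ A, ∃ (c : ℕ) (t : ℕ → List (Ordinal.{u} × Ordinal.{u})),
      IsStatIn S' lam.ord ∧ (∀ x < lam.ord, ∃ i ∈ A', x ≤ i ∧ i < lam.ord) ∧
      ∀ k ≤ m, q ≤ (t k).length ∧ (∀ δ ∈ S', labeled C f n lam.ord q δ (t k) ∉ I) ∧
        ∀ i ∈ A', osc true (bits C i (t k)) = c + k ∧ (bits C i (t k)).getLastD true = true := by
  have hlam : lam.IsRegular := hlamθ ▸ Cardinal.isRegular_succ hθ.1
  have hlam' : ℵ₀ < lam := hθ.1.trans_lt (hlamθ ▸ Order.lt_succ θ)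
  induction m with
  | zero =>
    -- The bits on `t₀` are fixed first. A prolongation with disagreement then ends in `true`, at
    -- the cost of one switch if `b` ends in `false`; `c` accounts for it.
    obtain ⟨⟨b⟩, -, hb⟩ := hA.exists_biUnion hlam hlam' (X := ULift.{u + 1} (List Bool)) (s := univ)
      (f := fun i => ⟨bits C i t₀⟩)
      (by
        have h1 : #(univ : Set (ULift.{u + 1} (List Bool))) ≤ ℵ₀ := Cardinal.mk_le_aleph0
        refine h1.trans_lt ?_
        simpa using hlam') (fun _ _ _ => mem_univ _)
    obtain ⟨S', hS', u, h1, h2, h3, h4⟩ := exists_prolong_ne (T := [t₀]) hθ hlamθ hC hI hIc hS hSlam hSθ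
      (fun x hx => by
        obtain ⟨y, hy, h1, h2⟩ := hb.unbounded hlam hx
        exact ⟨y, hy, h1.le, h2⟩) (by simpa using hq) (by simpa using ht₀)
    refine ⟨S', hS', {i ∈ A | bits C i t₀ = b ∧ ∀ p ∈ u, weight C p.1 i ≠ p.2},
      fun i hi => hi.1, osc true b + if b.getLastD true then 0 else 1,
      fun _ => t₀ ++ u, h1, fun x hx => ?_, fun k hk => ⟨?_, fun δ hδ => h3 δ hδ t₀ (by simp), ?_⟩⟩
    · obtain ⟨i, hi, h5, h6, h7⟩ := h4 x hx
      exact ⟨i, ⟨hi.1, ULift.up_inj.1 hi.2, h7⟩, h5, h6⟩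
    · rw [List.length_append]; omega
    · rintro i ⟨-, h5, h6⟩
      obtain rfl : k = 0 := by simpa using hk
      rw [bits_append, osc_append, getLastD_append, h5, osc_of_true (bits_eq_true h6) (bits_ne_nil h2),
        getLastD_const (bits_eq_true h6) (bits_ne_nil h2)]
      simp
  | succ m ih =>
    obtain ⟨S₁, hS₁, A₁, hA₁, c, t, hS₁st, hA₁u, ht⟩ := ih
    obtain ⟨γ₀, hγ₀, hpro⟩ := exists_prolong (f := f) (n := n) (q := q) (T := [t m]) hθ hlamθ hC hI hIc hS₁st (hS₁.trans hSlam)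
      (fun δ hδ => hSθ δ (hS₁ hδ)) hA₁u (by simpa using (ht m le_rfl).1)
      (by simpa using (ht m le_rfl).2.1)
    obtain ⟨S₂, hS₂, u₁, hS₂st, hu₁, -, hS₂u, hA₂u⟩ := hpro γ₀ le_rfl hγ₀
    obtain ⟨S₃, hS₃, u₂, hS₃st, hu₂, hS₃u, hA₃u⟩ := exists_prolong_ne (f := f) (n := n) (q := q)
      (A := {i ∈ A₁ | ∀ p ∈ u₁, weight C p.1 i = p.2})
      (T := (t m ++ u₁) :: (List.range (m + 1)).map t) hθ hlamθ hC hI hIc hS₂st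
      (hS₂.trans (hS₁.trans hSlam)) (fun δ hδ => hSθ δ (hS₁ (hS₂ hδ)))
      (fun x hx => by
        obtain ⟨i, h1, h2, h3, h4⟩ := hA₂u x hx
        exact ⟨i, ⟨h1, h4⟩, h2, h3⟩)
      (by
        intro t' ht'
        rcases List.mem_cons.1 ht' with rfl | ht'
        · rw [List.length_append]
          exact (ht m le_rfl).1.trans (Nat.le_add_right _ _)
        · obtain ⟨k, hk, rfl⟩ := List.mem_map.1 ht'
          exact (ht k (Nat.lt_succ_iff.1 (List.mem_range.1 hk))).1)
      (by
        intro δ hδ t' ht'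
        rcases List.mem_cons.1 ht' with rfl | ht'
        · exact hS₂u δ hδ (t m) (by simp)
        · obtain ⟨k, hk, rfl⟩ := List.mem_map.1 ht'
          exact (ht k (Nat.lt_succ_iff.1 (List.mem_range.1 hk))).2.1 δ (hS₂ hδ))
    -- Appending agreement and then disagreement to `t m` adds one switch. The earlier labels
    -- receive only the disagreement, which adds none since their last bit is `true`.
    refine ⟨S₃, hS₃.trans (hS₂.trans hS₁),
      {i ∈ A₁ | (∀ p ∈ u₁, weight C p.1 i = p.2) ∧ ∀ p ∈ u₂, weight C p.1 i ≠ p.2},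
      fun i hi => hA₁ hi.1, c, fun k => if k ≤ m then t k ++ u₂ else t m ++ u₁ ++ u₂, hS₃st,
      fun x hx => ?_, fun k hk => ?_⟩
    · obtain ⟨i, ⟨h1, h2⟩, h3, h4, h5⟩ := hA₃u x hx
      exact ⟨i, ⟨h1, h2, h5⟩, h3, h4⟩
    · by_cases hkm : k ≤ m
      · simp only [hkm, if_true]
        obtain ⟨h1, -, h3⟩ := ht k hkm
        refine ⟨?_, fun δ hδ => hS₃u δ hδ _ (List.mem_cons_of_mem _ (List.mem_map.2
          ⟨k, List.mem_range.2 (Nat.lt_succ_of_le hkm), rfl⟩)), fun i hi => ?_⟩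
        · rw [List.length_append]; omega
        · obtain ⟨h4, h5⟩ := h3 i hi.1
          have h6 := bits_eq_true hi.2.2
          rw [bits_append, osc_append, getLastD_append, h4, h5, osc_of_true h6 (bits_ne_nil hu₂),
            getLastD_const h6 (bits_ne_nil hu₂)]
          simp
      · obtain rfl : k = m + 1 := by omega
        simp only [hkm, if_false]
        obtain ⟨h1, -, h3⟩ := ht m le_rfl
        refine ⟨?_, fun δ hδ => hS₃u δ hδ _ List.mem_cons_self, fun i hi => ?_⟩
        · rw [List.length_append, List.length_append]; omega
        · obtain ⟨h4, h5⟩ := h3 i hi.1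
          have h6 := bits_eq_true hi.2.2
          have h7 := bits_eq_false hi.2.1
          rw [bits_append, osc_append, getLastD_append, bits_append, osc_append, getLastD_append, h4, h5,
            osc_of_true h6 (bits_ne_nil hu₂), osc_of_false h7,
            getLastD_const h6 (bits_ne_nil hu₂), getLastD_const h7 (bits_ne_nil hu₁)]
          simp [add_assoc]

end Oscillation

/-- Suppose that `τ i` is always null; it equals some `n` for stationarily many `i`. Start from a
positive label `t₀` of walks ending at points of color `n`, so that the vertex with number
`t₀.length` has color `n`. Prolong it to labels with consecutive oscillations, and choose one for
which the walk continued to some such `i` has an oscillation number of valuation `t₀.length`. Then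
positively many `β` get the color `n` from the `i`-th coloring. -/
theorem hasColorings_of_eq_succ {lam θ : Cardinal.{u}} (hθ : θ.IsRegular) (hlamθ : lam = Order.succ θ)
    (N : Prop) : HasColorings lam θ N := by
  have hlam : lam.IsRegular := hlamθ ▸ Cardinal.isRegular_succ hθ.1
  have hθlam : θ < lam := hlamθ ▸ Order.lt_succ θ
  have hlam' : ℵ₀ < lam := hθ.1.trans_lt hθlam
  obtain ⟨C, hC⟩ := exists_isLadder θ
  obtain ⟨f, hfθ, hf⟩ := exists_partition hθ.1
    ((isStatIn_cof (Cardinal.isRegular_succ hθ.1) hθ (Order.lt_succ θ)).inter_club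
      (Cardinal.isRegular_succ hθ.1) (hlamθ ▸ hlam') isClubIn_Iio)
  rw [← hlamθ] at hC hf
  refine ⟨Iio lam.ord,
    fun i β => f (vertex C (padicValNat 2 (osc true (bits C i (label C i β)))) β i), ?_,
    fun _ _ _ => hfθ _, fun I hI hIc _ => ?_⟩
  · rw [Cardinal.mk_Iio_ordinal, Cardinal.card_ord]
  by_contra hcon
  push Not at hcon
  choose τ hτ hτI using hcon
  obtain ⟨n, hn, hA⟩ := (isClubIn_Iio.isStatIn hlam hlam').exists_biUnion hlam hlam' (s := Iio θ.ord)
    (f := fun i => if h : i < lam.ord then τ ⟨i, h⟩ else 0)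
    (by rw [Cardinal.mk_Iio_ordinal, Cardinal.card_ord]; exact Cardinal.lift_lt.2 hθlam)
    fun i hi _ => by
      rw [mem_Iio] at hi
      simp only [hi, dif_pos]; exact hτ _
  obtain ⟨S₀, hS₀, t₀, hS₀st, hS₀t⟩ := exists_labeled hθ hC hIc hlamθ hI (hf n hn)
    (fun δ hδ => hδ.1.1) fun δ hδ => hδ.2
  obtain ⟨S, hS, A, hAsub, c, t, hSst, hAu, ht⟩ := exists_labels_osc hθ hlamθ hC hI hIc hS₀st
    (fun δ hδ => (hS₀ hδ).1.2) (fun δ hδ => (hS₀ hδ).1.1) hA le_rfl hS₀t (2 ^ (t₀.length + 2))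
  obtain ⟨δ, hδS, hδlam, hδacc⟩ := isStatIn_iff.1 hSst _ (isClubIn_acc hlam hlam' fun x hx => by
    obtain ⟨i, h1, h2, h3⟩ := hAu (x + 1) ((Cardinal.isSuccLimit_ord hlam.1).add_one_lt hx)
    exact ⟨i, h1, (lt_add_one x).trans_le h2, h3⟩)
  have hδθ : δ.cof = θ := (hS₀ (hS hδS)).1.1
  have hδ0 : 0 < δ := pos_iff_ne_zero.2 hδacc.1
  have key : ∀ k, ∃ γ < δ, k ≤ 2 ^ (t₀.length + 2) → (∀ p ∈ t k, p.1 ≤ γ) ∧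
      {β ∈ labeled C f n lam.ord t₀.length δ (t k) |
        ∀ ξ, γ ≤ ξ → ξ < δ → weight C ξ β = weight C ξ δ} ∉ I := fun k => by
    by_cases hk : k ≤ 2 ^ (t₀.length + 2)
    · have hpos := (ht k hk).2.1 δ hδS
      obtain ⟨γ, hγ, hγpos⟩ := exists_labeled_coherent hθ hC hI hIc hδθ hδlam hpos
      obtain ⟨b, hb, hb'⟩ := exists_list_bound hδ0 ((t k).map Prod.fst) fun x hx => by
        obtain ⟨p, hp, rfl⟩ := List.mem_map.1 hx
        obtain ⟨β, h1, h2, h3, -⟩ := hI.nonempty_of_notMem hlam.ord_pos hpos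
        rw [← h3] at hp
        exact label_fst_lt hC hθ hδθ h1.le h2 p hp
      refine ⟨max γ b, max_lt hγ hb, fun _ => ⟨fun p hp =>
        (hb' _ (List.mem_map.2 ⟨p, hp, rfl⟩)).trans (le_max_right _ _), fun h =>
        hγpos (hI.mono _ h _ fun β hβ => ⟨hβ.1, fun ξ h1 h2 => hβ.2 ξ ((le_max_left _ _).trans h1) h2⟩)⟩⟩
    · exact ⟨0, hδ0, fun h => absurd h hk⟩
  choose γ hγ hγpos using key
  obtain ⟨γ', hγ', hγγ'⟩ := exists_list_bound hδ0 ((List.range (2 ^ (t₀.length + 2) + 1)).map γ)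
    fun x hx => by
      obtain ⟨k, -, rfl⟩ := List.mem_map.1 hx
      exact hγ k
  obtain ⟨x, hx, hγx⟩ := (hC δ hδlam).2.1 γ' hγ'
  obtain ⟨i, hi, hxi, hiδ⟩ := hδacc.2 x ((hC δ hδlam).1 hx)
  have hilam : i < lam.ord := hiδ.trans hδlam
  -- The walk from `δ` to `i` contributes a fixed number of oscillations, as the preceding bits end
  -- in the initial state `true`; `k` compensates for it.
  obtain ⟨k, hk, hkq⟩ := exists_padicValNat_eq t₀.length (c + osc true (bits C i (label C i δ)))
  have hkx : γ k ≤ x := (hγγ' _ (List.mem_map.2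
    ⟨k, List.mem_range.2 (Nat.lt_succ_of_le hk), rfl⟩)).trans hγx
  refine (hγpos k hk).2 (hI.mono _ (hτI ⟨i, hilam⟩) _ ?_)
  rintro β ⟨⟨h1, h2, h3, h4⟩, h5⟩
  refine ⟨h2, ?_⟩
  obtain ⟨h6, h7, -⟩ := label_append hC hiδ h1 h2 h3 (hγpos k hk).1 hx hkx hxi h5 fun ξ hξ =>
    (hC.trace_le hδlam hiδ.le zero_le ξ hξ).trans_lt hiδ
  obtain ⟨h8, -, h9⟩ := ht k hk
  obtain ⟨h10, h11⟩ := h9 i hi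
  have hval : padicValNat 2 (osc true (bits C i (label C i β))) = t₀.length := by
    rw [h6, bits_append, osc_append, h10, h11, ← hkq]
    congr 1
    omega
  have hτn := (hAsub hi).2
  simp only [hilam, dif_pos] at hτn
  show f (vertex C (padicValNat 2 (osc true (bits C i (label C i β)))) β i) = τ ⟨i, hilam⟩
  rw [hval, h7 _ h8, h4, hτn]

end ClubGuess

/-! ### The theorem -/

theorem theoremC
    -- an infinite cardinal `lam` below a regular cardinal `κ`, and a cardinal `θ`
    (κ lam θ : Cardinal.{u}) (hκ : κ.IsRegular) (hlam : ℵ₀ ≤ lam) (hlamκ : lam < κ)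
    -- a stationary subset `T` of `κ`
    (T : Set Ordinal.{u}) (hTκ : T ⊆ Set.Iio κ.ord) (hT : ClubGuess.IsStatIn T κ.ord)
    -- `lam`-complete ideals `J δ`
    (J : Ordinal.{u} → Set (Set Ordinal.{u}))
    (hJ : ∀ δ ∈ ClubGuess.E κ lam,
      ClubGuess.IsIdealOver (J δ) δ ∧ ClubGuess.IsComplete (J δ) lam)
    -- a `lam`-bounded C-sequence `C` that guesses clubs
    (C : Ordinal.{u} → Set Ordinal.{u})
    (hC : ∀ δ ∈ ClubGuess.E κ lam,
      ClubGuess.IsClubIn (C δ) δ ∧ ClubGuess.otp (C δ) ≤ lam.ord)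
    (hguess : ∀ D, ClubGuess.IsClubIn D κ.ord → ∃ δ ∈ ClubGuess.E κ lam,
      ClubGuess.IsPositive (J δ) δ {β | β < δ ∧ ClubGuess.next (C δ) β ∈ D ∩ T})
    -- any one of the four hypotheses
    (hyp :
      (θ = lam ∧ lam ^< lam = lam ∧ ∃ ν : Cardinal.{u}, lam = Order.succ ν) ∨
      (θ = lam ∧ ClubGuess.Diamond lam ∧ ¬ ClubGuess.IsMahlo lam) ∨
      (θ = lam ∧ ClubGuess.DiamondStar lam ∧
        ∀ δ ∈ ClubGuess.E κ lam, ClubGuess.IsNormalIdeal (J δ) δ) ∨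
      (θ < lam ∧ θ.IsRegular ∧ ¬ ClubGuess.IsGreatlyMahlo lam)) :
    ∃ h : Ordinal.{u} → Ordinal.{u}, (∀ i < lam.ord, h i < θ.ord) ∧
      ∀ D, ClubGuess.IsClubIn D κ.ord → ∃ δ ∈ ClubGuess.E κ lam, ∀ τ < θ.ord,
        ClubGuess.IsPositive (J δ) δ
          {β | β < δ ∧ h (ClubGuess.otp (C δ ∩ Set.Iio β)) = τ ∧
            ClubGuess.next (C δ) β ∈ D ∩ T} := by 
  -- Guessing the trivial club provides an ordinal of cofinality `lam`, so `lam` is regular.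
  obtain ⟨δ₀, hδ₀, -⟩ := hguess _ ClubGuess.isClubIn_Iio
  have hreg : lam.IsRegular := ClubGuess.isRegular_of_mem_E hlam hδ₀
  rcases hyp with ⟨rfl, hpow, ν, hν⟩ | ⟨rfl, hd, hM⟩ | ⟨rfl, hd, hnormal⟩ | ⟨hθlam, hθ, hM⟩
  · exact (ClubGuess.hasColorings_of_powerlt hreg hpow hν False).guess hκ hreg hlamκ hJ
      False.elim hC hguess
  · exact (ClubGuess.hasColorings_of_diamond hreg hd hM False).guess hκ hreg hlamκ hJ
      False.elim hC hguess
  · exact (ClubGuess.hasColorings_of_diamondStar hreg hd).guess hκ hreg hlamκ hJ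
      (fun _ => hnormal) hC hguess
  · rcases (Order.succ_le_of_lt hθlam).eq_or_lt with h | h
    · exact (ClubGuess.hasColorings_of_eq_succ hθ h.symm False).guess hκ hreg hlamκ hJ
        False.elim hC hguess
    · exact (ClubGuess.hasColorings_of_succ_lt hreg hθ h hM False).guess hκ hreg hlamκ hJ
        False.elim hC hguess
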